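/- **Proposition.** Let $\mathbf{Gray\text{-}Cat}$ be the category of small Gray-categories (categories enriched in strict 2-categories with the Gray tensor product) and Gray-functors, and let $\mathbf{Gray\text{-}Gpd}$ be its full subcategory of Gray-groupoids, i.e. Gray-categories in which all 1-cells, 2-cells and 3-cells are strictly invertible. Given 2-cells $\alpha:f\to f':A\to B$ and $\beta:g\to g':B\to C$, write $\beta_\alpha:\beta f'.g\alpha\to g'\alpha.\beta f$ for the pseudonaturality isomorphism. A morphism $F:\mathbb A\to\mathbb B$ of $\mathbf{Gray\text{-}Gpd}$ is called * a *fibration* if each 2-functor $F:\mathbb A(A,A')\to\mathbb B(FA,FA')$ lifts equivalences (for every object $f$ of the source and every equivalence $\beta:b\to Ff$ there is an equivalence $\alpha:a\to f$ with $F\alpha=\beta$) and lifts invertible 2-cells (for every 1-cell $\alpha$ of the source and every invertible 2-cell $N:b\to F\alpha$ there is an invertible 2-cell $M:a\to\alpha$ with $FM=N$), and if for every object $A$ of $\mathbb A$ and every biequivalence $g:B\to FA$ in $\mathbb B$ there is a biequivalence $f:A'\to A$ in $\mathbb A$ with $FA'=B$ and $Ff\simeq g$ in $\mathbb B(B,FA)$;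 * a *weak equivalence* if each $F:\mathbb A(A,A')\to\mathbb B(FA,FA')$ is a biequivalence of 2-categories and every object of $\mathbb B$ is biequivalent to an object $FA$; * a *trivial fibration* if it is both a fibration and a weak equivalence. Let $\mathbf{SSet}$ be the category of simplicial sets, with Kan fibrations as fibrations, and with weak homotopy equivalences as weak equivalences (maps $X\to Y$ inducing bijections $[Y,K]\to[X,K]$ on homotopy classes of maps for every Kan complex $K$); a trivial fibration is a map which is both. Let $N:\mathbf{Gray\text{-}Gpd}\to\mathbf{SSet}$ be Berger's nerve: an $n$-simplex of $N\mathbb A$ consists of objects $A_i$, 1-cells $f_{ij}:A_i\to A_j$, 2-cells $\alpha_{ijk}:f_{jk}f_{ij}\to f_{ik}$ and 3-cells $X_{ijkl}:\alpha_{ikl}.f_{kl}\alpha_{ijk}\to\alpha_{ijl}.\alpha_{jkl}f_{ij}$ of $\mathbb A$, for $0\le i\le j\le k\le l\le n$, which are identities as soon as two consecutive indices are equal, and such that for all $0\le i\le j\le k\le l\le m\le n$ the two pasting composites of 3-cells $$\alpha_{ilm}.f_{lm}\alpha_{ikl}.f_{lm}f_{kl}\alpha_{ijk}\longrightarrow\alpha_{ijm}.\alpha_{jkm}f_{ij}.\alpha_{klm}f_{jk}f_{ij}$$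 are equal, where one is the composite of whiskerings of $X_{ijkl}$, then $X_{ijlm}$, then $X_{jklm}$, and the other is the composite of whiskerings of $X_{iklm}$, then $(\alpha_{klm})_{\alpha_{ijk}}$, then $X_{ijkm}$. The simplicial structure is given by reindexing along monotone maps. Then $N$ has a left adjoint, sends fibrations to Kan fibrations, and sends trivial fibrations to trivial fibrations; that is, $N$ is a right Quillen functor. Moreover, for every trivial fibration $F$ of Gray-groupoids, $NF$ has the right lifting property with respect to the inclusions $\partial\Delta[n]\to\Delta[n]$ for all $n\ge 0$. -/

import Mathlib

open CategoryTheory HomotopicalAlgebra Simplicial Opposite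

open scoped SSet.modelCategoryQuillen

universe u

/-! ## Gray-categories

A (small) Gray-category is a category enriched in the category of strict 2-categories, equipped with
the Gray tensor product.  It is presented here in essentially algebraic form: there are sets of
0-, 1-, 2- and 3-cells, with source and target maps, and operations which are defined on composable
cells.  Composites are written in the functional order: `comp1 g f` is "`g` after `f`". -/

/-- The cells of a Gray-category with their sources and targets: a 3-dimensional globular set. -/
structure GrayCells where
  /-- objects -/
  C0 : Type u
  /-- 1-cells -/
  C1 : Type u
  /-- 2-cells -/
  C2 : Type u
  /-- 3-cells -/
  C3 : Type u
  s0 : C1 → C0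
  t0 : C1 → C0
  s1 : C2 → C1
  t1 : C2 → C1
  s2 : C3 → C2
  t2 : C3 → C2
  s0_t1 : ∀ α, s0 (t1 α) = s0 (s1 α)
  t0_t1 : ∀ α, t0 (t1 α) = t0 (s1 α)
  s1_t2 : ∀ M, s1 (t2 M) = s1 (s2 M)
  t1_t2 : ∀ M, t1 (t2 M) = t1 (s2 M)

attribute [simp] GrayCells.s0_t1 GrayCells.t0_t1 GrayCells.s1_t2 GrayCells.t1_t2

/-- The operations of a Gray-category with their sources and targets. -/
structure GrayOps extends GrayCells.{u} where
  /-- identity 1-cell -/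
  id1 : C0 → C1
  s0_id1 : ∀ A, s0 (id1 A) = A
  t0_id1 : ∀ A, t0 (id1 A) = A
  /-- composition of 1-cells -/
  comp1 : ∀ g f : C1, s0 g = t0 f → C1
  s0_comp1 : ∀ g f h, s0 (comp1 g f h) = s0 f
  t0_comp1 : ∀ g f h, t0 (comp1 g f h) = t0 g
  /-- identity 2-cell -/
  id2 : C1 → C2
  s1_id2 : ∀ f, s1 (id2 f) = f
  t1_id2 : ∀ f, t1 (id2 f) = f
  /-- vertical composition of 2-cells, i.e. the composition of 1-cells in the hom 2-categories -/
  comp2 : ∀ β α : C2, s1 β = t1 α → C2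
  s1_comp2 : ∀ β α h, s1 (comp2 β α h) = s1 α
  t1_comp2 : ∀ β α h, t1 (comp2 β α h) = t1 β
  /-- identity 3-cell -/
  id3 : C2 → C3
  s2_id3 : ∀ α, s2 (id3 α) = α
  t2_id3 : ∀ α, t2 (id3 α) = α
  /-- composition of 3-cells along a 2-cell, i.e. the vertical composition of 2-cells in the
  hom 2-categories -/
  comp3 : ∀ N M : C3, s2 N = t2 M → C3
  s2_comp3 : ∀ N M h, s2 (comp3 N M h) = s2 M
  t2_comp3 : ∀ N M h, t2 (comp3 N M h) = t2 N
  /-- composition of 3-cells along a 1-cell, i.e. the horizontal composition of 2-cells in the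
  hom 2-categories -/
  hcomp3 : ∀ N M : C3, s1 (s2 N) = t1 (s2 M) → C3
  s2_hcomp3 : ∀ N M h, s2 (hcomp3 N M h) = comp2 (s2 N) (s2 M) h
  t2_hcomp3 : ∀ N M h, t2 (hcomp3 N M h) = comp2 (t2 N) (t2 M) (by rw [s1_t2, t1_t2, h])
  /-- left whiskering `g α` of a 2-cell by a 1-cell -/
  wl2 : ∀ (g : C1) (α : C2), s0 g = t0 (s1 α) → C2
  s1_wl2 : ∀ g α h, s1 (wl2 g α h) = comp1 g (s1 α) h
  t1_wl2 : ∀ g α h, t1 (wl2 g α h) = comp1 g (t1 α) (by rw [t0_t1, h])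
  /-- right whiskering `β f` of a 2-cell by a 1-cell -/
  wr2 : ∀ (β : C2) (f : C1), s0 (s1 β) = t0 f → C2
  s1_wr2 : ∀ β f h, s1 (wr2 β f h) = comp1 (s1 β) f h
  t1_wr2 : ∀ β f h, t1 (wr2 β f h) = comp1 (t1 β) f (by rw [s0_t1, h])
  /-- left whiskering `g M` of a 3-cell by a 1-cell -/
  wl3 : ∀ (g : C1) (M : C3), s0 g = t0 (s1 (s2 M)) → C3
  s2_wl3 : ∀ g M h, s2 (wl3 g M h) = wl2 g (s2 M) h
  t2_wl3 : ∀ g M h, t2 (wl3 g M h) = wl2 g (t2 M) (by rw [s1_t2, h])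
  /-- right whiskering `N f` of a 3-cell by a 1-cell -/
  wr3 : ∀ (N : C3) (f : C1), s0 (s1 (s2 N)) = t0 f → C3
  s2_wr3 : ∀ N f h, s2 (wr3 N f h) = wr2 (s2 N) f h
  t2_wr3 : ∀ N f h, t2 (wr3 N f h) = wr2 (t2 N) f (by rw [s1_t2, h])
  /-- the pseudonaturality 3-cell `β_α : β f' . g α → g' α . β f` for `α : f → f' : A → B` and
  `β : g → g' : B → C` -/
  ich : ∀ β α : C2, s0 (s1 β) = t0 (s1 α) → C3
  s2_ich : ∀ β α h, s2 (ich β α h) =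
    comp2 (wr2 β (t1 α) (by rw [t0_t1, h])) (wl2 (s1 β) α h) (by rw [s1_wr2, t1_wl2])
  t2_ich : ∀ β α h, t2 (ich β α h) =
    comp2 (wl2 (t1 β) α (by rw [s0_t1, h])) (wr2 β (s1 α) h) (by rw [s1_wl2, t1_wr2])

attribute [simp] GrayOps.s0_id1 GrayOps.t0_id1 GrayOps.s0_comp1 GrayOps.t0_comp1
  GrayOps.s1_id2 GrayOps.t1_id2 GrayOps.s1_comp2 GrayOps.t1_comp2
  GrayOps.s2_id3 GrayOps.t2_id3 GrayOps.s2_comp3 GrayOps.t2_comp3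
  GrayOps.s2_hcomp3 GrayOps.t2_hcomp3 GrayOps.s1_wl2 GrayOps.t1_wl2 GrayOps.s1_wr2 GrayOps.t1_wr2
  GrayOps.s2_wl3 GrayOps.t2_wl3 GrayOps.s2_wr3 GrayOps.t2_wr3 GrayOps.s2_ich GrayOps.t2_ich

namespace GrayOps

variable (A : GrayOps.{u})

/-- A 1-cell is (strictly) invertible. -/
def IsInv1 (f : A.C1) : Prop :=
  ∃ (g : A.C1) (h : A.s0 g = A.t0 f) (h' : A.s0 f = A.t0 g),
    A.comp1 g f h = A.id1 (A.s0 f) ∧ A.comp1 f g h' = A.id1 (A.t0 f)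

/-- A 2-cell is (strictly) invertible. -/
def IsInv2 (α : A.C2) : Prop :=
  ∃ (β : A.C2) (h : A.s1 β = A.t1 α) (h' : A.s1 α = A.t1 β),
    A.comp2 β α h = A.id2 (A.s1 α) ∧ A.comp2 α β h' = A.id2 (A.t1 α)

/-- A 3-cell is (strictly) invertible. -/
def IsInv3 (M : A.C3) : Prop :=
  ∃ (N : A.C3) (h : A.s2 N = A.t2 M) (h' : A.s2 M = A.t2 N),
    A.comp3 N M h = A.id3 (A.s2 M) ∧ A.comp3 M N h' = A.id3 (A.t2 M)

/-- Two 2-cells are isomorphic. -/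
def Iso2 (α β : A.C2) : Prop := ∃ M : A.C3, A.IsInv3 M ∧ A.s2 M = α ∧ A.t2 M = β

/-- A 2-cell is an equivalence in its hom 2-category. -/
def IsEquiv2 (α : A.C2) : Prop :=
  ∃ (β : A.C2) (h : A.s1 β = A.t1 α) (h' : A.s1 α = A.t1 β),
    A.Iso2 (A.comp2 β α h) (A.id2 (A.s1 α)) ∧ A.Iso2 (A.comp2 α β h') (A.id2 (A.t1 α))

/-- Two 1-cells are equivalent objects of their hom 2-category. -/
def Equiv1 (f g : A.C1) : Prop := ∃ α : A.C2, A.IsEquiv2 α ∧ A.s1 α = f ∧ A.t1 α = g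

/-- A 1-cell is a biequivalence. -/
def IsBiequiv1 (f : A.C1) : Prop :=
  ∃ (g : A.C1) (h : A.s0 g = A.t0 f) (h' : A.s0 f = A.t0 g),
    A.Equiv1 (A.comp1 g f h) (A.id1 (A.s0 f)) ∧ A.Equiv1 (A.comp1 f g h') (A.id1 (A.t0 f))

end GrayOps

/-- The axioms of a Gray-category. -/
structure GrayOps.IsGray (A : GrayOps.{u}) : Prop where
  /- 1-cells form a category -/
  comp1_id1 : ∀ f, A.comp1 f (A.id1 (A.s0 f)) (by simp) = f
  id1_comp1 : ∀ f, A.comp1 (A.id1 (A.t0 f)) f (by simp) = f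
  comp1_assoc : ∀ h g f (p : A.s0 h = A.t0 g) (q : A.s0 g = A.t0 f),
    A.comp1 (A.comp1 h g p) f (by simp [q]) = A.comp1 h (A.comp1 g f q) (by simp [p])
  /- The 1-cells, 2-cells and 3-cells with given 0-source and 0-target form a strict 2-category. -/
  comp2_id2 : ∀ α, A.comp2 α (A.id2 (A.s1 α)) (by simp) = α
  id2_comp2 : ∀ α, A.comp2 (A.id2 (A.t1 α)) α (by simp) = α
  comp2_assoc : ∀ γ β α (p : A.s1 γ = A.t1 β) (q : A.s1 β = A.t1 α),
    A.comp2 (A.comp2 γ β p) α (by simp [q]) = A.comp2 γ (A.comp2 β α q) (by simp [p])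
  comp3_id3 : ∀ M, A.comp3 M (A.id3 (A.s2 M)) (by simp) = M
  id3_comp3 : ∀ M, A.comp3 (A.id3 (A.t2 M)) M (by simp) = M
  comp3_assoc : ∀ P N M (p : A.s2 P = A.t2 N) (q : A.s2 N = A.t2 M),
    A.comp3 (A.comp3 P N p) M (by simp [q]) = A.comp3 P (A.comp3 N M q) (by simp [p])
  hcomp3_id : ∀ M, A.hcomp3 M (A.id3 (A.id2 (A.s1 (A.s2 M)))) (by simp) = M
  id_hcomp3 : ∀ M, A.hcomp3 (A.id3 (A.id2 (A.t1 (A.s2 M)))) M (by simp) = M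
  hcomp3_assoc : ∀ P N M (p : A.s1 (A.s2 P) = A.t1 (A.s2 N)) (q : A.s1 (A.s2 N) = A.t1 (A.s2 M)),
    A.hcomp3 (A.hcomp3 P N p) M (by simp [q]) = A.hcomp3 P (A.hcomp3 N M q) (by simp [p])
  hcomp3_id3 : ∀ β α (p : A.s1 β = A.t1 α),
    A.hcomp3 (A.id3 β) (A.id3 α) (by simp [p]) = A.id3 (A.comp2 β α p)
  interchange : ∀ N' N M' M (p : A.s2 N' = A.t2 N) (q : A.s2 M' = A.t2 M) (r : A.s1 (A.s2 N) = A.t1 (A.s2 M)),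
    A.hcomp3 (A.comp3 N' N p) (A.comp3 M' M q) (by simp [r]) =
      A.comp3 (A.hcomp3 N' M' (by simp [p, q, r])) (A.hcomp3 N M r) (by simp [p, q])
  /- Left whiskering by a 1-cell is a 2-functor. -/
  wl2_id2 : ∀ g f (p : A.s0 g = A.t0 f), A.wl2 g (A.id2 f) (by simp [p]) = A.id2 (A.comp1 g f p)
  wl2_comp2 : ∀ g β α (p : A.s1 β = A.t1 α) (q : A.s0 g = A.t0 (A.s1 α)),
    A.wl2 g (A.comp2 β α p) (by simp [q]) = A.comp2 (A.wl2 g β (by simp [p, q])) (A.wl2 g α q) (by simp [p])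
  wl3_id3 : ∀ g α (p : A.s0 g = A.t0 (A.s1 α)), A.wl3 g (A.id3 α) (by simp [p]) = A.id3 (A.wl2 g α p)
  wl3_comp3 : ∀ g N M (p : A.s2 N = A.t2 M) (q : A.s0 g = A.t0 (A.s1 (A.s2 M))),
    A.wl3 g (A.comp3 N M p) (by simp [q]) = A.comp3 (A.wl3 g N (by simp [p, q])) (A.wl3 g M q) (by simp [p])
  wl3_hcomp3 : ∀ g N M (p : A.s1 (A.s2 N) = A.t1 (A.s2 M)) (q : A.s0 g = A.t0 (A.s1 (A.s2 M))),
    A.wl3 g (A.hcomp3 N M p) (by simp [q]) = A.hcomp3 (A.wl3 g N (by simp [p, q])) (A.wl3 g M q) (by simp [p])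
  /- Right whiskering by a 1-cell is a 2-functor. -/
  wr2_id2 : ∀ g f (p : A.s0 g = A.t0 f), A.wr2 (A.id2 g) f (by simp [p]) = A.id2 (A.comp1 g f p)
  wr2_comp2 : ∀ β α f (p : A.s1 β = A.t1 α) (q : A.s0 (A.s1 α) = A.t0 f),
    A.wr2 (A.comp2 β α p) f (by simp [q]) = A.comp2 (A.wr2 β f (by simp [p, q])) (A.wr2 α f q) (by simp [p])
  wr3_id3 : ∀ α f (p : A.s0 (A.s1 α) = A.t0 f), A.wr3 (A.id3 α) f (by simp [p]) = A.id3 (A.wr2 α f p)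
  wr3_comp3 : ∀ N M f (p : A.s2 N = A.t2 M) (q : A.s0 (A.s1 (A.s2 M)) = A.t0 f),
    A.wr3 (A.comp3 N M p) f (by simp [q]) = A.comp3 (A.wr3 N f (by simp [p, q])) (A.wr3 M f q) (by simp [p])
  wr3_hcomp3 : ∀ N M f (p : A.s1 (A.s2 N) = A.t1 (A.s2 M)) (q : A.s0 (A.s1 (A.s2 M)) = A.t0 f),
    A.wr3 (A.hcomp3 N M p) f (by simp [q]) = A.hcomp3 (A.wr3 N f (by simp [p, q])) (A.wr3 M f q) (by simp [p])
  /- Whiskerings are associative and unital. -/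
  id1_wl2 : ∀ α, A.wl2 (A.id1 (A.t0 (A.s1 α))) α (by simp) = α
  id1_wl3 : ∀ M, A.wl3 (A.id1 (A.t0 (A.s1 (A.s2 M)))) M (by simp) = M
  wr2_id1 : ∀ α, A.wr2 α (A.id1 (A.s0 (A.s1 α))) (by simp) = α
  wr3_id1 : ∀ M, A.wr3 M (A.id1 (A.s0 (A.s1 (A.s2 M)))) (by simp) = M
  comp1_wl2 : ∀ h g α (p : A.s0 h = A.t0 g) (q : A.s0 g = A.t0 (A.s1 α)),
    A.wl2 (A.comp1 h g p) α (by simp [q]) = A.wl2 h (A.wl2 g α q) (by simp [p])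
  comp1_wl3 : ∀ h g M (p : A.s0 h = A.t0 g) (q : A.s0 g = A.t0 (A.s1 (A.s2 M))),
    A.wl3 (A.comp1 h g p) M (by simp [q]) = A.wl3 h (A.wl3 g M q) (by simp [p])
  wr2_comp1 : ∀ α g f (p : A.s0 (A.s1 α) = A.t0 g) (q : A.s0 g = A.t0 f),
    A.wr2 α (A.comp1 g f q) (by simp [p]) = A.wr2 (A.wr2 α g p) f (by simp [q])
  wr3_comp1 : ∀ M g f (p : A.s0 (A.s1 (A.s2 M)) = A.t0 g) (q : A.s0 g = A.t0 f),
    A.wr3 M (A.comp1 g f q) (by simp [p]) = A.wr3 (A.wr3 M g p) f (by simp [q])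
  wr2_wl2 : ∀ g α f (p : A.s0 g = A.t0 (A.s1 α)) (q : A.s0 (A.s1 α) = A.t0 f),
    A.wr2 (A.wl2 g α p) f (by simp [q]) = A.wl2 g (A.wr2 α f q) (by simp [p])
  wr3_wl3 : ∀ g M f (p : A.s0 g = A.t0 (A.s1 (A.s2 M))) (q : A.s0 (A.s1 (A.s2 M)) = A.t0 f),
    A.wr3 (A.wl3 g M p) f (by simp [q]) = A.wl3 g (A.wr3 M f q) (by simp [p])
  /- The pseudonaturality 3-cells are invertible; they are unital, compatible with vertical
  composition, and natural in both variables. -/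
  ich_inv : ∀ β α p, A.IsInv3 (A.ich β α p)
  ich_id_left : ∀ g α (p : A.s0 g = A.t0 (A.s1 α)), A.ich (A.id2 g) α (by simp [p]) = A.id3 (A.wl2 g α p)
  ich_id_right : ∀ β f (p : A.s0 (A.s1 β) = A.t0 f), A.ich β (A.id2 f) (by simp [p]) = A.id3 (A.wr2 β f p)
  ich_comp_right : ∀ β α' α (p : A.s1 α' = A.t1 α) (q : A.s0 (A.s1 β) = A.t0 (A.s1 α)),
    A.ich β (A.comp2 α' α p) (by simp [q]) =
      A.comp3
        (A.hcomp3 (A.id3 (A.wl2 (A.t1 β) α' (by simp [p, q]))) (A.ich β α q) (by simp [p]))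
        (A.hcomp3 (A.ich β α' (by simp [p, q])) (A.id3 (A.wl2 (A.s1 β) α q)) (by simp [p]))
        (by simp [p, comp2_assoc])
  ich_comp_left : ∀ β' β α (p : A.s1 β' = A.t1 β) (q : A.s0 (A.s1 β) = A.t0 (A.s1 α)),
    A.ich (A.comp2 β' β p) α (by simp [q]) =
      A.comp3
        (A.hcomp3 (A.ich β' α (by simp [p, q])) (A.id3 (A.wr2 β (A.s1 α) q)) (by simp [p]))
        (A.hcomp3 (A.id3 (A.wr2 β' (A.t1 α) (by simp [p, q]))) (A.ich β α q) (by simp [p]))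
        (by simp [p, comp2_assoc])
  ich_natural_right : ∀ β M (p : A.s0 (A.s1 β) = A.t0 (A.s1 (A.s2 M))),
    A.comp3 (A.ich β (A.t2 M) (by simp [p]))
        (A.hcomp3 (A.id3 (A.wr2 β (A.t1 (A.s2 M)) (by simp [p]))) (A.wl3 (A.s1 β) M p) (by simp)) (by simp) =
      A.comp3 (A.hcomp3 (A.wl3 (A.t1 β) M (by simp [p])) (A.id3 (A.wr2 β (A.s1 (A.s2 M)) p)) (by simp))
        (A.ich β (A.s2 M) p) (by simp)
  ich_natural_left : ∀ N α (p : A.s0 (A.s1 (A.s2 N)) = A.t0 (A.s1 α)),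
    A.comp3 (A.ich (A.t2 N) α (by simp [p]))
        (A.hcomp3 (A.wr3 N (A.t1 α) (by simp [p])) (A.id3 (A.wl2 (A.s1 (A.s2 N)) α p)) (by simp)) (by simp) =
      A.comp3 (A.hcomp3 (A.id3 (A.wl2 (A.t1 (A.s2 N)) α (by simp [p]))) (A.wr3 N (A.s1 α) p) (by simp))
        (A.ich (A.s2 N) α p) (by simp)
  /- The pseudonaturality 3-cells are compatible with whiskering by 1-cells. -/
  wl3_ich : ∀ h β α (p : A.s0 h = A.t0 (A.s1 β)) (q : A.s0 (A.s1 β) = A.t0 (A.s1 α)),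
    A.wl3 h (A.ich β α q) (by simp [p]) = A.ich (A.wl2 h β p) α (by simp [q])
  ich_wr2 : ∀ β g α (p : A.s0 (A.s1 β) = A.t0 g) (q : A.s0 g = A.t0 (A.s1 α)),
    A.ich (A.wr2 β g p) α (by simp [q]) = A.ich β (A.wl2 g α q) (by simp [p])
  wr3_ich : ∀ β α f (p : A.s0 (A.s1 β) = A.t0 (A.s1 α)) (q : A.s0 (A.s1 α) = A.t0 f),
    A.wr3 (A.ich β α p) f (by simp [q]) = A.ich β (A.wr2 α f q) (by simp [p])

/-- A Gray-category. -/
structure GrayCat extends GrayOps.{u} where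
  isGray : toGrayOps.IsGray

/-- A Gray-functor: a map of cells preserving the whole structure. -/
@[ext]
structure GrayFunctor (A B : GrayCat.{u}) where
  F0 : A.C0 → B.C0
  F1 : A.C1 → B.C1
  F2 : A.C2 → B.C2
  F3 : A.C3 → B.C3
  s0_F1 : ∀ f, B.s0 (F1 f) = F0 (A.s0 f)
  t0_F1 : ∀ f, B.t0 (F1 f) = F0 (A.t0 f)
  s1_F2 : ∀ α, B.s1 (F2 α) = F1 (A.s1 α)
  t1_F2 : ∀ α, B.t1 (F2 α) = F1 (A.t1 α)
  s2_F3 : ∀ M, B.s2 (F3 M) = F2 (A.s2 M)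
  t2_F3 : ∀ M, B.t2 (F3 M) = F2 (A.t2 M)
  map_id1 : ∀ X, F1 (A.id1 X) = B.id1 (F0 X)
  map_id2 : ∀ f, F2 (A.id2 f) = B.id2 (F1 f)
  map_id3 : ∀ α, F3 (A.id3 α) = B.id3 (F2 α)
  map_comp1 : ∀ g f h, F1 (A.comp1 g f h) = B.comp1 (F1 g) (F1 f) (by rw [s0_F1, t0_F1, h])
  map_comp2 : ∀ β α h, F2 (A.comp2 β α h) = B.comp2 (F2 β) (F2 α) (by rw [s1_F2, t1_F2, h])
  map_comp3 : ∀ N M h, F3 (A.comp3 N M h) = B.comp3 (F3 N) (F3 M) (by rw [s2_F3, t2_F3, h])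
  map_hcomp3 : ∀ N M h, F3 (A.hcomp3 N M h) =
    B.hcomp3 (F3 N) (F3 M) (by rw [s2_F3, s2_F3, s1_F2, t1_F2, h])
  map_wl2 : ∀ g α h, F2 (A.wl2 g α h) = B.wl2 (F1 g) (F2 α) (by rw [s0_F1, s1_F2, t0_F1, h])
  map_wr2 : ∀ β f h, F2 (A.wr2 β f h) = B.wr2 (F2 β) (F1 f) (by rw [s1_F2, s0_F1, t0_F1, h])
  map_wl3 : ∀ g M h, F3 (A.wl3 g M h) =
    B.wl3 (F1 g) (F3 M) (by rw [s0_F1, s2_F3, s1_F2, t0_F1, h])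
  map_wr3 : ∀ N f h, F3 (A.wr3 N f h) =
    B.wr3 (F3 N) (F1 f) (by rw [s2_F3, s1_F2, s0_F1, t0_F1, h])
  map_ich : ∀ β α h, F3 (A.ich β α h) =
    B.ich (F2 β) (F2 α) (by rw [s1_F2, s1_F2, s0_F1, t0_F1, h])

attribute [simp] GrayFunctor.s0_F1 GrayFunctor.t0_F1 GrayFunctor.s1_F2 GrayFunctor.t1_F2
  GrayFunctor.s2_F3 GrayFunctor.t2_F3 GrayFunctor.map_id1 GrayFunctor.map_id2 GrayFunctor.map_id3
  GrayFunctor.map_comp1 GrayFunctor.map_comp2 GrayFunctor.map_comp3 GrayFunctor.map_hcomp3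
  GrayFunctor.map_wl2 GrayFunctor.map_wr2 GrayFunctor.map_wl3 GrayFunctor.map_wr3
  GrayFunctor.map_ich

namespace GrayFunctor

/-- The identity Gray-functor. -/
@[simps F0 F1 F2 F3]
def id (A : GrayCat.{u}) : GrayFunctor A A where
  F0 X := X
  F1 f := f
  F2 α := α
  F3 M := M
  s0_F1 _ := rfl
  t0_F1 _ := rfl
  s1_F2 _ := rfl
  t1_F2 _ := rfl
  s2_F3 _ := rfl
  t2_F3 _ := rfl
  map_id1 _ := rfl
  map_id2 _ := rfl
  map_id3 _ := rfl
  map_comp1 _ _ _ := rfl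
  map_comp2 _ _ _ := rfl
  map_comp3 _ _ _ := rfl
  map_hcomp3 _ _ _ := rfl
  map_wl2 _ _ _ := rfl
  map_wr2 _ _ _ := rfl
  map_wl3 _ _ _ := rfl
  map_wr3 _ _ _ := rfl
  map_ich _ _ _ := rfl

/-- The composite of Gray-functors (in diagrammatic order). -/
@[simps F0 F1 F2 F3]
def comp {A B C : GrayCat.{u}} (F : GrayFunctor A B) (G : GrayFunctor B C) : GrayFunctor A C where
  F0 X := G.F0 (F.F0 X)
  F1 f := G.F1 (F.F1 f)
  F2 α := G.F2 (F.F2 α)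
  F3 M := G.F3 (F.F3 M)
  s0_F1 _ := by simp
  t0_F1 _ := by simp
  s1_F2 _ := by simp
  t1_F2 _ := by simp
  s2_F3 _ := by simp
  t2_F3 _ := by simp
  map_id1 _ := by simp
  map_id2 _ := by simp
  map_id3 _ := by simp
  map_comp1 _ _ _ := by simp
  map_comp2 _ _ _ := by simp
  map_comp3 _ _ _ := by simp
  map_hcomp3 _ _ _ := by simp
  map_wl2 _ _ _ := by simp
  map_wr2 _ _ _ := by simp
  map_wl3 _ _ _ := by simp
  map_wr3 _ _ _ := by simp
  map_ich _ _ _ := by simp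

variable {A B : GrayCat.{u}} (F : GrayFunctor A B)

/-- A Gray-functor is a fibration if it induces fibrations of 2-categories on the homs (liftings of
equivalences, and liftings of invertible 2-cells, of the hom 2-categories) and if it induces an
isofibration on the categories `π_*` whose morphisms are the equivalence classes of 1-cells, so
that isomorphisms are represented by biequivalences. -/
structure IsFibration : Prop where
  lift_equiv : ∀ (f : A.C1) (β : B.C2), B.IsEquiv2 β → B.t1 β = F.F1 f →
    ∃ α : A.C2, A.IsEquiv2 α ∧ A.t1 α = f ∧ F.F2 α = β
  lift_iso : ∀ (α : A.C2) (N : B.C3), B.IsInv3 N → B.t2 N = F.F2 α →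
    ∃ M : A.C3, A.IsInv3 M ∧ A.t2 M = α ∧ F.F3 M = N
  lift_biequiv : ∀ (X : A.C0) (g : B.C1), B.IsBiequiv1 g → B.t0 g = F.F0 X →
    ∃ f : A.C1, A.IsBiequiv1 f ∧ A.t0 f = X ∧ B.Equiv1 (F.F1 f) g

/-- A Gray-functor is a weak equivalence (a triequivalence) if every object of the target is
biequivalent to one in the image, and if it induces biequivalences on the hom 2-categories:
every 1-cell between objects in the image is equivalent to one in the image, and the functors
between the categories of 2-cells and 3-cells with fixed boundary 1-cells are equivalences,
i.e. essentially surjective and fully faithful. -/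
structure IsWeakEquivalence : Prop where
  essSurj0 : ∀ Y : B.C0, ∃ (X : A.C0) (g : B.C1), B.IsBiequiv1 g ∧ B.s0 g = Y ∧ B.t0 g = F.F0 X
  essSurj1 : ∀ (X X' : A.C0) (g : B.C1), B.s0 g = F.F0 X → B.t0 g = F.F0 X' →
    ∃ f : A.C1, A.s0 f = X ∧ A.t0 f = X' ∧ B.Equiv1 g (F.F1 f)
  essSurj2 : ∀ f f' : A.C1, A.s0 f = A.s0 f' → A.t0 f = A.t0 f' →
    ∀ β : B.C2, B.s1 β = F.F1 f → B.t1 β = F.F1 f' →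
    ∃ α : A.C2, A.s1 α = f ∧ A.t1 α = f' ∧ B.Iso2 β (F.F2 α)
  fullyFaithful : ∀ α α' : A.C2, A.s1 α = A.s1 α' → A.t1 α = A.t1 α' →
    ∀ N : B.C3, B.s2 N = F.F2 α → B.t2 N = F.F2 α' →
    ∃! M : A.C3, A.s2 M = α ∧ A.t2 M = α' ∧ F.F3 M = N

end GrayFunctor

/-- The category **Gray-Cat** of small Gray-categories and Gray-functors. -/
instance : Category.{u} GrayCat.{u} where
  Hom := GrayFunctor
  id := GrayFunctor.id
  comp F G := F.comp G

/-- A Gray-groupoid is a Gray-category in which all 1-cells, 2-cells and 3-cells are strictly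
invertible. -/
def IsGrayGroupoid : ObjectProperty GrayCat.{u} := fun A =>
  (∀ f, A.IsInv1 f) ∧ (∀ α, A.IsInv2 α) ∧ (∀ M, A.IsInv3 M)

/-- The full subcategory **Gray-Gpd** of **Gray-Cat** consisting of the Gray-groupoids. -/
abbrev GrayGpd : Type (u + 1) := IsGrayGroupoid.{u}.FullSubcategory

/-- The fibrations of Gray-groupoids are those of Gray-categories. -/
instance : CategoryWithFibrations GrayGpd.{u} where
  fibrations := fun _ _ F => GrayFunctor.IsFibration F.hom

/-- The weak equivalences of Gray-groupoids are those of Gray-categories. -/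
instance : CategoryWithWeakEquivalences GrayGpd.{u} where
  weakEquivalences := fun _ _ F => GrayFunctor.IsWeakEquivalence F.hom

/-! ## The nerve -/

/-- The data of a simplex of the nerve of a Gray-category, with set of vertices a preorder `P`
(for an `n`-simplex, `P = {0 < ... < n}`): objects `A_i`, 1-cells `f_ij : A_i → A_j`,
2-cells `α_ijk : f_jk f_ij → f_ik` and 3-cells
`X_ijkl : α_ikl . f_kl α_ijk → α_ijl . α_jkl f_ij`, indexed by `i ≤ j ≤ k ≤ l`, which are
identities as soon as two consecutive indices coincide. -/
@[ext]
structure GraySimplexData (A : GrayCat.{u}) (P : Type) [Preorder P] where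
  ob : P → A.C0
  f : ∀ {i j : P}, i ≤ j → A.C1
  s0_f : ∀ {i j : P} (ij : i ≤ j), A.s0 (f ij) = ob i
  t0_f : ∀ {i j : P} (ij : i ≤ j), A.t0 (f ij) = ob j
  f_refl : ∀ i : P, f (le_refl i) = A.id1 (ob i)
  α : ∀ {i j k : P}, i ≤ j → j ≤ k → A.C2
  s1_α : ∀ {i j k : P} (ij : i ≤ j) (jk : j ≤ k),
    A.s1 (α ij jk) = A.comp1 (f jk) (f ij) (by rw [s0_f, t0_f])
  t1_α : ∀ {i j k : P} (ij : i ≤ j) (jk : j ≤ k), A.t1 (α ij jk) = f (ij.trans jk)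
  α_refl_left : ∀ {i j : P} (ij : i ≤ j), α (le_refl i) ij = A.id2 (f ij)
  α_refl_right : ∀ {i j : P} (ij : i ≤ j), α ij (le_refl j) = A.id2 (f ij)
  X : ∀ {i j k l : P}, i ≤ j → j ≤ k → k ≤ l → A.C3
  s2_X : ∀ {i j k l : P} (ij : i ≤ j) (jk : j ≤ k) (kl : k ≤ l),
    A.s2 (X ij jk kl) =
      A.comp2 (α (ij.trans jk) kl) (A.wl2 (f kl) (α ij jk) (by simp [s1_α, s0_f, t0_f]))
        (by simp [s1_α, t1_α])
  t2_X : ∀ {i j k l : P} (ij : i ≤ j) (jk : j ≤ k) (kl : k ≤ l),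
    A.t2 (X ij jk kl) =
      A.comp2 (α ij (jk.trans kl)) (A.wr2 (α jk kl) (f ij) (by simp [s1_α, s0_f, t0_f]))
        (by simp [s1_α, t1_α])
  X_refl_left : ∀ {i j k : P} (ij : i ≤ j) (jk : j ≤ k), X (le_refl i) ij jk = A.id3 (α ij jk)
  X_refl_mid : ∀ {i j k : P} (ij : i ≤ j) (jk : j ≤ k), X ij (le_refl j) jk = A.id3 (α ij jk)
  X_refl_right : ∀ {i j k : P} (ij : i ≤ j) (jk : j ≤ k), X ij jk (le_refl k) = A.id3 (α ij jk)

namespace GraySimplexData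

attribute [simp] s0_f t0_f s1_α t1_α s2_X t2_X

variable {A B : GrayCat.{u}} {P Q : Type} [Preorder P] [Preorder Q]

/-- One of the two pasting composites of 3-cells
`α_ade . f_de α_acd . f_de f_cd α_abc → α_abe . α_bce f_ab . α_cde f_bc f_ab`,
which are associated with `a ≤ b ≤ c ≤ d ≤ e`: it goes through the faces
`X_abcd`, then `X_abde`, then `X_bcde`. -/
def pasting₁ (x : GraySimplexData A P) {a b c d e : P}
    (ab : a ≤ b) (bc : b ≤ c) (cd : c ≤ d) (de : d ≤ e) : A.C3 :=
  A.comp3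
    (A.hcomp3 (A.id3 (x.α ab ((bc.trans cd).trans de)))
      (A.wr3 (x.X bc cd de) (x.f ab) (by simp)) (by simp))
    (A.comp3
      (A.hcomp3 (x.X ab (bc.trans cd) de)
        (A.id3 (A.wr2 (A.wl2 (x.f de) (x.α bc cd) (by simp)) (x.f ab) (by simp)))
        (by simp [A.isGray.comp1_assoc]))
      (A.hcomp3 (A.id3 (x.α ((ab.trans bc).trans cd) de))
        (A.wl3 (x.f de) (x.X ab bc cd) (by simp)) (by simp))
      (by simp [A.isGray.wl2_comp2, A.isGray.comp2_assoc, A.isGray.wr2_wl2]))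
    (by simp [A.isGray.wr2_comp2, A.isGray.comp2_assoc])

/-- The other pasting composite: it goes through the face `X_acde`, then the pseudonaturality
3-cell of `α_cde` and `α_abc`, then the face `X_abce`. -/
def pasting₂ (x : GraySimplexData A P) {a b c d e : P}
    (ab : a ≤ b) (bc : b ≤ c) (cd : c ≤ d) (de : d ≤ e) : A.C3 :=
  A.comp3
    (A.hcomp3 (x.X ab bc (cd.trans de))
      (A.id3 (A.wr2 (x.α cd de) (A.comp1 (x.f bc) (x.f ab) (by simp)) (by simp)))
      (by simp))
    (A.comp3
      (A.hcomp3 (A.id3 (x.α (ab.trans bc) (cd.trans de)))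
        (A.ich (x.α cd de) (x.α ab bc) (by simp)) (by simp))
      (A.hcomp3 (x.X (ab.trans bc) cd de)
        (A.id3 (A.wl2 (A.comp1 (x.f de) (x.f cd) (by simp)) (x.α ab bc) (by simp)))
        (by simp [A.isGray.comp1_assoc]))
      (by simp [A.isGray.comp2_assoc]))
    (by simp [A.isGray.comp2_assoc])

/-- The two pasting composites are parallel. -/
lemma s2_pasting (x : GraySimplexData A P) {a b c d e : P}
    (ab : a ≤ b) (bc : b ≤ c) (cd : c ≤ d) (de : d ≤ e) :
    A.s2 (x.pasting₁ ab bc cd de) = A.s2 (x.pasting₂ ab bc cd de) := by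
  simp [pasting₁, pasting₂, A.isGray.wl2_comp2, A.isGray.comp2_assoc, A.isGray.comp1_wl2]

/-- The two pasting composites are parallel. -/
lemma t2_pasting (x : GraySimplexData A P) {a b c d e : P}
    (ab : a ≤ b) (bc : b ≤ c) (cd : c ≤ d) (de : d ≤ e) :
    A.t2 (x.pasting₁ ab bc cd de) = A.t2 (x.pasting₂ ab bc cd de) := by
  simp [pasting₁, pasting₂, A.isGray.wr2_comp2, A.isGray.comp2_assoc, A.isGray.wr2_comp1]

/-- Reindexing along a monotone map. -/
@[simps ob f α X]
def reindex (x : GraySimplexData A P) (φ : Q →o P) : GraySimplexData A Q where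
  ob i := x.ob (φ i)
  f ij := x.f (φ.monotone ij)
  s0_f ij := x.s0_f (φ.monotone ij)
  t0_f ij := x.t0_f (φ.monotone ij)
  f_refl i := x.f_refl (φ i)
  α ij jk := x.α (φ.monotone ij) (φ.monotone jk)
  s1_α ij jk := x.s1_α (φ.monotone ij) (φ.monotone jk)
  t1_α ij jk := x.t1_α (φ.monotone ij) (φ.monotone jk)
  α_refl_left ij := x.α_refl_left (φ.monotone ij)
  α_refl_right ij := x.α_refl_right (φ.monotone ij)
  X ij jk kl := x.X (φ.monotone ij) (φ.monotone jk) (φ.monotone kl)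
  s2_X ij jk kl := x.s2_X (φ.monotone ij) (φ.monotone jk) (φ.monotone kl)
  t2_X ij jk kl := x.t2_X (φ.monotone ij) (φ.monotone jk) (φ.monotone kl)
  X_refl_left ij jk := x.X_refl_left (φ.monotone ij) (φ.monotone jk)
  X_refl_mid ij jk := x.X_refl_mid (φ.monotone ij) (φ.monotone jk)
  X_refl_right ij jk := x.X_refl_right (φ.monotone ij) (φ.monotone jk)

/-- The image by a Gray-functor. -/
@[simps ob f α X]
def map (F : GrayFunctor A B) (x : GraySimplexData A P) : GraySimplexData B P where
  ob i := F.F0 (x.ob i)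
  f ij := F.F1 (x.f ij)
  s0_f ij := by simp
  t0_f ij := by simp
  f_refl i := by simp [x.f_refl]
  α ij jk := F.F2 (x.α ij jk)
  s1_α ij jk := by simp
  t1_α ij jk := by simp
  α_refl_left ij := by simp [x.α_refl_left]
  α_refl_right ij := by simp [x.α_refl_right]
  X ij jk kl := F.F3 (x.X ij jk kl)
  s2_X ij jk kl := by simp
  t2_X ij jk kl := by simp
  X_refl_left ij jk := by simp [x.X_refl_left]
  X_refl_mid ij jk := by simp [x.X_refl_mid]
  X_refl_right ij jk := by simp [x.X_refl_right]

lemma map_pasting₁ (F : GrayFunctor A B) (x : GraySimplexData A P) {a b c d e : P}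
    (ab : a ≤ b) (bc : b ≤ c) (cd : c ≤ d) (de : d ≤ e) :
    (x.map F).pasting₁ ab bc cd de = F.F3 (x.pasting₁ ab bc cd de) := by
  simp [pasting₁]

lemma map_pasting₂ (F : GrayFunctor A B) (x : GraySimplexData A P) {a b c d e : P}
    (ab : a ≤ b) (bc : b ≤ c) (cd : c ≤ d) (de : d ≤ e) :
    (x.map F).pasting₂ ab bc cd de = F.F3 (x.pasting₂ ab bc cd de) := by
  simp [pasting₂]

end GraySimplexData

/-- A simplex of the nerve of a Gray-category, with set of vertices `P`: the two pasting composites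
agree on all 4-dimensional faces. -/
@[ext]
structure GraySimplex (A : GrayCat.{u}) (P : Type) [Preorder P] extends GraySimplexData A P where
  pasting_eq : ∀ {a b c d e : P} (ab : a ≤ b) (bc : b ≤ c) (cd : c ≤ d) (de : d ≤ e),
    toGraySimplexData.pasting₁ ab bc cd de = toGraySimplexData.pasting₂ ab bc cd de

namespace GraySimplex

variable {A B : GrayCat.{u}} {P Q : Type} [Preorder P] [Preorder Q]

/-- Reindexing along a monotone map. -/
def reindex (x : GraySimplex A P) (φ : Q →o P) : GraySimplex A Q where
  toGraySimplexData := x.toGraySimplexData.reindex φ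
  pasting_eq ab bc cd de :=
    x.pasting_eq (φ.monotone ab) (φ.monotone bc) (φ.monotone cd) (φ.monotone de)

/-- The image by a Gray-functor. -/
def map (F : GrayFunctor A B) (x : GraySimplex A P) : GraySimplex B P where
  toGraySimplexData := x.toGraySimplexData.map F
  pasting_eq ab bc cd de := by
    rw [GraySimplexData.map_pasting₁, GraySimplexData.map_pasting₂, x.pasting_eq]

end GraySimplex

/-- The nerve of Gray-categories. -/
def grayCatNerve : GrayCat.{u} ⥤ SSet.{u} where
  obj A :=
    { obj n := GraySimplex A (Fin (n.unop.len + 1))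
      map φ := ↾fun x => x.reindex φ.unop.toOrderHom
      map_id _ := rfl
      map_comp _ _ := rfl }
  map F :=
    { app _ := ↾fun x => x.map F
      naturality _ _ _ := rfl }
  map_id _ := rfl
  map_comp _ _ := rfl

/-- The nerve functor `N : Gray-Gpd ⥤ SSet`. -/
def grayNerve : GrayGpd.{u} ⥤ SSet.{u} := IsGrayGroupoid.ι ⋙ grayCatNerve

/-! ## Simplicial sets and Quillen functors -/

/-- A map of simplicial sets `f : X ⟶ Y` is a weak equivalence if, for every Kan complex `K`, it
induces a bijection `[Y, K] → [X, K]` on homotopy classes of maps. -/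
def IsSimplicialWeakEquivalence : MorphismProperty SSet.{u} := fun X Y f =>
  ∀ (K : SSet.{u}) [SSet.KanComplex K],
    (∀ g : X ⟶ K, ∃ h : Y ⟶ K, Nonempty (SSet.Homotopy (f ≫ h) g)) ∧
    (∀ h h' : Y ⟶ K, Nonempty (SSet.Homotopy (f ≫ h) (f ≫ h')) → Nonempty (SSet.Homotopy h h'))

/-- The weak equivalences of the Kan-Quillen model structure; the fibrations, provided by Mathlib,
are the Kan fibrations. -/
instance : CategoryWithWeakEquivalences SSet.{u} where
  weakEquivalences := IsSimplicialWeakEquivalence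

/-- A right Quillen functor: a functor which has a left adjoint, and which preserves fibrations and
trivial fibrations. -/
structure IsRightQuillen {C D : Type*} [Category* C] [Category* D]
    [CategoryWithFibrations C] [CategoryWithWeakEquivalences C]
    [CategoryWithFibrations D] [CategoryWithWeakEquivalences D] (G : D ⥤ C) : Prop where
  isRightAdjoint : G.IsRightAdjoint
  fibrations_map : ∀ ⦃X Y : D⦄ (p : X ⟶ Y), fibrations D p → fibrations C (G.map p)
  trivialFibrations_map :
    ∀ ⦃X Y : D⦄ (p : X ⟶ Y), trivialFibrations D p → trivialFibrations C (G.map p)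

-- The proof splits into a lifting argument, a homotopy argument and the construction of the left
-- adjoint.
--
-- Lifting. A simplex of the nerve amounts to cells on the strictly increasing tuples of at most
-- four vertices, subject to one equation of 3-cells for each strictly increasing 5-tuple. A lifting
-- problem against a horn or a boundary therefore asks for the missing cells above given ones, and
-- for the missing equations (`PartialLift.hasExtension`). A horn of dimension n ≤ 3 lacks an
-- (n-1)-cell and an n-cell. Since whiskerings and compositions by cells of a Gray-groupoid are
-- invertible, the known factors can be moved to the target side, so that the unknown cell becomes
-- the source of a cell with known target, which a fibration lifts. For n = 1 the lift exists at
-- first only up to equivalence, and is corrected by lifting that equivalence. In dimension 4, the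
-- missing tetrahedron is the unique solution of the pasting equation, and uniqueness in the target
-- forces it to lie above the prescribed one. In dimension 5 only one pasting equation is missing.
-- The ways to remove the interior vertices 1, 2, 3, 4 one by one from the path 0 → 1 → … → 5 are
-- the vertices of a 3-dimensional permutohedron. Six of its hexagons are the pasting equations of
-- the six faces, the two other hexagons commute by naturality of the pseudonaturality cells, and
-- its six squares commute by interchange. All edges are invertible, so five of the equations imply
-- the sixth (`GraySimplexData.pasting_of_horn`). In higher dimensions nothing is missing.
--
-- Boundaries are treated in the same way for a trivial fibration. In dimensions 0, 1, 2 the weak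
-- equivalence provides the missing cell up to equivalence and the fibration makes it strict;
-- dimension 3 is fullness on 3-cells, dimension 4 is faithfulness, and beyond that nothing is
-- missing.
--
-- Homotopy. A map that lifts against boundary inclusions lifts against all monomorphisms. It thus
-- has a section which is also a homotopy inverse, and hence induces bijections on homotopy classes
-- of maps to every Kan complex (`SSet.isSimplicialWeakEquivalence_of_rlp`).
--
-- Left adjoint. For a simplicial set X, consider all maps from X to nerves of Gray-groupoids. The
-- product of these Gray-groupoids is too large, but the part of it generated by the cells of the
-- images of the simplices of X is small. It is initial among the Gray-groupoids under X: the
-- projections give existence, and generation gives uniqueness (`SSet.freeUnitIsInitial`).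

universe w

set_option linter.unusedSectionVars false

namespace GrayCat

variable (A : GrayCat.{u})

/-! ### The axioms of a Gray-category as rewriting rules

The composability conditions are arbitrary proofs, and the units are recognised even when their
boundary is not syntactically the one of the other cell. -/

@[simp]
lemma comp1_id1 (f : A.C1) (X : A.C0) (h : A.s0 f = A.t0 (A.id1 X)) :
    A.comp1 f (A.id1 X) h = f := by
  obtain rfl : A.s0 f = X := by simpa using h
  exact A.isGray.comp1_id1 f

@[simp]
lemma id1_comp1 (f : A.C1) (X : A.C0) (h : A.s0 (A.id1 X) = A.t0 f) :
    A.comp1 (A.id1 X) f h = f := by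
  obtain rfl : X = A.t0 f := by simpa using h
  exact A.isGray.id1_comp1 f

@[simp]
lemma comp1_assoc (h g f : A.C1) (p : A.s0 h = A.t0 g) (q : A.s0 (A.comp1 h g p) = A.t0 f) :
    A.comp1 (A.comp1 h g p) f q =
      A.comp1 h (A.comp1 g f (by simpa using q)) (by simp [p]) :=
  A.isGray.comp1_assoc h g f p (by simpa using q)

@[simp]
lemma comp2_id2 (α : A.C2) (f : A.C1) (h : A.s1 α = A.t1 (A.id2 f)) :
    A.comp2 α (A.id2 f) h = α := by
  obtain rfl : A.s1 α = f := by simpa using h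
  exact A.isGray.comp2_id2 α

@[simp]
lemma id2_comp2 (α : A.C2) (f : A.C1) (h : A.s1 (A.id2 f) = A.t1 α) :
    A.comp2 (A.id2 f) α h = α := by
  obtain rfl : f = A.t1 α := by simpa using h
  exact A.isGray.id2_comp2 α

@[simp]
lemma comp2_assoc (γ β α : A.C2) (p : A.s1 γ = A.t1 β) (q : A.s1 (A.comp2 γ β p) = A.t1 α) :
    A.comp2 (A.comp2 γ β p) α q =
      A.comp2 γ (A.comp2 β α (by simpa using q)) (by simp [p]) :=
  A.isGray.comp2_assoc γ β α p (by simpa using q)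

@[simp]
lemma comp3_id3 (M : A.C3) (α : A.C2) (h : A.s2 M = A.t2 (A.id3 α)) :
    A.comp3 M (A.id3 α) h = M := by
  obtain rfl : A.s2 M = α := by simpa using h
  exact A.isGray.comp3_id3 M

@[simp]
lemma id3_comp3 (M : A.C3) (α : A.C2) (h : A.s2 (A.id3 α) = A.t2 M) :
    A.comp3 (A.id3 α) M h = M := by
  obtain rfl : α = A.t2 M := by simpa using h
  exact A.isGray.id3_comp3 M

@[simp]
lemma comp3_assoc (P N M : A.C3) (p : A.s2 P = A.t2 N) (q : A.s2 (A.comp3 P N p) = A.t2 M) :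
    A.comp3 (A.comp3 P N p) M q =
      A.comp3 P (A.comp3 N M (by simpa using q)) (by simp [p]) :=
  A.isGray.comp3_assoc P N M p (by simpa using q)

@[simp]
lemma hcomp3_id3_id2 (M : A.C3) (f : A.C1) (h : A.s1 (A.s2 M) = A.t1 (A.s2 (A.id3 (A.id2 f)))) :
    A.hcomp3 M (A.id3 (A.id2 f)) h = M := by
  obtain rfl : A.s1 (A.s2 M) = f := by simpa using h
  exact A.isGray.hcomp3_id M

@[simp]
lemma id3_id2_hcomp3 (M : A.C3) (f : A.C1) (h : A.s1 (A.s2 (A.id3 (A.id2 f))) = A.t1 (A.s2 M)) :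
    A.hcomp3 (A.id3 (A.id2 f)) M h = M := by
  obtain rfl : f = A.t1 (A.s2 M) := by simpa using h
  exact A.isGray.id_hcomp3 M

@[simp]
lemma hcomp3_assoc (P N M : A.C3) (p : A.s1 (A.s2 P) = A.t1 (A.s2 N))
    (q : A.s1 (A.s2 (A.hcomp3 P N p)) = A.t1 (A.s2 M)) :
    A.hcomp3 (A.hcomp3 P N p) M q =
      A.hcomp3 P (A.hcomp3 N M (by simpa using q)) (by simp [p]) :=
  A.isGray.hcomp3_assoc P N M p (by simpa using q)

lemma hcomp3_id3 (β α : A.C2) (p : A.s1 (A.s2 (A.id3 β)) = A.t1 (A.s2 (A.id3 α))) :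
    A.hcomp3 (A.id3 β) (A.id3 α) p = A.id3 (A.comp2 β α (by simpa using p)) :=
  A.isGray.hcomp3_id3 β α (by simpa using p)

/-- The orientation is opposite to that of `hcomp3_id3`, and neither is a simp rule: merging
identities serves cancellations and degenerate simplices, while splitting them brings the squares of
the permutohedron to the form of their edges. -/
lemma id3_comp2 (β α : A.C2) (p : A.s1 β = A.t1 α) :
    A.id3 (A.comp2 β α p) = A.hcomp3 (A.id3 β) (A.id3 α) (by simp [p]) :=
  (A.isGray.hcomp3_id3 β α p).symm

lemma id3_hcomp3_comp3 (β : A.C2) (N M : A.C3) (p : A.s2 N = A.t2 M)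
    (q : A.s1 (A.s2 (A.id3 β)) = A.t1 (A.s2 (A.comp3 N M p))) :
    A.hcomp3 (A.id3 β) (A.comp3 N M p) q =
      A.comp3 (A.hcomp3 (A.id3 β) N (by simpa [p] using q))
        (A.hcomp3 (A.id3 β) M (by simpa using q)) (by simp [p]) := by
  rw [← A.isGray.interchange _ _ _ _ (by simp) p (by simpa using q)]
  simp

lemma comp3_hcomp3_id3 (N M : A.C3) (β : A.C2) (p : A.s2 N = A.t2 M)
    (q : A.s1 (A.s2 (A.comp3 N M p)) = A.t1 (A.s2 (A.id3 β))) :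
    A.hcomp3 (A.comp3 N M p) (A.id3 β) q =
      A.comp3 (A.hcomp3 N (A.id3 β) (by simpa [p] using q))
        (A.hcomp3 M (A.id3 β) (by simpa using q)) (by simp [p]) := by
  rw [← A.isGray.interchange _ _ _ _ p (by simp) (by simpa using q)]
  simp

/-- Two 3-cells that are horizontally composable can be composed in either order. -/
lemma hcomp3_comm (N M : A.C3) (h : A.s1 (A.s2 N) = A.t1 (A.s2 M)) :
    A.comp3 (A.hcomp3 N (A.id3 (A.t2 M)) (by simp [h])) (A.hcomp3 (A.id3 (A.s2 N)) M (by simp [h]))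
        (by simp) =
      A.comp3 (A.hcomp3 (A.id3 (A.t2 N)) M (by simp [h]))
        (A.hcomp3 N (A.id3 (A.s2 M)) (by simp [h])) (by simp) := by
  rw [← A.isGray.interchange _ _ _ _ (by simp) (by simp) (by simpa using h),
    ← A.isGray.interchange _ _ _ _ (by simp) (by simp) (by simpa using h)]
  simp

@[simp]
lemma wl2_id2 (g f : A.C1) (p : A.s0 g = A.t0 (A.s1 (A.id2 f))) :
    A.wl2 g (A.id2 f) p = A.id2 (A.comp1 g f (by simpa using p)) :=
  A.isGray.wl2_id2 g f (by simpa using p)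

@[simp]
lemma wl2_comp2 (g : A.C1) (β α : A.C2) (p : A.s1 β = A.t1 α)
    (q : A.s0 g = A.t0 (A.s1 (A.comp2 β α p))) :
    A.wl2 g (A.comp2 β α p) q =
      A.comp2 (A.wl2 g β (by simpa [p] using q)) (A.wl2 g α (by simpa using q)) (by simp [p]) :=
  A.isGray.wl2_comp2 g β α p (by simpa using q)

@[simp]
lemma wl3_id3 (g : A.C1) (α : A.C2) (p : A.s0 g = A.t0 (A.s1 (A.s2 (A.id3 α)))) :
    A.wl3 g (A.id3 α) p = A.id3 (A.wl2 g α (by simpa using p)) :=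
  A.isGray.wl3_id3 g α (by simpa using p)

@[simp]
lemma wl3_comp3 (g : A.C1) (N M : A.C3) (p : A.s2 N = A.t2 M)
    (q : A.s0 g = A.t0 (A.s1 (A.s2 (A.comp3 N M p)))) :
    A.wl3 g (A.comp3 N M p) q =
      A.comp3 (A.wl3 g N (by simpa [p] using q)) (A.wl3 g M (by simpa using q)) (by simp [p]) :=
  A.isGray.wl3_comp3 g N M p (by simpa using q)

@[simp]
lemma wl3_hcomp3 (g : A.C1) (N M : A.C3) (p : A.s1 (A.s2 N) = A.t1 (A.s2 M))
    (q : A.s0 g = A.t0 (A.s1 (A.s2 (A.hcomp3 N M p)))) :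
    A.wl3 g (A.hcomp3 N M p) q =
      A.hcomp3 (A.wl3 g N (by rw [p, A.t0_t1]; simpa using q)) (A.wl3 g M (by simpa using q))
        (by simp [p]) :=
  A.isGray.wl3_hcomp3 g N M p (by simpa using q)

@[simp]
lemma wr2_id2 (g f : A.C1) (p : A.s0 (A.s1 (A.id2 g)) = A.t0 f) :
    A.wr2 (A.id2 g) f p = A.id2 (A.comp1 g f (by simpa using p)) :=
  A.isGray.wr2_id2 g f (by simpa using p)

@[simp]
lemma wr2_comp2 (β α : A.C2) (f : A.C1) (p : A.s1 β = A.t1 α)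
    (q : A.s0 (A.s1 (A.comp2 β α p)) = A.t0 f) :
    A.wr2 (A.comp2 β α p) f q =
      A.comp2 (A.wr2 β f (by simpa [p] using q)) (A.wr2 α f (by simpa using q)) (by simp [p]) :=
  A.isGray.wr2_comp2 β α f p (by simpa using q)

@[simp]
lemma wr3_id3 (α : A.C2) (f : A.C1) (p : A.s0 (A.s1 (A.s2 (A.id3 α))) = A.t0 f) :
    A.wr3 (A.id3 α) f p = A.id3 (A.wr2 α f (by simpa using p)) :=
  A.isGray.wr3_id3 α f (by simpa using p)

@[simp]
lemma wr3_comp3 (N M : A.C3) (f : A.C1) (p : A.s2 N = A.t2 M)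
    (q : A.s0 (A.s1 (A.s2 (A.comp3 N M p))) = A.t0 f) :
    A.wr3 (A.comp3 N M p) f q =
      A.comp3 (A.wr3 N f (by simpa [p] using q)) (A.wr3 M f (by simpa using q)) (by simp [p]) :=
  A.isGray.wr3_comp3 N M f p (by simpa using q)

@[simp]
lemma wr3_hcomp3 (N M : A.C3) (f : A.C1) (p : A.s1 (A.s2 N) = A.t1 (A.s2 M))
    (q : A.s0 (A.s1 (A.s2 (A.hcomp3 N M p))) = A.t0 f) :
    A.wr3 (A.hcomp3 N M p) f q =
      A.hcomp3 (A.wr3 N f (by rw [p, A.s0_t1]; simpa using q)) (A.wr3 M f (by simpa using q))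
        (by simp [p]) :=
  A.isGray.wr3_hcomp3 N M f p (by simpa using q)

@[simp]
lemma id1_wl2 (X : A.C0) (α : A.C2) (p : A.s0 (A.id1 X) = A.t0 (A.s1 α)) :
    A.wl2 (A.id1 X) α p = α := by
  obtain rfl : X = A.t0 (A.s1 α) := by simpa using p
  exact A.isGray.id1_wl2 α

@[simp]
lemma id1_wl3 (X : A.C0) (M : A.C3) (p : A.s0 (A.id1 X) = A.t0 (A.s1 (A.s2 M))) :
    A.wl3 (A.id1 X) M p = M := by
  obtain rfl : X = A.t0 (A.s1 (A.s2 M)) := by simpa using p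
  exact A.isGray.id1_wl3 M

@[simp]
lemma wr2_id1 (α : A.C2) (X : A.C0) (p : A.s0 (A.s1 α) = A.t0 (A.id1 X)) :
    A.wr2 α (A.id1 X) p = α := by
  obtain rfl : A.s0 (A.s1 α) = X := by simpa using p
  exact A.isGray.wr2_id1 α

@[simp]
lemma wr3_id1 (M : A.C3) (X : A.C0) (p : A.s0 (A.s1 (A.s2 M)) = A.t0 (A.id1 X)) :
    A.wr3 M (A.id1 X) p = M := by
  obtain rfl : A.s0 (A.s1 (A.s2 M)) = X := by simpa using p
  exact A.isGray.wr3_id1 M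

@[simp]
lemma comp1_wl2 (h g : A.C1) (α : A.C2) (p : A.s0 h = A.t0 g)
    (q : A.s0 (A.comp1 h g p) = A.t0 (A.s1 α)) :
    A.wl2 (A.comp1 h g p) α q = A.wl2 h (A.wl2 g α (by simpa using q)) (by simp [p]) :=
  A.isGray.comp1_wl2 h g α p (by simpa using q)

@[simp]
lemma comp1_wl3 (h g : A.C1) (M : A.C3) (p : A.s0 h = A.t0 g)
    (q : A.s0 (A.comp1 h g p) = A.t0 (A.s1 (A.s2 M))) :
    A.wl3 (A.comp1 h g p) M q = A.wl3 h (A.wl3 g M (by simpa using q)) (by simp [p]) :=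
  A.isGray.comp1_wl3 h g M p (by simpa using q)

@[simp]
lemma wr2_comp1 (α : A.C2) (g f : A.C1) (q : A.s0 g = A.t0 f)
    (p : A.s0 (A.s1 α) = A.t0 (A.comp1 g f q)) :
    A.wr2 α (A.comp1 g f q) p = A.wr2 (A.wr2 α g (by simpa using p)) f (by simp [q]) :=
  A.isGray.wr2_comp1 α g f (by simpa using p) q

@[simp]
lemma wr3_comp1 (M : A.C3) (g f : A.C1) (q : A.s0 g = A.t0 f)
    (p : A.s0 (A.s1 (A.s2 M)) = A.t0 (A.comp1 g f q)) :
    A.wr3 M (A.comp1 g f q) p = A.wr3 (A.wr3 M g (by simpa using p)) f (by simp [q]) :=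
  A.isGray.wr3_comp1 M g f (by simpa using p) q

@[simp]
lemma wr2_wl2 (g : A.C1) (α : A.C2) (f : A.C1) (p : A.s0 g = A.t0 (A.s1 α))
    (q : A.s0 (A.s1 (A.wl2 g α p)) = A.t0 f) :
    A.wr2 (A.wl2 g α p) f q = A.wl2 g (A.wr2 α f (by simpa using q)) (by simp [p]) :=
  A.isGray.wr2_wl2 g α f p (by simpa using q)

@[simp]
lemma wr3_wl3 (g : A.C1) (M : A.C3) (f : A.C1) (p : A.s0 g = A.t0 (A.s1 (A.s2 M)))
    (q : A.s0 (A.s1 (A.s2 (A.wl3 g M p))) = A.t0 f) :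
    A.wr3 (A.wl3 g M p) f q = A.wl3 g (A.wr3 M f (by simpa using q)) (by simp [p]) :=
  A.isGray.wr3_wl3 g M f p (by simpa using q)

@[simp]
lemma ich_id2_left (g : A.C1) (α : A.C2) (p : A.s0 (A.s1 (A.id2 g)) = A.t0 (A.s1 α)) :
    A.ich (A.id2 g) α p = A.id3 (A.wl2 g α (by simpa using p)) :=
  A.isGray.ich_id_left g α (by simpa using p)

@[simp]
lemma ich_id2_right (β : A.C2) (f : A.C1) (p : A.s0 (A.s1 β) = A.t0 (A.s1 (A.id2 f))) :
    A.ich β (A.id2 f) p = A.id3 (A.wr2 β f (by simpa using p)) :=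
  A.isGray.ich_id_right β f (by simpa using p)

@[simp]
lemma wl3_ich (h : A.C1) (β α : A.C2) (q : A.s0 (A.s1 β) = A.t0 (A.s1 α))
    (p : A.s0 h = A.t0 (A.s1 (A.s2 (A.ich β α q)))) :
    A.wl3 h (A.ich β α q) p = A.ich (A.wl2 h β (by simpa using p)) α (by simp [q]) :=
  A.isGray.wl3_ich h β α (by simpa using p) q

@[simp]
lemma ich_wr2 (β : A.C2) (g : A.C1) (α : A.C2) (p : A.s0 (A.s1 β) = A.t0 g)
    (q : A.s0 (A.s1 (A.wr2 β g p)) = A.t0 (A.s1 α)) :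
    A.ich (A.wr2 β g p) α q = A.ich β (A.wl2 g α (by simpa using q)) (by simp [p]) :=
  A.isGray.ich_wr2 β g α p (by simpa using q)

@[simp]
lemma wr3_ich (β α : A.C2) (f : A.C1) (p : A.s0 (A.s1 β) = A.t0 (A.s1 α))
    (q : A.s0 (A.s1 (A.s2 (A.ich β α p))) = A.t0 f) :
    A.wr3 (A.ich β α p) f q = A.ich β (A.wr2 α f (by simpa using q)) (by simp [p]) :=
  A.isGray.wr3_ich β α f p (by simpa using q)

lemma ich_comp2_right (β α' α : A.C2) (p : A.s1 α' = A.t1 α)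
    (q : A.s0 (A.s1 β) = A.t0 (A.s1 (A.comp2 α' α p))) :
    A.ich β (A.comp2 α' α p) q =
      A.comp3
        (A.hcomp3 (A.id3 (A.wl2 (A.t1 β) α' (by simp at q; simp [p, q])))
          (A.ich β α (by simpa using q)) (by simp [p]))
        (A.hcomp3 (A.ich β α' (by simp at q; simp [p, q]))
          (A.id3 (A.wl2 (A.s1 β) α (by simpa using q))) (by simp [p]))
        (by simp [p]) :=
  A.isGray.ich_comp_right β α' α p (by simpa using q)

lemma ich_comp2_left (β' β α : A.C2) (p : A.s1 β' = A.t1 β)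
    (q : A.s0 (A.s1 (A.comp2 β' β p)) = A.t0 (A.s1 α)) :
    A.ich (A.comp2 β' β p) α q =
      A.comp3
        (A.hcomp3 (A.ich β' α (by simp at q; simp [p, q]))
          (A.id3 (A.wr2 β (A.s1 α) (by simpa using q))) (by simp [p]))
        (A.hcomp3 (A.id3 (A.wr2 β' (A.t1 α) (by simp at q; simp [p, q])))
          (A.ich β α (by simpa using q)) (by simp [p]))
        (by simp [p]) :=
  A.isGray.ich_comp_left β' β α p (by simpa using q)

end GrayCat

namespace GrayCat

variable {A : GrayCat.{u}}

/-! ### Cancellation of invertible cells -/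

/-- Whiskering by an invertible cell is undone by whiskering with its inverse. These four
cancellations are the reason why a pasting equation on a face is not merely sufficient but
equivalent to the corresponding whiskered equation in the permutohedron. -/
lemma hcomp3_id3_cancel {γ : A.C2} (hγ : A.IsInv2 γ) {M N : A.C3}
    {h : A.s1 (A.s2 M) = A.t1 (A.s2 (A.id3 γ))} {h' : A.s1 (A.s2 N) = A.t1 (A.s2 (A.id3 γ))}
    (e : A.hcomp3 M (A.id3 γ) h = A.hcomp3 N (A.id3 γ) h') : M = N := by
  obtain ⟨δ, p, p', -, e₂⟩ := hγ
  have : A.hcomp3 (A.hcomp3 M (A.id3 γ) h) (A.id3 δ) (by simp [p']) =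
      A.hcomp3 (A.hcomp3 N (A.id3 γ) h') (A.id3 δ) (by simp [p']) := by simp only [e]
  simpa [hcomp3_id3, e₂] using this

lemma id3_hcomp3_cancel {γ : A.C2} (hγ : A.IsInv2 γ) {M N : A.C3}
    {h : A.s1 (A.s2 (A.id3 γ)) = A.t1 (A.s2 M)} {h' : A.s1 (A.s2 (A.id3 γ)) = A.t1 (A.s2 N)}
    (e : A.hcomp3 (A.id3 γ) M h = A.hcomp3 (A.id3 γ) N h') : M = N := by
  obtain ⟨δ, p, p', e₁, -⟩ := hγ
  have key (P : A.C3) (hP) : A.hcomp3 (A.id3 δ) (A.hcomp3 (A.id3 γ) P hP) (by simp [p]) = P := by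
    rw [← A.hcomp3_assoc _ _ _ (by simp [p]) (by simpa using hP)]
    simp [hcomp3_id3, e₁]
  rw [← key M h, ← key N h']
  simp only [e]

lemma wl3_cancel {g : A.C1} (hg : A.IsInv1 g) {M N : A.C3}
    {h : A.s0 g = A.t0 (A.s1 (A.s2 M))} {h' : A.s0 g = A.t0 (A.s1 (A.s2 N))}
    (e : A.wl3 g M h = A.wl3 g N h') : M = N := by
  obtain ⟨k, p, p', e₁, -⟩ := hg
  have key (P : A.C3) (hP) : A.wl3 k (A.wl3 g P hP) (by simp [p]) = P := by
    rw [← A.comp1_wl3 _ _ _ p (by simpa using hP)]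
    simp [e₁]
  rw [← key M h, ← key N h']
  simp only [e]

lemma wr3_cancel {g : A.C1} (hg : A.IsInv1 g) {M N : A.C3}
    {h : A.s0 (A.s1 (A.s2 M)) = A.t0 g} {h' : A.s0 (A.s1 (A.s2 N)) = A.t0 g}
    (e : A.wr3 M g h = A.wr3 N g h') : M = N := by
  obtain ⟨k, p, p', -, e₂⟩ := hg
  have key (P : A.C3) (hP) : A.wr3 (A.wr3 P g hP) k (by simp [p']) = P := by
    rw [← A.wr3_comp1 _ _ _ p' (by simpa using hP)]
    simp [e₂]
  rw [← key M h, ← key N h']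
  simp only [e]

end GrayCat

/-! ### The category of 2-cells and 3-cells. -/

/-- The type of 2-cells of a Gray-category, as the type of objects of the category whose morphisms
are the 3-cells. -/
structure TwoCell (A : GrayCat.{u}) where
  cell : A.C2

namespace TwoCell

variable {A : GrayCat.{u}}

/-- With boundaries in the types, pasting equations become commutative diagrams of isomorphisms, to
which the cancellation and reassociation tools of category theory apply. The order of composition is
reversed: `M ≫ N` is `comp3 N M`. -/
instance : Category (TwoCell A) where
  Hom a b := {M : A.C3 // A.s2 M = a.cell ∧ A.t2 M = b.cell}
  id a := ⟨A.id3 a.cell, by simp⟩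
  comp M N := ⟨A.comp3 N.1 M.1 (N.2.1.trans M.2.2.symm), by simp [M.2.1, N.2.2]⟩
  id_comp M := Subtype.ext (by simp)
  comp_id M := Subtype.ext (by simp)
  assoc M N P := Subtype.ext (by simp)

/-- A 3-cell as a morphism in the category of 2-cells. -/
def Hom.mk {a b : TwoCell A} (M : A.C3) (hs : A.s2 M = a.cell) (ht : A.t2 M = b.cell) : a ⟶ b :=
  ⟨M, hs, ht⟩

/-- The 3-cell which underlies a morphism in the category of 2-cells. -/
def Hom.cell {a b : TwoCell A} (M : a ⟶ b) : A.C3 := M.1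

@[simp] lemma Hom.cell_mk {a b : TwoCell A} (M : A.C3) (hs : A.s2 M = a.cell)
    (ht : A.t2 M = b.cell) : Hom.cell (Hom.mk M hs ht) = M := rfl

@[simp] lemma Hom.s2_cell {a b : TwoCell A} (M : a ⟶ b) : A.s2 (Hom.cell M) = a.cell := M.2.1

@[simp] lemma Hom.t2_cell {a b : TwoCell A} (M : a ⟶ b) : A.t2 (Hom.cell M) = b.cell := M.2.2

@[simp] lemma Hom.cell_comp {a b c : TwoCell A} (M : a ⟶ b) (N : b ⟶ c) :
    Hom.cell (M ≫ N) = A.comp3 (Hom.cell N) (Hom.cell M) (by simp) := rfl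

lemma Hom.ext_cell {a b : TwoCell A} {M N : a ⟶ b} (h : Hom.cell M = Hom.cell N) : M = N :=
  Subtype.ext h

lemma Hom.isIso (hA : ∀ M, A.IsInv3 M) {a b : TwoCell A} (M : a ⟶ b) : IsIso M := by
  obtain ⟨N, h, h', e, e'⟩ := hA M.1
  refine ⟨⟨N, h.trans M.2.2, h'.symm.trans M.2.1⟩, Subtype.ext ?_, Subtype.ext ?_⟩
  · exact e.trans (congrArg _ M.2.1)
  · exact e'.trans (congrArg _ M.2.2)

end TwoCell

/-! ### The permutohedron of a 5-simplex: vertices and edges. -/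

namespace GraySimplexData

variable {A : GrayGpd.{u}} (x : GraySimplexData A.obj (Fin 6))

/-- The edges of a 5-simplex. -/
abbrev edge (i j : Fin 6) (ij : i ≤ j := by decide) : A.obj.C1 := x.f ij

/-- The triangles of a 5-simplex. -/
abbrev tri (i j k : Fin 6) (ij : i ≤ j := by decide) (jk : j ≤ k := by decide) : A.obj.C2 :=
  x.α ij jk

/-- The tetrahedra of a 5-simplex. -/
abbrev tet (i j k l : Fin 6) (ij : i ≤ j := by decide) (jk : j ≤ k := by decide)
    (kl : k ≤ l := by decide) : A.obj.C3 :=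
  x.X ij jk kl

namespace Permutohedron

/-- The digits give the order in which the vertices 1, 2, 3, 4 are removed from the path 0 → 1 → 2 →
3 → 4 → 5, each removal being a whiskered triangle. The first digit is the first removal, hence the
rightmost factor of the composite. -/
def v1234 : TwoCell A.obj :=
  ⟨A.obj.comp2 (x.tri 0 4 5) (A.obj.comp2 (A.obj.wl2 (x.edge 4 5) (x.tri 0 3 4) (by simp)) (A.obj.comp2 (A.obj.wl2 (x.edge 4 5) (A.obj.wl2 (x.edge 3 4) (x.tri 0 2 3) (by simp)) (by simp)) (A.obj.wl2 (x.edge 4 5) (A.obj.wl2 (x.edge 3 4) (A.obj.wl2 (x.edge 2 3) (x.tri 0 1 2) (by simp)) (by simp)) (by simp)) (by simp)) (by simp)) (by simp)⟩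

def v1243 : TwoCell A.obj :=
  ⟨A.obj.comp2 (x.tri 0 3 5) (A.obj.comp2 (A.obj.wr2 (x.tri 3 4 5) (x.edge 0 3) (by simp)) (A.obj.comp2 (A.obj.wl2 (x.edge 4 5) (A.obj.wl2 (x.edge 3 4) (x.tri 0 2 3) (by simp)) (by simp)) (A.obj.wl2 (x.edge 4 5) (A.obj.wl2 (x.edge 3 4) (A.obj.wl2 (x.edge 2 3) (x.tri 0 1 2) (by simp)) (by simp)) (by simp)) (by simp)) (by simp)) (by simp)⟩

def v1324 : TwoCell A.obj :=
  ⟨A.obj.comp2 (x.tri 0 4 5) (A.obj.comp2 (A.obj.wl2 (x.edge 4 5) (x.tri 0 2 4) (by simp)) (A.obj.comp2 (A.obj.wl2 (x.edge 4 5) (A.obj.wr2 (x.tri 2 3 4) (x.edge 0 2) (by simp)) (by simp)) (A.obj.wl2 (x.edge 4 5) (A.obj.wl2 (x.edge 3 4) (A.obj.wl2 (x.edge 2 3) (x.tri 0 1 2) (by simp)) (by simp)) (by simp)) (by simp)) (by simp)) (by simp)⟩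

def v1342 : TwoCell A.obj :=
  ⟨A.obj.comp2 (x.tri 0 2 5) (A.obj.comp2 (A.obj.wr2 (x.tri 2 4 5) (x.edge 0 2) (by simp)) (A.obj.comp2 (A.obj.wl2 (x.edge 4 5) (A.obj.wr2 (x.tri 2 3 4) (x.edge 0 2) (by simp)) (by simp)) (A.obj.wl2 (x.edge 4 5) (A.obj.wl2 (x.edge 3 4) (A.obj.wl2 (x.edge 2 3) (x.tri 0 1 2) (by simp)) (by simp)) (by simp)) (by simp)) (by simp)) (by simp)⟩

def v1423 : TwoCell A.obj :=
  ⟨A.obj.comp2 (x.tri 0 3 5) (A.obj.comp2 (A.obj.wl2 (x.edge 3 5) (x.tri 0 2 3) (by simp)) (A.obj.comp2 (A.obj.wr2 (A.obj.wr2 (x.tri 3 4 5) (x.edge 2 3) (by simp)) (x.edge 0 2) (by simp)) (A.obj.wl2 (x.edge 4 5) (A.obj.wl2 (x.edge 3 4) (A.obj.wl2 (x.edge 2 3) (x.tri 0 1 2) (by simp)) (by simp)) (by simp)) (by simp)) (by simp)) (by simp)⟩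

def v1432 : TwoCell A.obj :=
  ⟨A.obj.comp2 (x.tri 0 2 5) (A.obj.comp2 (A.obj.wr2 (x.tri 2 3 5) (x.edge 0 2) (by simp)) (A.obj.comp2 (A.obj.wr2 (A.obj.wr2 (x.tri 3 4 5) (x.edge 2 3) (by simp)) (x.edge 0 2) (by simp)) (A.obj.wl2 (x.edge 4 5) (A.obj.wl2 (x.edge 3 4) (A.obj.wl2 (x.edge 2 3) (x.tri 0 1 2) (by simp)) (by simp)) (by simp)) (by simp)) (by simp)) (by simp)⟩

def v2134 : TwoCell A.obj :=
  ⟨A.obj.comp2 (x.tri 0 4 5) (A.obj.comp2 (A.obj.wl2 (x.edge 4 5) (x.tri 0 3 4) (by simp)) (A.obj.comp2 (A.obj.wl2 (x.edge 4 5) (A.obj.wl2 (x.edge 3 4) (x.tri 0 1 3) (by simp)) (by simp)) (A.obj.wl2 (x.edge 4 5) (A.obj.wl2 (x.edge 3 4) (A.obj.wr2 (x.tri 1 2 3) (x.edge 0 1) (by simp)) (by simp)) (by simp)) (by simp)) (by simp)) (by simp)⟩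

def v2143 : TwoCell A.obj :=
  ⟨A.obj.comp2 (x.tri 0 3 5) (A.obj.comp2 (A.obj.wr2 (x.tri 3 4 5) (x.edge 0 3) (by simp)) (A.obj.comp2 (A.obj.wl2 (x.edge 4 5) (A.obj.wl2 (x.edge 3 4) (x.tri 0 1 3) (by simp)) (by simp)) (A.obj.wl2 (x.edge 4 5) (A.obj.wl2 (x.edge 3 4) (A.obj.wr2 (x.tri 1 2 3) (x.edge 0 1) (by simp)) (by simp)) (by simp)) (by simp)) (by simp)) (by simp)⟩

def v2314 : TwoCell A.obj :=
  ⟨A.obj.comp2 (x.tri 0 4 5) (A.obj.comp2 (A.obj.wl2 (x.edge 4 5) (x.tri 0 1 4) (by simp)) (A.obj.comp2 (A.obj.wl2 (x.edge 4 5) (A.obj.wr2 (x.tri 1 3 4) (x.edge 0 1) (by simp)) (by simp)) (A.obj.wl2 (x.edge 4 5) (A.obj.wl2 (x.edge 3 4) (A.obj.wr2 (x.tri 1 2 3) (x.edge 0 1) (by simp)) (by simp)) (by simp)) (by simp)) (by simp)) (by simp)⟩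

def v2341 : TwoCell A.obj :=
  ⟨A.obj.comp2 (x.tri 0 1 5) (A.obj.comp2 (A.obj.wr2 (x.tri 1 4 5) (x.edge 0 1) (by simp)) (A.obj.comp2 (A.obj.wl2 (x.edge 4 5) (A.obj.wr2 (x.tri 1 3 4) (x.edge 0 1) (by simp)) (by simp)) (A.obj.wl2 (x.edge 4 5) (A.obj.wl2 (x.edge 3 4) (A.obj.wr2 (x.tri 1 2 3) (x.edge 0 1) (by simp)) (by simp)) (by simp)) (by simp)) (by simp)) (by simp)⟩

def v2413 : TwoCell A.obj :=
  ⟨A.obj.comp2 (x.tri 0 3 5) (A.obj.comp2 (A.obj.wl2 (x.edge 3 5) (x.tri 0 1 3) (by simp)) (A.obj.comp2 (A.obj.wr2 (A.obj.wr2 (x.tri 3 4 5) (x.edge 1 3) (by simp)) (x.edge 0 1) (by simp)) (A.obj.wl2 (x.edge 4 5) (A.obj.wl2 (x.edge 3 4) (A.obj.wr2 (x.tri 1 2 3) (x.edge 0 1) (by simp)) (by simp)) (by simp)) (by simp)) (by simp)) (by simp)⟩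

def v2431 : TwoCell A.obj :=
  ⟨A.obj.comp2 (x.tri 0 1 5) (A.obj.comp2 (A.obj.wr2 (x.tri 1 3 5) (x.edge 0 1) (by simp)) (A.obj.comp2 (A.obj.wr2 (A.obj.wr2 (x.tri 3 4 5) (x.edge 1 3) (by simp)) (x.edge 0 1) (by simp)) (A.obj.wl2 (x.edge 4 5) (A.obj.wl2 (x.edge 3 4) (A.obj.wr2 (x.tri 1 2 3) (x.edge 0 1) (by simp)) (by simp)) (by simp)) (by simp)) (by simp)) (by simp)⟩

def v3124 : TwoCell A.obj :=
  ⟨A.obj.comp2 (x.tri 0 4 5) (A.obj.comp2 (A.obj.wl2 (x.edge 4 5) (x.tri 0 2 4) (by simp)) (A.obj.comp2 (A.obj.wl2 (x.edge 4 5) (A.obj.wl2 (x.edge 2 4) (x.tri 0 1 2) (by simp)) (by simp)) (A.obj.wl2 (x.edge 4 5) (A.obj.wr2 (A.obj.wr2 (x.tri 2 3 4) (x.edge 1 2) (by simp)) (x.edge 0 1) (by simp)) (by simp)) (by simp)) (by simp)) (by simp)⟩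

def v3142 : TwoCell A.obj :=
  ⟨A.obj.comp2 (x.tri 0 2 5) (A.obj.comp2 (A.obj.wr2 (x.tri 2 4 5) (x.edge 0 2) (by simp)) (A.obj.comp2 (A.obj.wl2 (x.edge 4 5) (A.obj.wl2 (x.edge 2 4) (x.tri 0 1 2) (by simp)) (by simp)) (A.obj.wl2 (x.edge 4 5) (A.obj.wr2 (A.obj.wr2 (x.tri 2 3 4) (x.edge 1 2) (by simp)) (x.edge 0 1) (by simp)) (by simp)) (by simp)) (by simp)) (by simp)⟩

def v3214 : TwoCell A.obj :=
  ⟨A.obj.comp2 (x.tri 0 4 5) (A.obj.comp2 (A.obj.wl2 (x.edge 4 5) (x.tri 0 1 4) (by simp)) (A.obj.comp2 (A.obj.wl2 (x.edge 4 5) (A.obj.wr2 (x.tri 1 2 4) (x.edge 0 1) (by simp)) (by simp)) (A.obj.wl2 (x.edge 4 5) (A.obj.wr2 (A.obj.wr2 (x.tri 2 3 4) (x.edge 1 2) (by simp)) (x.edge 0 1) (by simp)) (by simp)) (by simp)) (by simp)) (by simp)⟩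

def v3241 : TwoCell A.obj :=
  ⟨A.obj.comp2 (x.tri 0 1 5) (A.obj.comp2 (A.obj.wr2 (x.tri 1 4 5) (x.edge 0 1) (by simp)) (A.obj.comp2 (A.obj.wl2 (x.edge 4 5) (A.obj.wr2 (x.tri 1 2 4) (x.edge 0 1) (by simp)) (by simp)) (A.obj.wl2 (x.edge 4 5) (A.obj.wr2 (A.obj.wr2 (x.tri 2 3 4) (x.edge 1 2) (by simp)) (x.edge 0 1) (by simp)) (by simp)) (by simp)) (by simp)) (by simp)⟩

def v3412 : TwoCell A.obj :=
  ⟨A.obj.comp2 (x.tri 0 2 5) (A.obj.comp2 (A.obj.wl2 (x.edge 2 5) (x.tri 0 1 2) (by simp)) (A.obj.comp2 (A.obj.wr2 (A.obj.wr2 (x.tri 2 4 5) (x.edge 1 2) (by simp)) (x.edge 0 1) (by simp)) (A.obj.wl2 (x.edge 4 5) (A.obj.wr2 (A.obj.wr2 (x.tri 2 3 4) (x.edge 1 2) (by simp)) (x.edge 0 1) (by simp)) (by simp)) (by simp)) (by simp)) (by simp)⟩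

def v3421 : TwoCell A.obj :=
  ⟨A.obj.comp2 (x.tri 0 1 5) (A.obj.comp2 (A.obj.wr2 (x.tri 1 2 5) (x.edge 0 1) (by simp)) (A.obj.comp2 (A.obj.wr2 (A.obj.wr2 (x.tri 2 4 5) (x.edge 1 2) (by simp)) (x.edge 0 1) (by simp)) (A.obj.wl2 (x.edge 4 5) (A.obj.wr2 (A.obj.wr2 (x.tri 2 3 4) (x.edge 1 2) (by simp)) (x.edge 0 1) (by simp)) (by simp)) (by simp)) (by simp)) (by simp)⟩

def v4123 : TwoCell A.obj :=
  ⟨A.obj.comp2 (x.tri 0 3 5) (A.obj.comp2 (A.obj.wl2 (x.edge 3 5) (x.tri 0 2 3) (by simp)) (A.obj.comp2 (A.obj.wl2 (x.edge 3 5) (A.obj.wl2 (x.edge 2 3) (x.tri 0 1 2) (by simp)) (by simp)) (A.obj.wr2 (A.obj.wr2 (A.obj.wr2 (x.tri 3 4 5) (x.edge 2 3) (by simp)) (x.edge 1 2) (by simp)) (x.edge 0 1) (by simp)) (by simp)) (by simp)) (by simp)⟩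

def v4132 : TwoCell A.obj :=
  ⟨A.obj.comp2 (x.tri 0 2 5) (A.obj.comp2 (A.obj.wr2 (x.tri 2 3 5) (x.edge 0 2) (by simp)) (A.obj.comp2 (A.obj.wl2 (x.edge 3 5) (A.obj.wl2 (x.edge 2 3) (x.tri 0 1 2) (by simp)) (by simp)) (A.obj.wr2 (A.obj.wr2 (A.obj.wr2 (x.tri 3 4 5) (x.edge 2 3) (by simp)) (x.edge 1 2) (by simp)) (x.edge 0 1) (by simp)) (by simp)) (by simp)) (by simp)⟩

def v4213 : TwoCell A.obj :=
  ⟨A.obj.comp2 (x.tri 0 3 5) (A.obj.comp2 (A.obj.wl2 (x.edge 3 5) (x.tri 0 1 3) (by simp)) (A.obj.comp2 (A.obj.wl2 (x.edge 3 5) (A.obj.wr2 (x.tri 1 2 3) (x.edge 0 1) (by simp)) (by simp)) (A.obj.wr2 (A.obj.wr2 (A.obj.wr2 (x.tri 3 4 5) (x.edge 2 3) (by simp)) (x.edge 1 2) (by simp)) (x.edge 0 1) (by simp)) (by simp)) (by simp)) (by simp)⟩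

def v4231 : TwoCell A.obj :=
  ⟨A.obj.comp2 (x.tri 0 1 5) (A.obj.comp2 (A.obj.wr2 (x.tri 1 3 5) (x.edge 0 1) (by simp)) (A.obj.comp2 (A.obj.wl2 (x.edge 3 5) (A.obj.wr2 (x.tri 1 2 3) (x.edge 0 1) (by simp)) (by simp)) (A.obj.wr2 (A.obj.wr2 (A.obj.wr2 (x.tri 3 4 5) (x.edge 2 3) (by simp)) (x.edge 1 2) (by simp)) (x.edge 0 1) (by simp)) (by simp)) (by simp)) (by simp)⟩

def v4312 : TwoCell A.obj :=
  ⟨A.obj.comp2 (x.tri 0 2 5) (A.obj.comp2 (A.obj.wl2 (x.edge 2 5) (x.tri 0 1 2) (by simp)) (A.obj.comp2 (A.obj.wr2 (A.obj.wr2 (x.tri 2 3 5) (x.edge 1 2) (by simp)) (x.edge 0 1) (by simp)) (A.obj.wr2 (A.obj.wr2 (A.obj.wr2 (x.tri 3 4 5) (x.edge 2 3) (by simp)) (x.edge 1 2) (by simp)) (x.edge 0 1) (by simp)) (by simp)) (by simp)) (by simp)⟩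

def v4321 : TwoCell A.obj :=
  ⟨A.obj.comp2 (x.tri 0 1 5) (A.obj.comp2 (A.obj.wr2 (x.tri 1 2 5) (x.edge 0 1) (by simp)) (A.obj.comp2 (A.obj.wr2 (A.obj.wr2 (x.tri 2 3 5) (x.edge 1 2) (by simp)) (x.edge 0 1) (by simp)) (A.obj.wr2 (A.obj.wr2 (A.obj.wr2 (x.tri 3 4 5) (x.edge 2 3) (by simp)) (x.edge 1 2) (by simp)) (x.edge 0 1) (by simp)) (by simp)) (by simp)) (by simp)⟩

/-- An edge exchanges two successive removals i < j into j, i. If i and j are neighbours in the path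
that is left, the 3-cell is a tetrahedron; otherwise the two triangles do not overlap and it is a
pseudonaturality cell. The remaining removals contribute identities. -/
def e1234_2134 : v1234 x ⟶ v2134 x :=
  TwoCell.Hom.mk (A.obj.hcomp3 (A.obj.id3 (x.tri 0 4 5)) (A.obj.hcomp3 (A.obj.id3 (A.obj.wl2 (x.edge 4 5) (x.tri 0 3 4) (by simp))) (A.obj.wl3 (x.edge 4 5) (A.obj.wl3 (x.edge 3 4) (x.tet 0 1 2 3) (by simp)) (by simp)) (by simp)) (by simp))
    (by simp [v1234]) (by simp [v2134])

def e1234_1324 : v1234 x ⟶ v1324 x :=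
  TwoCell.Hom.mk (A.obj.hcomp3 (A.obj.id3 (x.tri 0 4 5)) (A.obj.hcomp3 (A.obj.wl3 (x.edge 4 5) (x.tet 0 2 3 4) (by simp)) (A.obj.id3 (A.obj.wl2 (x.edge 4 5) (A.obj.wl2 (x.edge 3 4) (A.obj.wl2 (x.edge 2 3) (x.tri 0 1 2) (by simp)) (by simp)) (by simp))) (by simp)) (by simp))
    (by simp [v1234]) (by simp [v1324])

def e1234_1243 : v1234 x ⟶ v1243 x :=
  TwoCell.Hom.mk (A.obj.hcomp3 (x.tet 0 3 4 5) (A.obj.hcomp3 (A.obj.id3 (A.obj.wl2 (x.edge 4 5) (A.obj.wl2 (x.edge 3 4) (x.tri 0 2 3) (by simp)) (by simp))) (A.obj.id3 (A.obj.wl2 (x.edge 4 5) (A.obj.wl2 (x.edge 3 4) (A.obj.wl2 (x.edge 2 3) (x.tri 0 1 2) (by simp)) (by simp)) (by simp))) (by simp)) (by simp))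
    (by simp [v1234]) (by simp [v1243])

def e1243_2143 : v1243 x ⟶ v2143 x :=
  TwoCell.Hom.mk (A.obj.hcomp3 (A.obj.id3 (x.tri 0 3 5)) (A.obj.hcomp3 (A.obj.id3 (A.obj.wr2 (x.tri 3 4 5) (x.edge 0 3) (by simp))) (A.obj.wl3 (x.edge 4 5) (A.obj.wl3 (x.edge 3 4) (x.tet 0 1 2 3) (by simp)) (by simp)) (by simp)) (by simp))
    (by simp [v1243]) (by simp [v2143])

def e1243_1423 : v1243 x ⟶ v1423 x :=
  TwoCell.Hom.mk (A.obj.hcomp3 (A.obj.id3 (x.tri 0 3 5)) (A.obj.hcomp3 (A.obj.ich (x.tri 3 4 5) (x.tri 0 2 3) (by simp)) (A.obj.id3 (A.obj.wl2 (x.edge 4 5) (A.obj.wl2 (x.edge 3 4) (A.obj.wl2 (x.edge 2 3) (x.tri 0 1 2) (by simp)) (by simp)) (by simp))) (by simp)) (by simp))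
    (by simp [v1243]) (by simp [v1423])

def e1324_3124 : v1324 x ⟶ v3124 x :=
  TwoCell.Hom.mk (A.obj.hcomp3 (A.obj.id3 (x.tri 0 4 5)) (A.obj.hcomp3 (A.obj.id3 (A.obj.wl2 (x.edge 4 5) (x.tri 0 2 4) (by simp))) (A.obj.ich (A.obj.wl2 (x.edge 4 5) (x.tri 2 3 4) (by simp)) (x.tri 0 1 2) (by simp)) (by simp)) (by simp))
    (by simp [v1324]) (by simp [v3124])

def e1324_1342 : v1324 x ⟶ v1342 x :=
  TwoCell.Hom.mk (A.obj.hcomp3 (x.tet 0 2 4 5) (A.obj.hcomp3 (A.obj.id3 (A.obj.wl2 (x.edge 4 5) (A.obj.wr2 (x.tri 2 3 4) (x.edge 0 2) (by simp)) (by simp))) (A.obj.id3 (A.obj.wl2 (x.edge 4 5) (A.obj.wl2 (x.edge 3 4) (A.obj.wl2 (x.edge 2 3) (x.tri 0 1 2) (by simp)) (by simp)) (by simp))) (by simp)) (by simp))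
    (by simp [v1324]) (by simp [v1342])

def e1342_3142 : v1342 x ⟶ v3142 x :=
  TwoCell.Hom.mk (A.obj.hcomp3 (A.obj.id3 (x.tri 0 2 5)) (A.obj.hcomp3 (A.obj.id3 (A.obj.wr2 (x.tri 2 4 5) (x.edge 0 2) (by simp))) (A.obj.ich (A.obj.wl2 (x.edge 4 5) (x.tri 2 3 4) (by simp)) (x.tri 0 1 2) (by simp)) (by simp)) (by simp))
    (by simp [v1342]) (by simp [v3142])

def e1342_1432 : v1342 x ⟶ v1432 x :=
  TwoCell.Hom.mk (A.obj.hcomp3 (A.obj.id3 (x.tri 0 2 5)) (A.obj.hcomp3 (A.obj.wr3 (x.tet 2 3 4 5) (x.edge 0 2) (by simp)) (A.obj.id3 (A.obj.wl2 (x.edge 4 5) (A.obj.wl2 (x.edge 3 4) (A.obj.wl2 (x.edge 2 3) (x.tri 0 1 2) (by simp)) (by simp)) (by simp))) (by simp)) (by simp))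
    (by simp [v1342]) (by simp [v1432])

def e1423_4123 : v1423 x ⟶ v4123 x :=
  TwoCell.Hom.mk (A.obj.hcomp3 (A.obj.id3 (x.tri 0 3 5)) (A.obj.hcomp3 (A.obj.id3 (A.obj.wl2 (x.edge 3 5) (x.tri 0 2 3) (by simp))) (A.obj.ich (x.tri 3 4 5) (A.obj.wl2 (x.edge 2 3) (x.tri 0 1 2) (by simp)) (by simp)) (by simp)) (by simp))
    (by simp [v1423]) (by simp [v4123])

def e1423_1432 : v1423 x ⟶ v1432 x :=
  TwoCell.Hom.mk (A.obj.hcomp3 (x.tet 0 2 3 5) (A.obj.hcomp3 (A.obj.id3 (A.obj.wr2 (A.obj.wr2 (x.tri 3 4 5) (x.edge 2 3) (by simp)) (x.edge 0 2) (by simp))) (A.obj.id3 (A.obj.wl2 (x.edge 4 5) (A.obj.wl2 (x.edge 3 4) (A.obj.wl2 (x.edge 2 3) (x.tri 0 1 2) (by simp)) (by simp)) (by simp))) (by simp)) (by simp))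
    (by simp [v1423]) (by simp [v1432])

def e1432_4132 : v1432 x ⟶ v4132 x :=
  TwoCell.Hom.mk (A.obj.hcomp3 (A.obj.id3 (x.tri 0 2 5)) (A.obj.hcomp3 (A.obj.id3 (A.obj.wr2 (x.tri 2 3 5) (x.edge 0 2) (by simp))) (A.obj.ich (x.tri 3 4 5) (A.obj.wl2 (x.edge 2 3) (x.tri 0 1 2) (by simp)) (by simp)) (by simp)) (by simp))
    (by simp [v1432]) (by simp [v4132])

def e2134_2314 : v2134 x ⟶ v2314 x :=
  TwoCell.Hom.mk (A.obj.hcomp3 (A.obj.id3 (x.tri 0 4 5)) (A.obj.hcomp3 (A.obj.wl3 (x.edge 4 5) (x.tet 0 1 3 4) (by simp)) (A.obj.id3 (A.obj.wl2 (x.edge 4 5) (A.obj.wl2 (x.edge 3 4) (A.obj.wr2 (x.tri 1 2 3) (x.edge 0 1) (by simp)) (by simp)) (by simp))) (by simp)) (by simp))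
    (by simp [v2134]) (by simp [v2314])

def e2134_2143 : v2134 x ⟶ v2143 x :=
  TwoCell.Hom.mk (A.obj.hcomp3 (x.tet 0 3 4 5) (A.obj.hcomp3 (A.obj.id3 (A.obj.wl2 (x.edge 4 5) (A.obj.wl2 (x.edge 3 4) (x.tri 0 1 3) (by simp)) (by simp))) (A.obj.id3 (A.obj.wl2 (x.edge 4 5) (A.obj.wl2 (x.edge 3 4) (A.obj.wr2 (x.tri 1 2 3) (x.edge 0 1) (by simp)) (by simp)) (by simp))) (by simp)) (by simp))
    (by simp [v2134]) (by simp [v2143])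

def e2143_2413 : v2143 x ⟶ v2413 x :=
  TwoCell.Hom.mk (A.obj.hcomp3 (A.obj.id3 (x.tri 0 3 5)) (A.obj.hcomp3 (A.obj.ich (x.tri 3 4 5) (x.tri 0 1 3) (by simp)) (A.obj.id3 (A.obj.wl2 (x.edge 4 5) (A.obj.wl2 (x.edge 3 4) (A.obj.wr2 (x.tri 1 2 3) (x.edge 0 1) (by simp)) (by simp)) (by simp))) (by simp)) (by simp))
    (by simp [v2143]) (by simp [v2413])

def e2314_3214 : v2314 x ⟶ v3214 x :=
  TwoCell.Hom.mk (A.obj.hcomp3 (A.obj.id3 (x.tri 0 4 5)) (A.obj.hcomp3 (A.obj.id3 (A.obj.wl2 (x.edge 4 5) (x.tri 0 1 4) (by simp))) (A.obj.wl3 (x.edge 4 5) (A.obj.wr3 (x.tet 1 2 3 4) (x.edge 0 1) (by simp)) (by simp)) (by simp)) (by simp))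
    (by simp [v2314]) (by simp [v3214])

def e2314_2341 : v2314 x ⟶ v2341 x :=
  TwoCell.Hom.mk (A.obj.hcomp3 (x.tet 0 1 4 5) (A.obj.hcomp3 (A.obj.id3 (A.obj.wl2 (x.edge 4 5) (A.obj.wr2 (x.tri 1 3 4) (x.edge 0 1) (by simp)) (by simp))) (A.obj.id3 (A.obj.wl2 (x.edge 4 5) (A.obj.wl2 (x.edge 3 4) (A.obj.wr2 (x.tri 1 2 3) (x.edge 0 1) (by simp)) (by simp)) (by simp))) (by simp)) (by simp))
    (by simp [v2314]) (by simp [v2341])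

def e2341_3241 : v2341 x ⟶ v3241 x :=
  TwoCell.Hom.mk (A.obj.hcomp3 (A.obj.id3 (x.tri 0 1 5)) (A.obj.hcomp3 (A.obj.id3 (A.obj.wr2 (x.tri 1 4 5) (x.edge 0 1) (by simp))) (A.obj.wl3 (x.edge 4 5) (A.obj.wr3 (x.tet 1 2 3 4) (x.edge 0 1) (by simp)) (by simp)) (by simp)) (by simp))
    (by simp [v2341]) (by simp [v3241])

def e2341_2431 : v2341 x ⟶ v2431 x :=
  TwoCell.Hom.mk (A.obj.hcomp3 (A.obj.id3 (x.tri 0 1 5)) (A.obj.hcomp3 (A.obj.wr3 (x.tet 1 3 4 5) (x.edge 0 1) (by simp)) (A.obj.id3 (A.obj.wl2 (x.edge 4 5) (A.obj.wl2 (x.edge 3 4) (A.obj.wr2 (x.tri 1 2 3) (x.edge 0 1) (by simp)) (by simp)) (by simp))) (by simp)) (by simp))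
    (by simp [v2341]) (by simp [v2431])

def e2413_4213 : v2413 x ⟶ v4213 x :=
  TwoCell.Hom.mk (A.obj.hcomp3 (A.obj.id3 (x.tri 0 3 5)) (A.obj.hcomp3 (A.obj.id3 (A.obj.wl2 (x.edge 3 5) (x.tri 0 1 3) (by simp))) (A.obj.ich (x.tri 3 4 5) (A.obj.wr2 (x.tri 1 2 3) (x.edge 0 1) (by simp)) (by simp)) (by simp)) (by simp))
    (by simp [v2413]) (by simp [v4213])

def e2413_2431 : v2413 x ⟶ v2431 x :=
  TwoCell.Hom.mk (A.obj.hcomp3 (x.tet 0 1 3 5) (A.obj.hcomp3 (A.obj.id3 (A.obj.wr2 (A.obj.wr2 (x.tri 3 4 5) (x.edge 1 3) (by simp)) (x.edge 0 1) (by simp))) (A.obj.id3 (A.obj.wl2 (x.edge 4 5) (A.obj.wl2 (x.edge 3 4) (A.obj.wr2 (x.tri 1 2 3) (x.edge 0 1) (by simp)) (by simp)) (by simp))) (by simp)) (by simp))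
    (by simp [v2413]) (by simp [v2431])

def e2431_4231 : v2431 x ⟶ v4231 x :=
  TwoCell.Hom.mk (A.obj.hcomp3 (A.obj.id3 (x.tri 0 1 5)) (A.obj.hcomp3 (A.obj.id3 (A.obj.wr2 (x.tri 1 3 5) (x.edge 0 1) (by simp))) (A.obj.ich (x.tri 3 4 5) (A.obj.wr2 (x.tri 1 2 3) (x.edge 0 1) (by simp)) (by simp)) (by simp)) (by simp))
    (by simp [v2431]) (by simp [v4231])

def e3124_3214 : v3124 x ⟶ v3214 x :=
  TwoCell.Hom.mk (A.obj.hcomp3 (A.obj.id3 (x.tri 0 4 5)) (A.obj.hcomp3 (A.obj.wl3 (x.edge 4 5) (x.tet 0 1 2 4) (by simp)) (A.obj.id3 (A.obj.wl2 (x.edge 4 5) (A.obj.wr2 (A.obj.wr2 (x.tri 2 3 4) (x.edge 1 2) (by simp)) (x.edge 0 1) (by simp)) (by simp))) (by simp)) (by simp))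
    (by simp [v3124]) (by simp [v3214])

def e3124_3142 : v3124 x ⟶ v3142 x :=
  TwoCell.Hom.mk (A.obj.hcomp3 (x.tet 0 2 4 5) (A.obj.hcomp3 (A.obj.id3 (A.obj.wl2 (x.edge 4 5) (A.obj.wl2 (x.edge 2 4) (x.tri 0 1 2) (by simp)) (by simp))) (A.obj.id3 (A.obj.wl2 (x.edge 4 5) (A.obj.wr2 (A.obj.wr2 (x.tri 2 3 4) (x.edge 1 2) (by simp)) (x.edge 0 1) (by simp)) (by simp))) (by simp)) (by simp))
    (by simp [v3124]) (by simp [v3142])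

def e3142_3412 : v3142 x ⟶ v3412 x :=
  TwoCell.Hom.mk (A.obj.hcomp3 (A.obj.id3 (x.tri 0 2 5)) (A.obj.hcomp3 (A.obj.ich (x.tri 2 4 5) (x.tri 0 1 2) (by simp)) (A.obj.id3 (A.obj.wl2 (x.edge 4 5) (A.obj.wr2 (A.obj.wr2 (x.tri 2 3 4) (x.edge 1 2) (by simp)) (x.edge 0 1) (by simp)) (by simp))) (by simp)) (by simp))
    (by simp [v3142]) (by simp [v3412])

def e3214_3241 : v3214 x ⟶ v3241 x :=
  TwoCell.Hom.mk (A.obj.hcomp3 (x.tet 0 1 4 5) (A.obj.hcomp3 (A.obj.id3 (A.obj.wl2 (x.edge 4 5) (A.obj.wr2 (x.tri 1 2 4) (x.edge 0 1) (by simp)) (by simp))) (A.obj.id3 (A.obj.wl2 (x.edge 4 5) (A.obj.wr2 (A.obj.wr2 (x.tri 2 3 4) (x.edge 1 2) (by simp)) (x.edge 0 1) (by simp)) (by simp))) (by simp)) (by simp))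
    (by simp [v3214]) (by simp [v3241])

def e3241_3421 : v3241 x ⟶ v3421 x :=
  TwoCell.Hom.mk (A.obj.hcomp3 (A.obj.id3 (x.tri 0 1 5)) (A.obj.hcomp3 (A.obj.wr3 (x.tet 1 2 4 5) (x.edge 0 1) (by simp)) (A.obj.id3 (A.obj.wl2 (x.edge 4 5) (A.obj.wr2 (A.obj.wr2 (x.tri 2 3 4) (x.edge 1 2) (by simp)) (x.edge 0 1) (by simp)) (by simp))) (by simp)) (by simp))
    (by simp [v3241]) (by simp [v3421])

def e3412_4312 : v3412 x ⟶ v4312 x :=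
  TwoCell.Hom.mk (A.obj.hcomp3 (A.obj.id3 (x.tri 0 2 5)) (A.obj.hcomp3 (A.obj.id3 (A.obj.wl2 (x.edge 2 5) (x.tri 0 1 2) (by simp))) (A.obj.wr3 (A.obj.wr3 (x.tet 2 3 4 5) (x.edge 1 2) (by simp)) (x.edge 0 1) (by simp)) (by simp)) (by simp))
    (by simp [v3412]) (by simp [v4312])

def e3412_3421 : v3412 x ⟶ v3421 x :=
  TwoCell.Hom.mk (A.obj.hcomp3 (x.tet 0 1 2 5) (A.obj.hcomp3 (A.obj.id3 (A.obj.wr2 (A.obj.wr2 (x.tri 2 4 5) (x.edge 1 2) (by simp)) (x.edge 0 1) (by simp))) (A.obj.id3 (A.obj.wl2 (x.edge 4 5) (A.obj.wr2 (A.obj.wr2 (x.tri 2 3 4) (x.edge 1 2) (by simp)) (x.edge 0 1) (by simp)) (by simp))) (by simp)) (by simp))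
    (by simp [v3412]) (by simp [v3421])

def e3421_4321 : v3421 x ⟶ v4321 x :=
  TwoCell.Hom.mk (A.obj.hcomp3 (A.obj.id3 (x.tri 0 1 5)) (A.obj.hcomp3 (A.obj.id3 (A.obj.wr2 (x.tri 1 2 5) (x.edge 0 1) (by simp))) (A.obj.wr3 (A.obj.wr3 (x.tet 2 3 4 5) (x.edge 1 2) (by simp)) (x.edge 0 1) (by simp)) (by simp)) (by simp))
    (by simp [v3421]) (by simp [v4321])

def e4123_4213 : v4123 x ⟶ v4213 x :=
  TwoCell.Hom.mk (A.obj.hcomp3 (A.obj.id3 (x.tri 0 3 5)) (A.obj.hcomp3 (A.obj.wl3 (x.edge 3 5) (x.tet 0 1 2 3) (by simp)) (A.obj.id3 (A.obj.wr2 (A.obj.wr2 (A.obj.wr2 (x.tri 3 4 5) (x.edge 2 3) (by simp)) (x.edge 1 2) (by simp)) (x.edge 0 1) (by simp))) (by simp)) (by simp))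
    (by simp [v4123]) (by simp [v4213])

def e4123_4132 : v4123 x ⟶ v4132 x :=
  TwoCell.Hom.mk (A.obj.hcomp3 (x.tet 0 2 3 5) (A.obj.hcomp3 (A.obj.id3 (A.obj.wl2 (x.edge 3 5) (A.obj.wl2 (x.edge 2 3) (x.tri 0 1 2) (by simp)) (by simp))) (A.obj.id3 (A.obj.wr2 (A.obj.wr2 (A.obj.wr2 (x.tri 3 4 5) (x.edge 2 3) (by simp)) (x.edge 1 2) (by simp)) (x.edge 0 1) (by simp))) (by simp)) (by simp))
    (by simp [v4123]) (by simp [v4132])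

def e4132_4312 : v4132 x ⟶ v4312 x :=
  TwoCell.Hom.mk (A.obj.hcomp3 (A.obj.id3 (x.tri 0 2 5)) (A.obj.hcomp3 (A.obj.ich (x.tri 2 3 5) (x.tri 0 1 2) (by simp)) (A.obj.id3 (A.obj.wr2 (A.obj.wr2 (A.obj.wr2 (x.tri 3 4 5) (x.edge 2 3) (by simp)) (x.edge 1 2) (by simp)) (x.edge 0 1) (by simp))) (by simp)) (by simp))
    (by simp [v4132]) (by simp [v4312])

def e4213_4231 : v4213 x ⟶ v4231 x :=
  TwoCell.Hom.mk (A.obj.hcomp3 (x.tet 0 1 3 5) (A.obj.hcomp3 (A.obj.id3 (A.obj.wl2 (x.edge 3 5) (A.obj.wr2 (x.tri 1 2 3) (x.edge 0 1) (by simp)) (by simp))) (A.obj.id3 (A.obj.wr2 (A.obj.wr2 (A.obj.wr2 (x.tri 3 4 5) (x.edge 2 3) (by simp)) (x.edge 1 2) (by simp)) (x.edge 0 1) (by simp))) (by simp)) (by simp))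
    (by simp [v4213]) (by simp [v4231])

def e4231_4321 : v4231 x ⟶ v4321 x :=
  TwoCell.Hom.mk (A.obj.hcomp3 (A.obj.id3 (x.tri 0 1 5)) (A.obj.hcomp3 (A.obj.wr3 (x.tet 1 2 3 5) (x.edge 0 1) (by simp)) (A.obj.id3 (A.obj.wr2 (A.obj.wr2 (A.obj.wr2 (x.tri 3 4 5) (x.edge 2 3) (by simp)) (x.edge 1 2) (by simp)) (x.edge 0 1) (by simp))) (by simp)) (by simp))
    (by simp [v4231]) (by simp [v4321])

def e4312_4321 : v4312 x ⟶ v4321 x :=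
  TwoCell.Hom.mk (A.obj.hcomp3 (x.tet 0 1 2 5) (A.obj.hcomp3 (A.obj.id3 (A.obj.wr2 (A.obj.wr2 (x.tri 2 3 5) (x.edge 1 2) (by simp)) (x.edge 0 1) (by simp))) (A.obj.id3 (A.obj.wr2 (A.obj.wr2 (A.obj.wr2 (x.tri 3 4 5) (x.edge 2 3) (by simp)) (x.edge 1 2) (by simp)) (x.edge 0 1) (by simp))) (by simp)) (by simp))
    (by simp [v4312]) (by simp [v4321])

end Permutohedron

end GraySimplexData

/-! ### The faces of the permutohedron, and horns of dimension 5. -/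

lemma GrayCat.id3_hcomp3_congr (A : GrayCat.{u}) (γ : A.C2) {M N : A.C3} (e : M = N)
    (h : A.s1 (A.s2 (A.id3 γ)) = A.t1 (A.s2 M)) :
    A.hcomp3 (A.id3 γ) M h = A.hcomp3 (A.id3 γ) N (e ▸ h) := by
  subst e
  rfl

namespace TwoCell

variable {A : GrayCat.{u}}

lemma Hom.ext_cell_iff {a b : TwoCell A} {M N : a ⟶ b} : Hom.cell M = Hom.cell N ↔ M = N :=
  ⟨Hom.ext_cell, fun h => h ▸ rfl⟩

/-- Meant for `P` and `Q` the two pasting composites of a face, and `M` and `N` the two sides of the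
hexagon in which this face appears whiskered by an invertible 2-cell. The two variants below serve
the faces opposite to the vertices 5 and 0. -/
lemma eq_iff_of_cell_eq_hcomp3_id3 {a b : TwoCell A} {M N : a ⟶ b} {P Q : A.C3} {γ : A.C2} {p q}
    (hγ : A.IsInv2 γ) (hM : Hom.cell M = A.hcomp3 P (A.id3 γ) p)
    (hN : Hom.cell N = A.hcomp3 Q (A.id3 γ) q) : P = Q ↔ M = N := by
  rw [← Hom.ext_cell_iff, hM, hN]
  refine ⟨?_, GrayCat.hcomp3_id3_cancel hγ⟩
  rintro rfl
  rfl

lemma eq_iff_of_cell_eq_id3_hcomp3_wl3 {a b : TwoCell A} {M N : a ⟶ b} {P Q : A.C3} {γ : A.C2}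
    {g : A.C1} {p p' q q'} (hγ : A.IsInv2 γ) (hg : A.IsInv1 g)
    (hM : Hom.cell M = A.hcomp3 (A.id3 γ) (A.wl3 g P p) p')
    (hN : Hom.cell N = A.hcomp3 (A.id3 γ) (A.wl3 g Q q) q') : P = Q ↔ M = N := by
  rw [← Hom.ext_cell_iff, hM, hN]
  refine ⟨?_, fun h => GrayCat.wl3_cancel hg (GrayCat.id3_hcomp3_cancel hγ h)⟩
  rintro rfl
  rfl

lemma eq_iff_of_cell_eq_id3_hcomp3_wr3 {a b : TwoCell A} {M N : a ⟶ b} {P Q : A.C3} {γ : A.C2}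
    {f : A.C1} {p p' q q'} (hγ : A.IsInv2 γ) (hf : A.IsInv1 f)
    (hM : Hom.cell M = A.hcomp3 (A.id3 γ) (A.wr3 P f p) p')
    (hN : Hom.cell N = A.hcomp3 (A.id3 γ) (A.wr3 Q f q) q') : P = Q ↔ M = N := by
  rw [← Hom.ext_cell_iff, hM, hN]
  refine ⟨?_, fun h => GrayCat.wr3_cancel hf (GrayCat.id3_hcomp3_cancel hγ h)⟩
  rintro rfl
  rfl

end TwoCell

namespace GraySimplexData

variable {A : GrayGpd.{u}} (x : GraySimplexData A.obj (Fin 6))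

/-- The condition on a 4-dimensional face. -/
def Pasting (a b c d e : Fin 6) (ab : a ≤ b := by decide) (bc : b ≤ c := by decide)
    (cd : c ≤ d := by decide) (de : d ≤ e := by decide) : Prop :=
  x.pasting₁ ab bc cd de = x.pasting₂ ab bc cd de

namespace Permutohedron

open TwoCell

/-- On the paths where vertex 1 is removed first, the 2-cell `f₄₅ f₃₄ f₂₃ α₀₁₂` is a constant right
factor; once it is cancelled, there remains the hexagon of the face 02345. The vertices 2, 3 and 4
are treated in the same way by the next three lemmas. -/
lemma pasting_iff_1 : x.Pasting 0 2 3 4 5 ↔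
    e1234_1324 x ≫ e1324_1342 x ≫ e1342_1432 x =
      e1234_1243 x ≫ e1243_1423 x ≫ e1423_1432 x := by
  apply eq_iff_of_cell_eq_hcomp3_id3 (γ := A.obj.wl2 (x.edge 4 5) (A.obj.wl2 (x.edge 3 4) (A.obj.wl2 (x.edge 2 3) (x.tri 0 1 2) (by simp)) (by simp)) (by simp))
    (A.property.2.1 _)
  · simp [pasting₁, GrayCat.comp3_hcomp3_id3]; rfl
  · simp [pasting₂, GrayCat.comp3_hcomp3_id3]; rfl
  · simp [pasting₁]
  · simp [pasting₂]

lemma pasting_iff_2 : x.Pasting 0 1 3 4 5 ↔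
    e2134_2314 x ≫ e2314_2341 x ≫ e2341_2431 x =
      e2134_2143 x ≫ e2143_2413 x ≫ e2413_2431 x := by
  apply eq_iff_of_cell_eq_hcomp3_id3 (γ := A.obj.wl2 (x.edge 4 5) (A.obj.wl2 (x.edge 3 4) (A.obj.wr2 (x.tri 1 2 3) (x.edge 0 1) (by simp)) (by simp)) (by simp))
    (A.property.2.1 _)
  · simp [pasting₁, GrayCat.comp3_hcomp3_id3]; rfl
  · simp [pasting₂, GrayCat.comp3_hcomp3_id3]; rfl
  · simp [pasting₁]
  · simp [pasting₂]

lemma pasting_iff_3 : x.Pasting 0 1 2 4 5 ↔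
    e3124_3214 x ≫ e3214_3241 x ≫ e3241_3421 x =
      e3124_3142 x ≫ e3142_3412 x ≫ e3412_3421 x := by
  apply eq_iff_of_cell_eq_hcomp3_id3 (γ := A.obj.wl2 (x.edge 4 5) (A.obj.wr2 (A.obj.wr2 (x.tri 2 3 4) (x.edge 1 2) (by simp)) (x.edge 0 1) (by simp)) (by simp))
    (A.property.2.1 _)
  · simp [pasting₁, GrayCat.comp3_hcomp3_id3]; rfl
  · simp [pasting₂, GrayCat.comp3_hcomp3_id3]; rfl
  · simp [pasting₁]
  · simp [pasting₂]

lemma pasting_iff_4 : x.Pasting 0 1 2 3 5 ↔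
    e4123_4213 x ≫ e4213_4231 x ≫ e4231_4321 x =
      e4123_4132 x ≫ e4132_4312 x ≫ e4312_4321 x := by
  apply eq_iff_of_cell_eq_hcomp3_id3 (γ := A.obj.wr2 (A.obj.wr2 (A.obj.wr2 (x.tri 3 4 5) (x.edge 2 3) (by simp)) (x.edge 1 2) (by simp)) (x.edge 0 1) (by simp))
    (A.property.2.1 _)
  · simp [pasting₁, GrayCat.comp3_hcomp3_id3]; rfl
  · simp [pasting₂, GrayCat.comp3_hcomp3_id3]; rfl
  · simp [pasting₁]
  · simp [pasting₂]

/-- When vertex 1 is removed last, everything else takes place in the path from 1 to 5, whiskered by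
`f₀₁` and followed by `α₀₁₅`, and both can be cancelled. The mirror case, where vertex 4 is removed
last, is `pasting_iff_5`. -/
lemma pasting_iff_0 : x.Pasting 1 2 3 4 5 ↔
    e2341_3241 x ≫ e3241_3421 x ≫ e3421_4321 x =
      e2341_2431 x ≫ e2431_4231 x ≫ e4231_4321 x := by
  apply eq_iff_of_cell_eq_id3_hcomp3_wr3 (γ := x.tri 0 1 5) (f := x.edge 0 1) (A.property.2.1 _)
    (A.property.1 _)
  · simp [pasting₁, GrayCat.id3_hcomp3_comp3]; rfl
  · simp [pasting₂, GrayCat.id3_hcomp3_comp3]; rfl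
  all_goals simp [pasting₁, pasting₂]

lemma pasting_iff_5 : x.Pasting 0 1 2 3 4 ↔
    e1234_2134 x ≫ e2134_2314 x ≫ e2314_3214 x =
      e1234_1324 x ≫ e1324_3124 x ≫ e3124_3214 x := by
  apply eq_iff_of_cell_eq_id3_hcomp3_wl3 (γ := x.tri 0 4 5) (g := x.edge 4 5) (A.property.2.1 _)
    (A.property.1 _)
  · simp [pasting₁, GrayCat.id3_hcomp3_comp3]; rfl
  · simp [pasting₂, GrayCat.id3_hcomp3_comp3]; rfl
  all_goals simp [pasting₁, pasting₂]

/-- When vertex 2 is removed last, the path splits into 0 → 1 → 2 and 2 → 3 → 4 → 5, and the hexagon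
says that the tetrahedron 2345 slides past the triangle 012: this is naturality of the
pseudonaturality cell in its left variable. The boundary of the tetrahedron consists of composites,
whose pseudonaturality cells decompose into the edges of the hexagon. -/
lemma hexagon_2 :
    e1342_3142 x ≫ e3142_3412 x ≫ e3412_4312 x =
      e1342_1432 x ≫ e1432_4132 x ≫ e4132_4312 x := by
  have h := A.obj.isGray.ich_natural_left (x.tet 2 3 4 5) (x.tri 0 1 2) (by simp)
  have h' := A.obj.id3_hcomp3_congr (x.tri 0 2 5) h (by simp)
  apply Hom.ext_cell
  simp only [s2_X, t2_X, GrayCat.ich_comp2_left] at h'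
  simp [GrayCat.id3_hcomp3_comp3] at h'
  simp only [Hom.cell_comp, GrayCat.comp3_assoc]
  exact h'.symm

/-- Mirror image of `hexagon_2`: when vertex 3 is removed last, the tetrahedron 0123 slides past the
triangle 345, by naturality in the right variable. -/
lemma hexagon_3 :
    e1243_2143 x ≫ e2143_2413 x ≫ e2413_4213 x =
      e1243_1423 x ≫ e1423_4123 x ≫ e4123_4213 x := by
  have h := A.obj.isGray.ich_natural_right (x.tri 3 4 5) (x.tet 0 1 2 3) (by simp)
  have h' := A.obj.id3_hcomp3_congr (x.tri 0 3 5) h (by simp)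
  apply Hom.ext_cell
  simp only [s2_X, t2_X, GrayCat.ich_comp2_right] at h'
  simp [GrayCat.id3_hcomp3_comp3] at h'
  simp only [Hom.cell_comp, GrayCat.comp3_assoc]
  exact h'

/-- One pair of edges exchanges the first two removals, the other pair the last two. These 3-cells
act on disjoint factors of the vertical composite, so they commute by interchange. The index of each
square records the two vertices that are removed first. -/
lemma square_12 :
    e1234_2134 x ≫ e2134_2143 x = e1234_1243 x ≫ e1243_2143 x := by
  apply Hom.ext_cell
  refine Eq.trans ?_ ((A.obj.hcomp3_comm (x.tet 0 3 4 5) (A.obj.wl3 (x.edge 4 5) (A.obj.wl3 (x.edge 3 4) (x.tet 0 1 2 3) (by simp)) (by simp)) (by simp)).trans ?_)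
  · simp [GrayCat.id3_comp2]; rfl
  · simp [GrayCat.id3_comp2]; rfl

lemma square_13 :
    e1324_3124 x ≫ e3124_3142 x = e1324_1342 x ≫ e1342_3142 x := by
  apply Hom.ext_cell
  refine Eq.trans ?_ ((A.obj.hcomp3_comm (x.tet 0 2 4 5) (A.obj.ich (A.obj.wl2 (x.edge 4 5) (x.tri 2 3 4) (by simp)) (x.tri 0 1 2) (by simp)) (by simp)).trans ?_)
  · simp [GrayCat.id3_comp2]; rfl
  · simp [GrayCat.id3_comp2]; rfl

lemma square_14 :
    e1423_4123 x ≫ e4123_4132 x = e1423_1432 x ≫ e1432_4132 x := by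
  apply Hom.ext_cell
  refine Eq.trans ?_ ((A.obj.hcomp3_comm (x.tet 0 2 3 5) (A.obj.ich (x.tri 3 4 5) (A.obj.wl2 (x.edge 2 3) (x.tri 0 1 2) (by simp)) (by simp)) (by simp)).trans ?_)
  · simp [GrayCat.id3_comp2]; rfl
  · simp [GrayCat.id3_comp2]; rfl

lemma square_23 :
    e2314_3214 x ≫ e3214_3241 x = e2314_2341 x ≫ e2341_3241 x := by
  apply Hom.ext_cell
  refine Eq.trans ?_ ((A.obj.hcomp3_comm (x.tet 0 1 4 5) (A.obj.wl3 (x.edge 4 5) (A.obj.wr3 (x.tet 1 2 3 4) (x.edge 0 1) (by simp)) (by simp)) (by simp)).trans ?_)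
  · simp [GrayCat.id3_comp2]; rfl
  · simp [GrayCat.id3_comp2]; rfl

lemma square_24 :
    e2413_4213 x ≫ e4213_4231 x = e2413_2431 x ≫ e2431_4231 x := by
  apply Hom.ext_cell
  refine Eq.trans ?_ ((A.obj.hcomp3_comm (x.tet 0 1 3 5) (A.obj.ich (x.tri 3 4 5) (A.obj.wr2 (x.tri 1 2 3) (x.edge 0 1) (by simp)) (by simp)) (by simp)).trans ?_)
  · simp [GrayCat.id3_comp2]; rfl
  · simp [GrayCat.id3_comp2]; rfl

lemma square_34 :
    e3412_4312 x ≫ e4312_4321 x = e3412_3421 x ≫ e3421_4321 x := by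
  apply Hom.ext_cell
  refine Eq.trans ?_ ((A.obj.hcomp3_comm (x.tet 0 1 2 5) (A.obj.wr3 (A.obj.wr3 (x.tet 2 3 4 5) (x.edge 1 2) (by simp)) (x.edge 0 1) (by simp)) (by simp)).trans ?_)
  · simp [GrayCat.id3_comp2]; rfl
  · simp [GrayCat.id3_comp2]; rfl

instance (A : GrayGpd.{u}) {a b : TwoCell A.obj} (M : a ⟶ b) : IsIso M :=
  Hom.isIso A.property.2.2 M

lemma eq_iff_of_eq_comp {C : Type*} [Category* C] {a b c d : C} {p : a ⟶ b} {l r : b ⟶ c}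
    {s : c ⟶ d} [IsIso p] [IsIso s] {w w' : a ⟶ d} (hw : w = p ≫ l ≫ s) (hw' : w' = p ≫ r ≫ s) :
    l = r ↔ w = w' := by
  rw [hw, hw', cancel_epi, cancel_mono]

/-- The boundary of the permutohedron is a sphere, swept out by a cyclic sequence of eight directed
paths from 1234 to 4321. Two consecutive paths are separated by exactly one hexagon, and by at most
one square; each of the six squares is crossed once. As every edge is invertible, the equality of
two such paths is equivalent to the commutation of the hexagon between them. -/
lemma exists_cycle : ∃ c0 c1 c2 c3 c4 c5 c6 c7 : v1234 x ⟶ v4321 x,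
    (x.Pasting 0 1 2 3 4 ↔ c0 = c1) ∧
    (x.Pasting 0 1 2 4 5 ↔ c1 = c2) ∧
    c2 = c3 ∧
    (x.Pasting 0 2 3 4 5 ↔ c3 = c4) ∧
    (x.Pasting 0 1 2 3 5 ↔ c5 = c4) ∧
    c6 = c5 ∧
    (x.Pasting 0 1 3 4 5 ↔ c7 = c6) ∧
    (x.Pasting 1 2 3 4 5 ↔ c0 = c7) := by
  refine ⟨e1234_2134 x ≫ e2134_2314 x ≫ e2314_3214 x ≫ e3214_3241 x ≫ e3241_3421 x ≫ e3421_4321 x,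
    e1234_1324 x ≫ e1324_3124 x ≫ e3124_3214 x ≫ e3214_3241 x ≫ e3241_3421 x ≫ e3421_4321 x,
    e1234_1324 x ≫ e1324_3124 x ≫ e3124_3142 x ≫ e3142_3412 x ≫ e3412_4312 x ≫ e4312_4321 x,
    e1234_1324 x ≫ e1324_1342 x ≫ e1342_1432 x ≫ e1432_4132 x ≫ e4132_4312 x ≫ e4312_4321 x,
    e1234_1243 x ≫ e1243_1423 x ≫ e1423_4123 x ≫ e4123_4132 x ≫ e4132_4312 x ≫ e4312_4321 x,
    e1234_1243 x ≫ e1243_1423 x ≫ e1423_4123 x ≫ e4123_4213 x ≫ e4213_4231 x ≫ e4231_4321 x,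
    e1234_2134 x ≫ e2134_2143 x ≫ e2143_2413 x ≫ e2413_4213 x ≫ e4213_4231 x ≫ e4231_4321 x,
    e1234_2134 x ≫ e2134_2314 x ≫ e2314_2341 x ≫ e2341_2431 x ≫ e2431_4231 x ≫ e4231_4321 x,
    ?_, ?_, ?_, ?_, ?_, ?_, ?_, ?_⟩
  -- In each case `p` and `s` are the parts that both paths share before and after the hexagon; when
  -- the paths do not literally share them, one square rewrites one path first.
  · refine (pasting_iff_5 x).trans (eq_iff_of_eq_comp (p := 𝟙 _) (s := e3214_3241 x ≫ e3241_3421 x ≫ e3421_4321 x) ?_ ?_)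
    · simp
    · simp
  · refine (pasting_iff_3 x).trans (eq_iff_of_eq_comp (p := e1234_1324 x ≫ e1324_3124 x) (s := e3421_4321 x) ?_ ?_)
    · simp
    · simp
      rw [square_34 x]
  · refine (eq_iff_of_eq_comp (p := e1234_1324 x ≫ e1324_1342 x) (s := e4312_4321 x) ?_ ?_).1 (hexagon_2 x)
    · simp
      rw [reassoc_of% (square_13 x)]
    · simp
  · refine (pasting_iff_1 x).trans (eq_iff_of_eq_comp (p := 𝟙 _) (s := e1432_4132 x ≫ e4132_4312 x ≫ e4312_4321 x) ?_ ?_)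
    · simp
    · simp
      rw [reassoc_of% (square_14 x)]
  · refine (pasting_iff_4 x).trans (eq_iff_of_eq_comp (p := e1234_1243 x ≫ e1243_1423 x ≫ e1423_4123 x) (s := 𝟙 _) ?_ ?_)
    · simp
    · simp
  · refine (eq_iff_of_eq_comp (p := e1234_1243 x) (s := e4213_4231 x ≫ e4231_4321 x) ?_ ?_).1 (hexagon_3 x)
    · simp
      rw [reassoc_of% (square_12 x)]
    · simp
  · refine (pasting_iff_2 x).trans (eq_iff_of_eq_comp (p := e1234_2134 x) (s := e2431_4231 x ≫ e4231_4321 x) ?_ ?_)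
    · simp
    · simp
      rw [reassoc_of% (square_24 x)]
  · refine (pasting_iff_0 x).trans (eq_iff_of_eq_comp (p := e1234_2134 x ≫ e2134_2314 x ≫ e2314_2341 x) (s := 𝟙 _) ?_ ?_)
    · simp
      rw [reassoc_of% (square_23 x)]
    · simp

end Permutohedron

open Permutohedron in
/-- If the pasting composites agree on all the 4-dimensional faces of a 5-simplex which contain the
vertex `k`, then they agree on the remaining face. -/
lemma pasting_of_horn (k : Fin 6)
    (h : ∀ {a b c d e : Fin 6} (ab : a < b) (bc : b < c) (cd : c < d) (de : d < e),
      k = a ∨ k = b ∨ k = c ∨ k = d ∨ k = e →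
        x.pasting₁ ab.le bc.le cd.le de.le = x.pasting₂ ab.le bc.le cd.le de.le)
    {a b c d e : Fin 6} (ab : a < b) (bc : b < c) (cd : c < d) (de : d < e) :
    x.pasting₁ ab.le bc.le cd.le de.le = x.pasting₂ ab.le bc.le cd.le de.le := by
  obtain ⟨c0, c1, c2, c3, c4, c5, c6, c7, h5, h3, e₂, h1, h4, e₃, h2, h0⟩ := exists_cycle x
  have H5 : k ≠ 5 → x.Pasting 0 1 2 3 4 := fun _ => h (by decide) (by decide) (by decide)
    (by decide) (by omega)
  have H4 : k ≠ 4 → x.Pasting 0 1 2 3 5 := fun _ => h (by decide) (by decide) (by decide)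
    (by decide) (by omega)
  have H3 : k ≠ 3 → x.Pasting 0 1 2 4 5 := fun _ => h (by decide) (by decide) (by decide)
    (by decide) (by omega)
  have H2 : k ≠ 2 → x.Pasting 0 1 3 4 5 := fun _ => h (by decide) (by decide) (by decide)
    (by decide) (by omega)
  have H1 : k ≠ 1 → x.Pasting 0 2 3 4 5 := fun _ => h (by decide) (by decide) (by decide)
    (by decide) (by omega)
  have H0 : k ≠ 0 → x.Pasting 1 2 3 4 5 := fun _ => h (by decide) (by decide) (by decide)
    (by decide) (by omega)
  have H : x.Pasting 0 1 2 3 4 ∧ x.Pasting 0 1 2 3 5 ∧ x.Pasting 0 1 2 4 5 ∧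
      x.Pasting 0 1 3 4 5 ∧ x.Pasting 0 2 3 4 5 ∧ x.Pasting 1 2 3 4 5 := by
    -- The six conditions become six of the eight links of the closed chain `c0, …, c7`. The two
    -- other links always hold, so any five of the six give the last one by transitivity.
    rw [h0, h1, h2, h3, h4, h5] at *
    clear h h0 h1 h2 h3 h4 h5
    subst e₂ e₃
    fin_cases k <;> simp at * <;> grind
  clear h h0 h1 h2 h3 h4 h5 e₂ e₃ H0 H1 H2 H3 H4 H5
  have : (a = 0 ∧ b = 1 ∧ c = 2 ∧ d = 3 ∧ e = 4) ∨ (a = 0 ∧ b = 1 ∧ c = 2 ∧ d = 3 ∧ e = 5) ∨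
      (a = 0 ∧ b = 1 ∧ c = 2 ∧ d = 4 ∧ e = 5) ∨ (a = 0 ∧ b = 1 ∧ c = 3 ∧ d = 4 ∧ e = 5) ∨
      (a = 0 ∧ b = 2 ∧ c = 3 ∧ d = 4 ∧ e = 5) ∨ (a = 1 ∧ b = 2 ∧ c = 3 ∧ d = 4 ∧ e = 5) := by
    omega
  obtain ⟨H1, H2, H3, H4, H5, H6⟩ := H
  rcases this with h | h | h | h | h | h <;> obtain ⟨rfl, rfl, rfl, rfl, rfl⟩ := h <;> assumption

end GraySimplexData

namespace GraySimplexData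

section

variable {A : GrayCat.{u}} {P : Type} [Preorder P] (x : GraySimplexData A P)

/-! ### Degenerate 4-simplices -/

/-- A repeated index makes all the 3-cells identities except one on each side. By the unit laws both
composites reduce to the tetrahedron on the tuple without the repetition. -/
lemma pasting_eq_of_refl₁ {a c d e : P} (ac : a ≤ c) (cd : c ≤ d) (de : d ≤ e) :
    x.pasting₁ (le_refl a) ac cd de = x.pasting₂ (le_refl a) ac cd de := by
  simp [pasting₁, pasting₂, f_refl, α_refl_left, X_refl_left, GrayCat.hcomp3_id3]

lemma pasting_eq_of_refl₂ {a b d e : P} (ab : a ≤ b) (bd : b ≤ d) (de : d ≤ e) :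
    x.pasting₁ ab (le_refl b) bd de = x.pasting₂ ab (le_refl b) bd de := by
  simp [pasting₁, pasting₂, f_refl, α_refl_left, α_refl_right, X_refl_left, X_refl_mid,
    GrayCat.hcomp3_id3]

lemma pasting_eq_of_refl₃ {a b c e : P} (ab : a ≤ b) (bc : b ≤ c) (ce : c ≤ e) :
    x.pasting₁ ab bc (le_refl c) ce = x.pasting₂ ab bc (le_refl c) ce := by
  simp [pasting₁, pasting₂, f_refl, α_refl_left, α_refl_right, X_refl_mid, X_refl_right,
    GrayCat.hcomp3_id3]

lemma pasting_eq_of_refl₄ {a b c d : P} (ab : a ≤ b) (bc : b ≤ c) (cd : c ≤ d) :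
    x.pasting₁ ab bc cd (le_refl d) = x.pasting₂ ab bc cd (le_refl d) := by
  simp [pasting₁, pasting₂, f_refl, α_refl_right, X_refl_right, GrayCat.hcomp3_id3]

end

end GraySimplexData

/-! ### Simplices given by their nondegenerate cells. -/

/-- Families of cells of a Gray-category, indexed by the tuples of elements of `P`. -/
structure RawSimplex (A : GrayCat.{u}) (P : Type) where
  ob : P → A.C0
  f : P → P → A.C1
  α : P → P → P → A.C2
  X : P → P → P → P → A.C3

namespace RawSimplex

section

variable {A : GrayCat.{u}} {P : Type} [LinearOrder P]

/-- The conditions on sources and targets of 1-cells and 2-cells, for strictly increasing tuples. -/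
structure IsStrict₂ (R : RawSimplex A P) : Prop where
  s0_f : ∀ {i j}, i < j → A.s0 (R.f i j) = R.ob i
  t0_f : ∀ {i j}, i < j → A.t0 (R.f i j) = R.ob j
  s1_α : ∀ {i j k} (ij : i < j) (jk : j < k),
    A.s1 (R.α i j k) = A.comp1 (R.f j k) (R.f i j) (by rw [s0_f jk, t0_f ij])
  t1_α : ∀ {i j k}, i < j → j < k → A.t1 (R.α i j k) = R.f i k

/-- The conditions on sources and targets, for strictly increasing tuples. -/
structure IsStrict₃ (R : RawSimplex A P) : Prop extends R.IsStrict₂ where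
  s2_X : ∀ {i j k l} (ij : i < j) (jk : j < k) (kl : k < l),
    A.s2 (R.X i j k l) = A.comp2 (R.α i k l)
      (A.wl2 (R.f k l) (R.α i j k) (by simp [s1_α ij jk, s0_f kl, t0_f jk]))
      (by simp [s1_α (ij.trans jk) kl, t1_α ij jk])
  t2_X : ∀ {i j k l} (ij : i < j) (jk : j < k) (kl : k < l),
    A.t2 (R.X i j k l) = A.comp2 (R.α i j l)
      (A.wr2 (R.α j k l) (R.f i j) (by simp [s1_α jk kl, s0_f jk, t0_f ij]))
      (by simp [s1_α ij (jk.trans kl), t1_α jk kl])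

/-- The 1-cells, with identities on the diagonal. -/
def f' (R : RawSimplex A P) (i j : P) : A.C1 := if i = j then A.id1 (R.ob i) else R.f i j

/-- The 2-cells, with identities on the degenerate tuples. -/
def α' (R : RawSimplex A P) (i j k : P) : A.C2 :=
  if i = j then A.id2 (R.f' j k) else if j = k then A.id2 (R.f' i j) else R.α i j k

/-- The 3-cells, with identities on the degenerate tuples. -/
def X' (R : RawSimplex A P) (i j k l : P) : A.C3 :=
  if i = j then A.id3 (R.α' j k l) else if j = k then A.id3 (R.α' i j l) else
    if k = l then A.id3 (R.α' i j k) else R.X i j k l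

variable (R : RawSimplex A P)

@[simp] lemma f'_refl (i : P) : R.f' i i = A.id1 (R.ob i) := by simp [f']
lemma f'_of_lt {i j : P} (ij : i < j) : R.f' i j = R.f i j := by simp [f', ij.ne]
@[simp] lemma α'_refl_left (i j : P) : R.α' i i j = A.id2 (R.f' i j) := by simp [α']
@[simp] lemma α'_refl_right (i j : P) : R.α' i j j = A.id2 (R.f' i j) := by
  by_cases h : i = j <;> simp [α', h]
lemma α'_of_lt {i j k : P} (ij : i < j) (jk : j < k) : R.α' i j k = R.α i j k := by
  simp [α', ij.ne, jk.ne]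
@[simp] lemma X'_refl_left (i j k : P) : R.X' i i j k = A.id3 (R.α' i j k) := by simp [X']
@[simp] lemma X'_refl_mid (i j k : P) : R.X' i j j k = A.id3 (R.α' i j k) := by
  by_cases h : i = j <;> simp [X', h]
@[simp] lemma X'_refl_right (i j k : P) : R.X' i j k k = A.id3 (R.α' i j k) := by
  by_cases h : i = j
  · subst h; simp
  by_cases h' : j = k
  · subst h'; simp
  · simp [X', h, h']
lemma X'_of_lt {i j k l : P} (ij : i < j) (jk : j < k) (kl : k < l) :
    R.X' i j k l = R.X i j k l := by
  simp [X', ij.ne, jk.ne, kl.ne]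

variable {R}

/-- The families are total, with no inequality among their arguments, so that indices can be
rewritten freely; their values off the strictly increasing tuples are irrelevant. Each boundary
condition for weakly increasing tuples follows from the strict one, since a repeated index reduces
it to a unit law. -/
lemma IsStrict₂.s0_f' (h : R.IsStrict₂) {i j : P} (ij : i ≤ j) : A.s0 (R.f' i j) = R.ob i := by
  obtain rfl | ij := ij.eq_or_lt
  · simp
  · simp [f'_of_lt, ij, h.s0_f]

lemma IsStrict₂.t0_f' (h : R.IsStrict₂) {i j : P} (ij : i ≤ j) : A.t0 (R.f' i j) = R.ob j := by
  obtain rfl | ij := ij.eq_or_lt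
  · simp
  · simp [f'_of_lt, ij, h.t0_f]

lemma IsStrict₂.s1_α' (h : R.IsStrict₂) {i j k : P} (ij : i ≤ j) (jk : j ≤ k) :
    A.s1 (R.α' i j k) = A.comp1 (R.f' j k) (R.f' i j) (by rw [h.s0_f' jk, h.t0_f' ij]) := by
  obtain rfl | ij := ij.eq_or_lt
  · simp
  · obtain rfl | jk := jk.eq_or_lt
    · simp
    · simp [f'_of_lt, α'_of_lt, ij, jk, h.s1_α]

lemma IsStrict₂.t1_α' (h : R.IsStrict₂) {i j k : P} (ij : i ≤ j) (jk : j ≤ k) :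
    A.t1 (R.α' i j k) = R.f' i k := by
  obtain rfl | ij := ij.eq_or_lt
  · simp
  · obtain rfl | jk := jk.eq_or_lt
    · simp
    · simp [f'_of_lt, α'_of_lt, ij, jk, ij.trans jk, h.t1_α]

lemma IsStrict₃.s2_X' (h : R.IsStrict₃) {i j k l : P} (ij : i ≤ j) (jk : j ≤ k) (kl : k ≤ l) :
    A.s2 (R.X' i j k l) = A.comp2 (R.α' i k l)
      (A.wl2 (R.f' k l) (R.α' i j k) (by simp [h.s1_α' ij jk, h.s0_f' kl, h.t0_f' jk]))
      (by simp [h.s1_α' (ij.trans jk) kl, h.t1_α' ij jk]) := by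
  obtain rfl | ij := ij.eq_or_lt
  · simp
  obtain rfl | jk := jk.eq_or_lt
  · simp
  obtain rfl | kl := kl.eq_or_lt
  · simp
  simp [f'_of_lt, α'_of_lt, X'_of_lt, ij, jk, kl, ij.trans jk, h.s2_X]

lemma IsStrict₃.t2_X' (h : R.IsStrict₃) {i j k l : P} (ij : i ≤ j) (jk : j ≤ k) (kl : k ≤ l) :
    A.t2 (R.X' i j k l) = A.comp2 (R.α' i j l)
      (A.wr2 (R.α' j k l) (R.f' i j) (by simp [h.s1_α' jk kl, h.s0_f' jk, h.t0_f' ij]))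
      (by simp [h.s1_α' ij (jk.trans kl), h.t1_α' jk kl]) := by
  obtain rfl | ij := ij.eq_or_lt
  · simp
  obtain rfl | jk := jk.eq_or_lt
  · simp
  obtain rfl | kl := kl.eq_or_lt
  · simp
  simp [f'_of_lt, α'_of_lt, X'_of_lt, ij, jk, kl, jk.trans kl, h.t2_X]

/-- The simplex data given by a family of cells indexed by strictly increasing tuples. -/
@[simps ob f α X]
def toData (R : RawSimplex A P) (h : R.IsStrict₃) : GraySimplexData A P where
  ob := R.ob
  f {i j} _ := R.f' i j
  s0_f := h.s0_f'
  t0_f := h.t0_f'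
  f_refl := R.f'_refl
  α {i j k} _ _ := R.α' i j k
  s1_α := h.s1_α'
  t1_α := h.t1_α'
  α_refl_left _ := R.α'_refl_left _ _
  α_refl_right _ := R.α'_refl_right _ _
  X {i j k l} _ _ _ := R.X' i j k l
  s2_X := h.s2_X'
  t2_X := h.t2_X'
  X_refl_left _ _ := R.X'_refl_left _ _ _
  X_refl_mid _ _ := R.X'_refl_mid _ _ _
  X_refl_right _ _ := R.X'_refl_right _ _ _

end

end RawSimplex

/-- It suffices to check the equality of the pasting composites on strictly increasing tuples. -/
def GraySimplexData.toSimplex {A : GrayCat.{u}} {P : Type} [LinearOrder P]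
    (x : GraySimplexData A P)
    (h : ∀ {a b c d e : P} (ab : a < b) (bc : b < c) (cd : c < d) (de : d < e),
      x.pasting₁ ab.le bc.le cd.le de.le = x.pasting₂ ab.le bc.le cd.le de.le) :
    GraySimplex A P where
  toGraySimplexData := x
  pasting_eq ab bc cd de := by
    obtain rfl | ab := ab.eq_or_lt
    · exact x.pasting_eq_of_refl₁ _ _ _
    obtain rfl | bc := bc.eq_or_lt
    · exact x.pasting_eq_of_refl₂ _ _ _
    obtain rfl | cd := cd.eq_or_lt
    · exact x.pasting_eq_of_refl₃ _ _ _
    obtain rfl | de := de.eq_or_lt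
    · exact x.pasting_eq_of_refl₄ _ _ _
    exact h ab bc cd de

/-! ### Strict inverses in Gray-groupoids. -/

/-- The Gray-category is a Gray-groupoid. -/
class GrayCat.IsGroupoid (A : GrayCat.{u}) : Prop where
  isGrayGroupoid : IsGrayGroupoid A

instance (A : GrayGpd.{u}) : A.obj.IsGroupoid := ⟨A.property⟩

namespace GrayCat

variable (A : GrayCat.{u}) [A.IsGroupoid]

lemma isInv1 (f : A.C1) : A.IsInv1 f := IsGroupoid.isGrayGroupoid.1 f
lemma isInv2 (α : A.C2) : A.IsInv2 α := IsGroupoid.isGrayGroupoid.2.1 α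
lemma isInv3 (M : A.C3) : A.IsInv3 M := IsGroupoid.isGrayGroupoid.2.2 M

/-- The inverse of a 1-cell. -/
noncomputable def inv1 (f : A.C1) : A.C1 := (A.isInv1 f).choose
/-- The inverse of a 2-cell. -/
noncomputable def inv2 (α : A.C2) : A.C2 := (A.isInv2 α).choose
/-- The inverse of a 3-cell. -/
noncomputable def inv3 (M : A.C3) : A.C3 := (A.isInv3 M).choose

@[simp] lemma s0_inv1 (f : A.C1) : A.s0 (A.inv1 f) = A.t0 f := (A.isInv1 f).choose_spec.choose
@[simp] lemma t0_inv1 (f : A.C1) : A.t0 (A.inv1 f) = A.s0 f :=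
  (A.isInv1 f).choose_spec.choose_spec.choose.symm
@[simp] lemma s1_inv2 (α : A.C2) : A.s1 (A.inv2 α) = A.t1 α := (A.isInv2 α).choose_spec.choose
@[simp] lemma t1_inv2 (α : A.C2) : A.t1 (A.inv2 α) = A.s1 α :=
  (A.isInv2 α).choose_spec.choose_spec.choose.symm
@[simp] lemma s2_inv3 (M : A.C3) : A.s2 (A.inv3 M) = A.t2 M := (A.isInv3 M).choose_spec.choose
@[simp] lemma t2_inv3 (M : A.C3) : A.t2 (A.inv3 M) = A.s2 M :=
  (A.isInv3 M).choose_spec.choose_spec.choose.symm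

@[simp] lemma inv1_comp1 (f : A.C1) (h) : A.comp1 (A.inv1 f) f h = A.id1 (A.s0 f) :=
  (A.isInv1 f).choose_spec.choose_spec.choose_spec.1
@[simp] lemma comp1_inv1 (f : A.C1) (h) : A.comp1 f (A.inv1 f) h = A.id1 (A.t0 f) :=
  (A.isInv1 f).choose_spec.choose_spec.choose_spec.2
@[simp] lemma inv2_comp2 (α : A.C2) (h) : A.comp2 (A.inv2 α) α h = A.id2 (A.s1 α) :=
  (A.isInv2 α).choose_spec.choose_spec.choose_spec.1
@[simp] lemma comp2_inv2 (α : A.C2) (h) : A.comp2 α (A.inv2 α) h = A.id2 (A.t1 α) :=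
  (A.isInv2 α).choose_spec.choose_spec.choose_spec.2
@[simp] lemma inv3_comp3 (M : A.C3) (h) : A.comp3 (A.inv3 M) M h = A.id3 (A.s2 M) :=
  (A.isInv3 M).choose_spec.choose_spec.choose_spec.1
@[simp] lemma comp3_inv3 (M : A.C3) (h) : A.comp3 M (A.inv3 M) h = A.id3 (A.t2 M) :=
  (A.isInv3 M).choose_spec.choose_spec.choose_spec.2

@[simp] lemma inv1_comp1_cancel_left (f g : A.C1) (h) (h') :
    A.comp1 (A.inv1 f) (A.comp1 f g h) h' = g := by
  rw [← A.comp1_assoc _ _ _ (by simp) (by simpa using h)]; simp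
@[simp] lemma comp1_inv1_cancel_left (f g : A.C1) (h) (h') :
    A.comp1 f (A.comp1 (A.inv1 f) g h) h' = g := by
  rw [← A.comp1_assoc _ _ _ (by simp) (by simpa using h)]; simp
@[simp] lemma inv2_comp2_cancel_left (α β : A.C2) (h) (h') :
    A.comp2 (A.inv2 α) (A.comp2 α β h) h' = β := by
  rw [← A.comp2_assoc _ _ _ (by simp) (by simpa using h)]; simp
@[simp] lemma comp2_inv2_cancel_left (α β : A.C2) (h) (h') :
    A.comp2 α (A.comp2 (A.inv2 α) β h) h' = β := by
  rw [← A.comp2_assoc _ _ _ (by simp) (by simpa using h)]; simp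
@[simp] lemma inv2_hcomp3_cancel_left (α : A.C2) (M : A.C3) (h) (h') :
    A.hcomp3 (A.id3 (A.inv2 α)) (A.hcomp3 (A.id3 α) M h) h' = M := by
  rw [← A.hcomp3_assoc _ _ _ (by simp) (by simpa using h)]; simp [hcomp3_id3]
@[simp] lemma hcomp3_inv2_cancel_left (α : A.C2) (M : A.C3) (h) (h') :
    A.hcomp3 (A.id3 α) (A.hcomp3 (A.id3 (A.inv2 α)) M h) h' = M := by
  rw [← A.hcomp3_assoc _ _ _ (by simp) (by simpa using h)]; simp [hcomp3_id3]
@[simp] lemma inv1_wl2_cancel (g : A.C1) (α : A.C2) (h) (h') :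
    A.wl2 (A.inv1 g) (A.wl2 g α h) h' = α := by
  rw [← A.comp1_wl2 _ _ _ (by simp) (by simpa using h)]; simp
@[simp] lemma wl2_inv1_cancel (g : A.C1) (α : A.C2) (h) (h') :
    A.wl2 g (A.wl2 (A.inv1 g) α h) h' = α := by
  rw [← A.comp1_wl2 _ _ _ (by simp) (by simpa using h)]; simp
@[simp] lemma inv1_wl3_cancel (g : A.C1) (M : A.C3) (h) (h') :
    A.wl3 (A.inv1 g) (A.wl3 g M h) h' = M := by
  rw [← A.comp1_wl3 _ _ _ (by simp) (by simpa using h)]; simp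
@[simp] lemma wl3_inv1_cancel (g : A.C1) (M : A.C3) (h) (h') :
    A.wl3 g (A.wl3 (A.inv1 g) M h) h' = M := by
  rw [← A.comp1_wl3 _ _ _ (by simp) (by simpa using h)]; simp
@[simp] lemma wr2_inv1_cancel (g : A.C1) (α : A.C2) (h) (h') :
    A.wr2 (A.wr2 α (A.inv1 g) h) g h' = α := by
  rw [← A.wr2_comp1 _ _ _ (by simp) (by simpa using h)]; simp
@[simp] lemma inv1_wr2_cancel (g : A.C1) (α : A.C2) (h) (h') :
    A.wr2 (A.wr2 α g h) (A.inv1 g) h' = α := by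
  rw [← A.wr2_comp1 _ _ _ (by simp) (by simpa using h)]; simp
@[simp] lemma wr3_inv1_cancel (g : A.C1) (M : A.C3) (h) (h') :
    A.wr3 (A.wr3 M (A.inv1 g) h) g h' = M := by
  rw [← A.wr3_comp1 _ _ _ (by simp) (by simpa using h)]; simp
@[simp] lemma inv1_wr3_cancel (g : A.C1) (M : A.C3) (h) (h') :
    A.wr3 (A.wr3 M g h) (A.inv1 g) h' = M := by
  rw [← A.wr3_comp1 _ _ _ (by simp) (by simpa using h)]; simp

variable {A}

/-- Strict inverses are unique, so that the chosen ones are preserved by everything that preserves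
composites and identities, in particular by whiskerings and by Gray-functors. -/
lemma eq_inv1 {f g : A.C1} (h : A.s0 g = A.t0 f) (e : A.comp1 g f h = A.id1 (A.s0 f)) :
    g = A.inv1 f := by
  have h' : A.comp1 (A.comp1 g f h) (A.inv1 f) (by simp) = A.inv1 f := by simp [e]
  simpa [h] using h'

lemma eq_inv2 {α β : A.C2} (h : A.s1 β = A.t1 α) (e : A.comp2 β α h = A.id2 (A.s1 α)) :
    β = A.inv2 α := by
  have h' : A.comp2 (A.comp2 β α h) (A.inv2 α) (by simp) = A.inv2 α := by simp [e]
  simpa [h] using h'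

lemma eq_inv3 {M N : A.C3} (h : A.s2 N = A.t2 M) (e : A.comp3 N M h = A.id3 (A.s2 M)) :
    N = A.inv3 M := by
  have h' : A.comp3 (A.comp3 N M h) (A.inv3 M) (by simp) = A.inv3 M := by simp [e]
  simpa [h] using h'

@[simp] lemma inv1_inv1 (f : A.C1) : A.inv1 (A.inv1 f) = f :=
  (eq_inv1 (by simp) (by simp)).symm
@[simp] lemma inv2_inv2 (α : A.C2) : A.inv2 (A.inv2 α) = α :=
  (eq_inv2 (by simp) (by simp)).symm
@[simp] lemma inv3_inv3 (M : A.C3) : A.inv3 (A.inv3 M) = M :=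
  (eq_inv3 (by simp) (by simp)).symm

@[simp] lemma wr2_inv2 (α : A.C2) (f : A.C1) (h) :
    A.wr2 (A.inv2 α) f h = A.inv2 (A.wr2 α f (by simpa using h)) :=
  eq_inv2 (by simp) (by rw [← A.wr2_comp2 _ _ _ (by simp) (by simpa using h)]; simp)
@[simp] lemma wl2_inv2 (α : A.C2) (g : A.C1) (h) :
    A.wl2 g (A.inv2 α) h = A.inv2 (A.wl2 g α (by simpa using h)) :=
  eq_inv2 (by simp) (by rw [← A.wl2_comp2 _ _ _ (by simp) (by simpa using h)]; simp)

variable (A) in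
lemma iso2_refl (α : A.C2) : A.Iso2 α α := ⟨A.id3 α, A.isInv3 _, by simp, by simp⟩

/-- A strict inverse is an inverse up to identity 3-cells. Together with `isBiequiv1` and `isInv3`,
this makes the lifting conditions of a fibration available for all cells. -/
lemma isEquiv2 (α : A.C2) : A.IsEquiv2 α := by
  obtain ⟨β, h, h', e, e'⟩ := A.isInv2 α
  exact ⟨β, h, h', e ▸ A.iso2_refl _, e' ▸ A.iso2_refl _⟩

variable (A) in
lemma equiv1_refl (f : A.C1) : A.Equiv1 f f := ⟨A.id2 f, isEquiv2 _, by simp, by simp⟩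

lemma isBiequiv1 (f : A.C1) : A.IsBiequiv1 f := by
  obtain ⟨g, h, h', e, e'⟩ := A.isInv1 f
  exact ⟨g, h, h', e ▸ A.equiv1_refl _, e' ▸ A.equiv1_refl _⟩

end GrayCat

/-! ### Lifting of cells along fibrations. -/

namespace GrayFunctor

variable {A B : GrayCat.{u}} [A.IsGroupoid] [B.IsGroupoid] (F : GrayFunctor A B)

@[simp] lemma map_inv1 (f : A.C1) : F.F1 (A.inv1 f) = B.inv1 (F.F1 f) :=
  GrayCat.eq_inv1 (by simp) (by rw [← F.map_comp1 _ _ (by simp)]; simp)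
@[simp] lemma map_inv2 (α : A.C2) : F.F2 (A.inv2 α) = B.inv2 (F.F2 α) :=
  GrayCat.eq_inv2 (by simp) (by rw [← F.map_comp2 _ _ (by simp)]; simp)
@[simp] lemma map_inv3 (M : A.C3) : F.F3 (A.inv3 M) = B.inv3 (F.F3 M) :=
  GrayCat.eq_inv3 (by simp) (by rw [← F.map_comp3 _ _ (by simp)]; simp)

namespace IsFibration

variable {F} (hF : F.IsFibration)

include hF

/-! ### Liftings of 1-cells -/

/-- The definition of a fibration lifts `g` only up to an equivalence `β : F f → g`. Lifting the
inverse of `β` to a 2-cell with target `f` corrects this: its source is a strict lift of `g` with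
the same endpoints as `f`. -/
lemma exists_lift1_of_t0 (X : A.C0) (g : B.C1) (h : B.t0 g = F.F0 X) :
    ∃ f, A.t0 f = X ∧ F.F1 f = g := by
  obtain ⟨f, -, rfl, β, -, h₁, h₂⟩ := hF.lift_biequiv X g (GrayCat.isBiequiv1 g) h
  obtain ⟨α, -, hα, e⟩ := hF.lift_equiv f (B.inv2 β) (GrayCat.isEquiv2 _) (by simp [h₁])
  refine ⟨A.s1 α, by rw [← A.t0_t1, hα], ?_⟩
  rw [← F.s1_F2, e, B.s1_inv2, h₂]

lemma exists_lift1_of_s0 (X : A.C0) (g : B.C1) (h : B.s0 g = F.F0 X) :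
    ∃ f, A.s0 f = X ∧ F.F1 f = g := by
  obtain ⟨f, h₁, h₂⟩ := hF.exists_lift1_of_t0 X (B.inv1 g) (by simp [h])
  exact ⟨A.inv1 f, by simp [h₁], by simp [h₂]⟩

/-! ### Liftings of 2-cells -/

lemma exists_lift2_of_t1 (f : A.C1) (β : B.C2) (h : B.t1 β = F.F1 f) :
    ∃ α, A.t1 α = f ∧ F.F2 α = β := by
  obtain ⟨α, -, h⟩ := hF.lift_equiv f β (GrayCat.isEquiv2 _) h
  exact ⟨α, h⟩

lemma exists_lift2_of_s1 (f : A.C1) (β : B.C2) (h : B.s1 β = F.F1 f) :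
    ∃ α, A.s1 α = f ∧ F.F2 α = β := by
  obtain ⟨α, h₁, h₂⟩ := hF.exists_lift2_of_t1 f (B.inv2 β) (by simp [h])
  exact ⟨A.inv2 α, by simp [h₁], by simp [h₂]⟩

/-- Lifting of a 2-cell `g f → h` when `f` and `h` are given. -/
lemma exists_lift2_left (f h : A.C1) (e : A.s0 h = A.s0 f) (g : B.C1) (β : B.C2) (p)
    (h₁ : B.s1 β = B.comp1 g (F.F1 f) p) (h₂ : B.t1 β = F.F1 h) :
    ∃ (g' : A.C1) (q : A.s0 g' = A.t0 f) (α : A.C2), A.t0 g' = A.t0 h ∧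
      A.s1 α = A.comp1 g' f q ∧ A.t1 α = h ∧ F.F1 g' = g ∧ F.F2 α = β := by
  -- Whiskering with the inverse of `F f` moves `f` to the target: the 2-cell now goes from the
  -- unknown `g` to the image of the known 1-cell `h f⁻¹`. Its lift is whiskered back by `f`.
  obtain ⟨α, h₃, h₄⟩ := hF.exists_lift2_of_t1 (A.comp1 h (A.inv1 f) (by simp [e]))
    (B.wr2 β (B.inv1 (F.F1 f)) (by simp [h₁])) (by simp [h₂])
  have h₅ : A.s0 (A.s1 α) = A.t0 f := by rw [← A.s0_t1, h₃]; simp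
  refine ⟨A.s1 α, h₅, A.wr2 α f h₅, ?_, by simp, by simp [h₃], ?_, by simp [h₄]⟩
  · rw [← A.t0_t1, h₃]; simp
  · rw [← F.s1_F2, h₄]; simp [h₁]

/-- Lifting of a 2-cell `g f → h` when `g` and `h` are given. -/
lemma exists_lift2_right (g h : A.C1) (e : A.t0 g = A.t0 h) (f : B.C1) (β : B.C2) (p)
    (h₁ : B.s1 β = B.comp1 (F.F1 g) f p) (h₂ : B.t1 β = F.F1 h) :
    ∃ (f' : A.C1) (q : A.s0 g = A.t0 f') (α : A.C2), A.s0 f' = A.s0 h ∧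
      A.s1 α = A.comp1 g f' q ∧ A.t1 α = h ∧ F.F1 f' = f ∧ F.F2 α = β := by
  obtain ⟨α, h₃, h₄⟩ := hF.exists_lift2_of_t1 (A.comp1 (A.inv1 g) h (by simp [e]))
    (B.wl2 (B.inv1 (F.F1 g)) β (by simp [h₁])) (by simp [h₂])
  have h₅ : A.s0 g = A.t0 (A.s1 α) := by rw [← A.t0_t1, h₃]; simp
  refine ⟨A.s1 α, h₅, A.wl2 g α h₅, ?_, by simp, by simp [h₃], ?_, by simp [h₄]⟩
  · rw [← A.s0_t1, h₃]; simp
  · rw [← F.s1_F2, h₄]; simp [h₁]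

/-! ### Liftings of 3-cells -/

lemma exists_lift3_of_t2 (α : A.C2) (N : B.C3) (h : B.t2 N = F.F2 α) :
    ∃ M, A.t2 M = α ∧ F.F3 M = N := by
  obtain ⟨M, -, h⟩ := hF.lift_iso α N (B.isInv3 _) h
  exact ⟨M, h⟩

/-- Lifting of a 3-cell `δ.(βf) → γ` when `δ`, `f` and `γ` are given. -/
lemma exists_lift3_wr2 (δ γ : A.C2) (f p q : A.C1) (hp hq)
    (h₁ : A.s1 γ = A.comp1 p f hp) (h₂ : A.t1 γ = A.t1 δ) (h₃ : A.s1 δ = A.comp1 q f hq)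
    (β : B.C2) (N : B.C3) (k) (k')
    (h₄ : B.s2 N = B.comp2 (F.F2 δ) (B.wr2 β (F.F1 f) k) k') (h₅ : B.t2 N = F.F2 γ) :
    ∃ (β' : A.C2) (e₁ : A.s1 β' = p) (e₂ : A.t1 β' = q) (M : A.C3),
      A.s2 M = A.comp2 δ (A.wr2 β' f (by rw [e₁, hp])) (by simp [h₃, e₂]) ∧ A.t2 M = γ ∧
      F.F2 β' = β ∧ F.F3 M = N := by
  -- Both known factors are moved to the target, so that the 3-cell goes from `β` alone to the image
  -- of `(δ⁻¹ γ) f⁻¹`. The source of its lift is the wanted `β'`, and the lift is whiskered back by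
  -- `f` and `δ`. The two lemmas below follow the same scheme.
  obtain ⟨M, h₆, h₇⟩ := hF.exists_lift3_of_t2
    (A.wr2 (A.comp2 (A.inv2 δ) γ (by simp [h₂])) (A.inv1 f) (by simp [h₁]))
    (B.wr3 (B.hcomp3 (B.id3 (B.inv2 (F.F2 δ))) N (by simp [h₄])) (B.inv1 (F.F1 f))
      (by simp [h₄])) (by simp [h₅])
  have e₁ : A.s1 (A.s2 M) = p := by
    rw [← A.s1_t2, h₆]; simp [h₁]
  have e₂ : A.t1 (A.s2 M) = q := by
    rw [← A.t1_t2, h₆]; simp [h₃]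
  refine ⟨A.s2 M, e₁, e₂, A.hcomp3 (A.id3 δ) (A.wr3 M f (by rw [e₁, hp])) (by simp [h₃, e₂]),
    by simp, by simp [h₆], ?_, by simp [h₇]⟩
  rw [← F.s2_F3, h₇]
  simp [h₄]

/-- Lifting of a 3-cell `δ.(gβ) → γ` when `δ`, `g` and `γ` are given. -/
lemma exists_lift3_wl2 (δ γ : A.C2) (g p q : A.C1) (hp hq)
    (h₁ : A.s1 γ = A.comp1 g p hp) (h₂ : A.t1 γ = A.t1 δ) (h₃ : A.s1 δ = A.comp1 g q hq)
    (β : B.C2) (N : B.C3) (k) (k')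
    (h₄ : B.s2 N = B.comp2 (F.F2 δ) (B.wl2 (F.F1 g) β k) k') (h₅ : B.t2 N = F.F2 γ) :
    ∃ (β' : A.C2) (e₁ : A.s1 β' = p) (e₂ : A.t1 β' = q) (M : A.C3),
      A.s2 M = A.comp2 δ (A.wl2 g β' (by rw [e₁, hp])) (by simp [h₃, e₂]) ∧ A.t2 M = γ ∧
      F.F2 β' = β ∧ F.F3 M = N := by
  obtain ⟨M, h₆, h₇⟩ := hF.exists_lift3_of_t2
    (A.wl2 (A.inv1 g) (A.comp2 (A.inv2 δ) γ (by simp [h₂])) (by simp [h₁]))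
    (B.wl3 (B.inv1 (F.F1 g)) (B.hcomp3 (B.id3 (B.inv2 (F.F2 δ))) N (by simp [h₄]))
      (by simp [h₄])) (by simp [h₅])
  have e₁ : A.s1 (A.s2 M) = p := by
    rw [← A.s1_t2, h₆]; simp [h₁]
  have e₂ : A.t1 (A.s2 M) = q := by
    rw [← A.t1_t2, h₆]; simp [h₃]
  refine ⟨A.s2 M, e₁, e₂, A.hcomp3 (A.id3 δ) (A.wl3 g M (by rw [e₁, hp])) (by simp [h₃, e₂]),
    by simp, by simp [h₆], ?_, by simp [h₇]⟩
  rw [← F.s2_F3, h₇]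
  simp [h₄]

/-- Lifting of a 3-cell `β.δ → γ` when `δ` and `γ` are given. -/
lemma exists_lift3_comp2 (δ γ : A.C2) (h₁ : A.s1 γ = A.s1 δ)
    (β : B.C2) (N : B.C3) (k)
    (h₄ : B.s2 N = B.comp2 β (F.F2 δ) k) (h₅ : B.t2 N = F.F2 γ) :
    ∃ (β' : A.C2) (e₁ : A.s1 β' = A.t1 δ) (M : A.C3), A.t1 β' = A.t1 γ ∧
      A.s2 M = A.comp2 β' δ e₁ ∧ A.t2 M = γ ∧ F.F2 β' = β ∧ F.F3 M = N := by
  obtain ⟨M, h₆, h₇⟩ := hF.exists_lift3_of_t2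
    (A.comp2 γ (A.inv2 δ) (by simp [h₁]))
    (B.hcomp3 N (B.id3 (B.inv2 (F.F2 δ))) (by simp [h₄])) (by simp [h₅])
  have e₁ : A.s1 (A.s2 M) = A.t1 δ := by
    rw [← A.s1_t2, h₆]; simp
  have e₂ : A.t1 (A.s2 M) = A.t1 γ := by
    rw [← A.t1_t2, h₆]; simp
  refine ⟨A.s2 M, e₁, A.hcomp3 M (A.id3 δ) (by simp [e₁]), e₂,
    by simp, by simp [h₆], ?_, by simp [h₇, GrayCat.hcomp3_id3]⟩
  rw [← F.s2_F3, h₇]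
  simp [h₄]

end IsFibration

end GrayFunctor

/-! ### The hexagon of a 4-simplex. -/

/-- The 2-dimensional part of the data of a 4-simplex. -/
structure TwoSkeleton (A : GrayCat.{u}) extends RawSimplex A (Fin 5) where
  isStrict₂ : toRawSimplex.IsStrict₂

namespace TwoSkeleton

open TwoCell RawSimplex

variable {A : GrayCat.{u}} (T : TwoSkeleton A)

@[simp] lemma s0_f {i j : Fin 5} (ij : i < j) : A.s0 (T.f i j) = T.ob i := T.isStrict₂.s0_f ij
@[simp] lemma t0_f {i j : Fin 5} (ij : i < j) : A.t0 (T.f i j) = T.ob j := T.isStrict₂.t0_f ij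
@[simp] lemma s1_α {i j k : Fin 5} (ij : i < j) (jk : j < k) :
    A.s1 (T.α i j k) = A.comp1 (T.f j k) (T.f i j) (by simp [ij, jk]) := T.isStrict₂.s1_α ij jk
@[simp] lemma t1_α {i j k : Fin 5} (ij : i < j) (jk : j < k) : A.t1 (T.α i j k) = T.f i k :=
  T.isStrict₂.t1_α ij jk

/-- The source of the 3-cell which is associated with a tetrahedron. -/
@[simps]
def src (i j k l : Fin 5) (ij : i < j := by decide) (jk : j < k := by decide)
    (kl : k < l := by decide) : TwoCell A :=
  ⟨A.comp2 (T.α i k l) (A.wl2 (T.f k l) (T.α i j k) (by simp [ij, jk, kl]))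
    (by simp [ij, jk, kl, ij.trans jk])⟩

/-- The target of the 3-cell which is associated with a tetrahedron. -/
@[simps]
def tgt (i j k l : Fin 5) (ij : i < j := by decide) (jk : j < k := by decide)
    (kl : k < l := by decide) : TwoCell A :=
  ⟨A.comp2 (T.α i j l) (A.wr2 (T.α j k l) (T.f i j) (by simp [ij, jk, kl]))
    (by simp [ij, jk, kl, jk.trans kl])⟩

/-! The vertices and the edges of the hexagon of 2-cells which is associated with a 4-simplex. -/

-- As in the permutohedron, the digits give the order in which the vertices 1, 2, 3 are removed from
-- the path 0 → 1 → 2 → 3 → 4. Five edges come from tetrahedra and the sixth, `e132_312`, is a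
-- pseudonaturality cell.
@[simps]
def v123 : TwoCell A :=
  ⟨A.comp2 (T.α 0 3 4) (A.comp2 (A.wl2 (T.f 3 4) (T.α 0 2 3) (by simp)) (A.wl2 (T.f 3 4) (A.wl2 (T.f 2 3) (T.α 0 1 2) (by simp)) (by simp)) (by simp)) (by simp)⟩

@[simps]
def v132 : TwoCell A :=
  ⟨A.comp2 (T.α 0 2 4) (A.comp2 (A.wr2 (T.α 2 3 4) (T.f 0 2) (by simp)) (A.wl2 (T.f 3 4) (A.wl2 (T.f 2 3) (T.α 0 1 2) (by simp)) (by simp)) (by simp)) (by simp)⟩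

@[simps]
def v213 : TwoCell A :=
  ⟨A.comp2 (T.α 0 3 4) (A.comp2 (A.wl2 (T.f 3 4) (T.α 0 1 3) (by simp)) (A.wl2 (T.f 3 4) (A.wr2 (T.α 1 2 3) (T.f 0 1) (by simp)) (by simp)) (by simp)) (by simp)⟩

@[simps]
def v231 : TwoCell A :=
  ⟨A.comp2 (T.α 0 1 4) (A.comp2 (A.wr2 (T.α 1 3 4) (T.f 0 1) (by simp)) (A.wl2 (T.f 3 4) (A.wr2 (T.α 1 2 3) (T.f 0 1) (by simp)) (by simp)) (by simp)) (by simp)⟩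

@[simps]
def v312 : TwoCell A :=
  ⟨A.comp2 (T.α 0 2 4) (A.comp2 (A.wl2 (T.f 2 4) (T.α 0 1 2) (by simp)) (A.wr2 (A.wr2 (T.α 2 3 4) (T.f 1 2) (by simp)) (T.f 0 1) (by simp)) (by simp)) (by simp)⟩

@[simps]
def v321 : TwoCell A :=
  ⟨A.comp2 (T.α 0 1 4) (A.comp2 (A.wr2 (T.α 1 2 4) (T.f 0 1) (by simp)) (A.wr2 (A.wr2 (T.α 2 3 4) (T.f 1 2) (by simp)) (T.f 0 1) (by simp)) (by simp)) (by simp)⟩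

def e123_213 (M : T.src 0 1 2 3 ⟶ T.tgt 0 1 2 3) : T.v123 ⟶ T.v213 :=
  Hom.mk (A.hcomp3 (A.id3 (T.α 0 3 4)) (A.wl3 (T.f 3 4) (Hom.cell M) (by simp)) (by simp))
    (by simp) (by simp)

def e123_132 (M : T.src 0 2 3 4 ⟶ T.tgt 0 2 3 4) : T.v123 ⟶ T.v132 :=
  Hom.mk (A.hcomp3 (Hom.cell M) (A.id3 (A.wl2 (T.f 3 4) (A.wl2 (T.f 2 3) (T.α 0 1 2) (by simp)) (by simp))) (by simp))
    (by simp) (by simp)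

def e132_312 : T.v132 ⟶ T.v312 :=
  Hom.mk (A.hcomp3 (A.id3 (T.α 0 2 4)) (A.ich (T.α 2 3 4) (T.α 0 1 2) (by simp)) (by simp))
    (by simp) (by simp)

def e213_231 (M : T.src 0 1 3 4 ⟶ T.tgt 0 1 3 4) : T.v213 ⟶ T.v231 :=
  Hom.mk (A.hcomp3 (Hom.cell M) (A.id3 (A.wl2 (T.f 3 4) (A.wr2 (T.α 1 2 3) (T.f 0 1) (by simp)) (by simp))) (by simp))
    (by simp) (by simp)

def e231_321 (M : T.src 1 2 3 4 ⟶ T.tgt 1 2 3 4) : T.v231 ⟶ T.v321 :=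
  Hom.mk (A.hcomp3 (A.id3 (T.α 0 1 4)) (A.wr3 (Hom.cell M) (T.f 0 1) (by simp)) (by simp))
    (by simp) (by simp)

def e312_321 (M : T.src 0 1 2 4 ⟶ T.tgt 0 1 2 4) : T.v312 ⟶ T.v321 :=
  Hom.mk (A.hcomp3 (Hom.cell M) (A.id3 (A.wr2 (A.wr2 (T.α 2 3 4) (T.f 1 2) (by simp)) (T.f 0 1) (by simp))) (by simp))
    (by simp) (by simp)

/-- The compatibility of the 3-cells of a 4-simplex. -/
def Compatible (M₁₂₃ : T.src 0 1 2 3 ⟶ T.tgt 0 1 2 3) (M₁₃ : T.src 0 1 3 4 ⟶ T.tgt 0 1 3 4)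
    (M₂₃₄ : T.src 1 2 3 4 ⟶ T.tgt 1 2 3 4) (M₂₃ : T.src 0 2 3 4 ⟶ T.tgt 0 2 3 4)
    (M₁₂ : T.src 0 1 2 4 ⟶ T.tgt 0 1 2 4) : Prop :=
  T.e123_213 M₁₂₃ ≫ T.e213_231 M₁₃ ≫ T.e231_321 M₂₃₄ =
    T.e123_132 M₂₃ ≫ T.e132_312 ≫ T.e312_321 M₁₂

section

variable [A.IsGroupoid]

instance {a b : TwoCell A} (M : a ⟶ b) : IsIso M := Hom.isIso A.isInv3 M

/-- Each edge is a tetrahedron whiskered by cells that depend only on the 2-skeleton. Whiskering by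
their inverses recovers the tetrahedron from the edge. -/
lemma bijective_e123_213 : Function.Bijective T.e123_213 := by
  refine Function.bijective_iff_has_inverse.2 ⟨fun N => Hom.mk (A.wl3 (A.inv1 (T.f 3 4)) (A.hcomp3 (A.id3 (A.inv2 (T.α 0 3 4))) (Hom.cell N) (by simp)) (by simp)) (by simp) (by simp),
    fun M => Hom.ext_cell ?_, fun N => Hom.ext_cell ?_⟩ <;> simp [e123_213]

lemma bijective_e231_321 : Function.Bijective T.e231_321 := by
  refine Function.bijective_iff_has_inverse.2 ⟨fun N => Hom.mk (A.wr3 (A.hcomp3 (A.id3 (A.inv2 (T.α 0 1 4))) (Hom.cell N) (by simp)) (A.inv1 (T.f 0 1)) (by simp)) (by simp) (by simp),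
    fun M => Hom.ext_cell ?_, fun N => Hom.ext_cell ?_⟩ <;> simp [e231_321]

lemma bijective_e123_132 : Function.Bijective T.e123_132 := by
  refine Function.bijective_iff_has_inverse.2 ⟨fun N => Hom.mk (A.hcomp3 (Hom.cell N) (A.id3 (A.inv2 (A.wl2 (T.f 3 4) (A.wl2 (T.f 2 3) (T.α 0 1 2) (by simp)) (by simp)))) (by simp)) (by simp) (by simp),
    fun M => Hom.ext_cell ?_, fun N => Hom.ext_cell ?_⟩ <;> simp [e123_132, GrayCat.hcomp3_id3]

lemma bijective_e213_231 : Function.Bijective T.e213_231 := by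
  refine Function.bijective_iff_has_inverse.2 ⟨fun N => Hom.mk (A.hcomp3 (Hom.cell N) (A.id3 (A.inv2 (A.wl2 (T.f 3 4) (A.wr2 (T.α 1 2 3) (T.f 0 1) (by simp)) (by simp)))) (by simp)) (by simp) (by simp),
    fun M => Hom.ext_cell ?_, fun N => Hom.ext_cell ?_⟩ <;> simp [e213_231, GrayCat.hcomp3_id3]

lemma bijective_e312_321 : Function.Bijective T.e312_321 := by
  refine Function.bijective_iff_has_inverse.2 ⟨fun N => Hom.mk (A.hcomp3 (Hom.cell N) (A.id3 (A.inv2 (A.wr2 (A.wr2 (T.α 2 3 4) (T.f 1 2) (by simp)) (T.f 0 1) (by simp)))) (by simp)) (by simp) (by simp),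
    fun M => Hom.ext_cell ?_, fun N => Hom.ext_cell ?_⟩ <;> simp [e312_321, GrayCat.hcomp3_id3]

/-- In a commutative hexagon of isomorphisms, each edge is determined by the five others, and by
bijectivity so is the tetrahedron that gives this edge. Here `M₁₂₃` is the tetrahedron 0123, `M₂₃₄`
is 1234, and `M` with two indices i, j is 0ij4. -/
lemma existsUnique_compatible₁₂₃ (M₁₃ M₂₃₄ M₂₃ M₁₂) :
    ∃! M, T.Compatible M M₁₃ M₂₃₄ M₂₃ M₁₂ := by
  obtain ⟨M, hM, hM'⟩ := (Function.bijective_iff_existsUnique _).1 T.bijective_e123_213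
    ((T.e123_132 M₂₃ ≫ T.e132_312 ≫ T.e312_321 M₁₂) ≫ inv (T.e213_231 M₁₃ ≫ T.e231_321 M₂₃₄))
  refine ⟨M, by simp [Compatible, hM], fun N hN => hM' N ?_⟩
  beta_reduce
  rw [IsIso.eq_comp_inv]; simpa [Compatible] using hN

lemma existsUnique_compatible₂₃₄ (M₁₂₃ M₁₃ M₂₃ M₁₂) :
    ∃! M, T.Compatible M₁₂₃ M₁₃ M M₂₃ M₁₂ := by
  obtain ⟨M, hM, hM'⟩ := (Function.bijective_iff_existsUnique _).1 T.bijective_e231_321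
    (inv (T.e123_213 M₁₂₃ ≫ T.e213_231 M₁₃) ≫ T.e123_132 M₂₃ ≫ T.e132_312 ≫ T.e312_321 M₁₂)
  refine ⟨M, by simp [Compatible, hM], fun N hN => hM' N ?_⟩
  beta_reduce
  rw [IsIso.eq_inv_comp]; simpa [Compatible] using hN

lemma existsUnique_compatible₁₃ (M₁₂₃ M₂₃₄ M₂₃ M₁₂) :
    ∃! M, T.Compatible M₁₂₃ M M₂₃₄ M₂₃ M₁₂ := by
  obtain ⟨M, hM, hM'⟩ := (Function.bijective_iff_existsUnique _).1 T.bijective_e213_231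
    (inv (T.e123_213 M₁₂₃) ≫ (T.e123_132 M₂₃ ≫ T.e132_312 ≫ T.e312_321 M₁₂) ≫
      inv (T.e231_321 M₂₃₄))
  refine ⟨M, by simp [Compatible, hM], fun N hN => hM' N ?_⟩
  beta_reduce
  rw [IsIso.eq_inv_comp, IsIso.eq_comp_inv]; simpa [Compatible] using hN

lemma existsUnique_compatible₂₃ (M₁₂₃ M₁₃ M₂₃₄ M₁₂) :
    ∃! M, T.Compatible M₁₂₃ M₁₃ M₂₃₄ M M₁₂ := by
  obtain ⟨M, hM, hM'⟩ := (Function.bijective_iff_existsUnique _).1 T.bijective_e123_132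
    ((T.e123_213 M₁₂₃ ≫ T.e213_231 M₁₃ ≫ T.e231_321 M₂₃₄) ≫ inv (T.e132_312 ≫ T.e312_321 M₁₂))
  refine ⟨M, by simp [Compatible, hM], fun N hN => hM' N ?_⟩
  beta_reduce
  rw [IsIso.eq_comp_inv]; simpa [Compatible] using hN.symm

lemma existsUnique_compatible₁₂ (M₁₂₃ M₁₃ M₂₃₄ M₂₃) :
    ∃! M, T.Compatible M₁₂₃ M₁₃ M₂₃₄ M₂₃ M := by
  obtain ⟨M, hM, hM'⟩ := (Function.bijective_iff_existsUnique _).1 T.bijective_e312_321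
    (inv (T.e123_132 M₂₃ ≫ T.e132_312) ≫ T.e123_213 M₁₂₃ ≫ T.e213_231 M₁₃ ≫ T.e231_321 M₂₃₄)
  refine ⟨M, by simp [Compatible, hM], fun N hN => hM' N ?_⟩
  beta_reduce
  rw [IsIso.eq_inv_comp]; simpa [Compatible] using hN.symm

/-- The only tetrahedron not containing `m` is the opposite one, and it is the unique solution of
the compatibility condition once the four others are fixed. -/
lemma eq_of_compatible (m : Fin 5) (M M' : ∀ (i j k l : Fin 5) (ij : i < j := by decide)
      (jk : j < k := by decide) (kl : k < l := by decide), T.src i j k l ij jk kl ⟶ T.tgt i j k l ij jk kl)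
    (c : T.Compatible (M 0 1 2 3) (M 0 1 3 4) (M 1 2 3 4) (M 0 2 3 4) (M 0 1 2 4))
    (c' : T.Compatible (M' 0 1 2 3) (M' 0 1 3 4) (M' 1 2 3 4) (M' 0 2 3 4) (M' 0 1 2 4))
    (h : ∀ i j k l ij jk kl, m = i ∨ m = j ∨ m = k ∨ m = l →
      M i j k l ij jk kl = M' i j k l ij jk kl) (i j k l ij jk kl) :
    M i j k l ij jk kl = M' i j k l ij jk kl := by
  by_cases hm : m = i ∨ m = j ∨ m = k ∨ m = l
  · exact h _ _ _ _ _ _ _ hm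
  have h₀ := h 1 2 3 4 (by decide) (by decide) (by decide)
  have h₁ := h 0 2 3 4 (by decide) (by decide) (by decide)
  have h₂ := h 0 1 3 4 (by decide) (by decide) (by decide)
  have h₃ := h 0 1 2 4 (by decide) (by decide) (by decide)
  have h₄ := h 0 1 2 3 (by decide) (by decide) (by decide)
  have hm' : m = 0 ∨ m = 1 ∨ m = 2 ∨ m = 3 ∨ m = 4 := by omega
  rcases hm' with rfl | rfl | rfl | rfl | rfl
  · rw [← h₁ (by simp), ← h₂ (by simp), ← h₃ (by simp), ← h₄ (by simp)] at c'
    obtain ⟨rfl, rfl, rfl, rfl⟩ : i = 1 ∧ j = 2 ∧ k = 3 ∧ l = 4 := by omega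
    exact (T.existsUnique_compatible₂₃₄ _ _ _ _).unique c c'
  · rw [← h₀ (by simp), ← h₂ (by simp), ← h₃ (by simp), ← h₄ (by simp)] at c'
    obtain ⟨rfl, rfl, rfl, rfl⟩ : i = 0 ∧ j = 2 ∧ k = 3 ∧ l = 4 := by omega
    exact (T.existsUnique_compatible₂₃ _ _ _ _).unique c c'
  · rw [← h₀ (by simp), ← h₁ (by simp), ← h₃ (by simp), ← h₄ (by simp)] at c'
    obtain ⟨rfl, rfl, rfl, rfl⟩ : i = 0 ∧ j = 1 ∧ k = 3 ∧ l = 4 := by omega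
    exact (T.existsUnique_compatible₁₃ _ _ _ _).unique c c'
  · rw [← h₀ (by simp), ← h₁ (by simp), ← h₂ (by simp), ← h₄ (by simp)] at c'
    obtain ⟨rfl, rfl, rfl, rfl⟩ : i = 0 ∧ j = 1 ∧ k = 2 ∧ l = 4 := by omega
    exact (T.existsUnique_compatible₁₂ _ _ _ _).unique c c'
  · rw [← h₀ (by simp), ← h₁ (by simp), ← h₂ (by simp), ← h₃ (by simp)] at c'
    obtain ⟨rfl, rfl, rfl, rfl⟩ : i = 0 ∧ j = 1 ∧ k = 2 ∧ l = 3 := by omega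
    exact (T.existsUnique_compatible₁₂₃ _ _ _ _).unique c c'

end

/-- The hexagon is the pasting equation written with typed morphisms; unfolding both sides gives the
same equality of 3-cells. The family `X` replaces the irrelevant 3-cells of the `TwoSkeleton`. -/
lemma compatible_iff {X} (h : IsStrict₃ {T.toRawSimplex with X := X})
    (M₁₂₃ M₁₃ M₂₃₄ M₂₃ M₁₂) (h₁₂₃ : Hom.cell M₁₂₃ = X 0 1 2 3) (h₁₃ : Hom.cell M₁₃ = X 0 1 3 4)
    (h₂₃₄ : Hom.cell M₂₃₄ = X 1 2 3 4) (h₂₃ : Hom.cell M₂₃ = X 0 2 3 4)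
    (h₁₂ : Hom.cell M₁₂ = X 0 1 2 4) (l₁ l₂ l₃ l₄) :
    T.Compatible M₁₂₃ M₁₃ M₂₃₄ M₂₃ M₁₂ ↔
      GraySimplexData.pasting₁ (toData _ h) (a := 0) (b := 1) (c := 2) (d := 3) (e := 4)
        l₁ l₂ l₃ l₄ = GraySimplexData.pasting₂ (toData _ h) l₁ l₂ l₃ l₄ := by
  rw [Compatible, ← Hom.ext_cell_iff]
  simp [e123_213, e213_231, e231_321, e123_132, e132_312, e312_321,
    GraySimplexData.pasting₁, GraySimplexData.pasting₂, f', α', X', *]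

end TwoSkeleton

/-! ### Existence and uniqueness of the missing tetrahedron of a 4-dimensional horn. -/

namespace RawSimplex

open TwoCell

variable {A : GrayCat.{u}}

/-- Replacement of the 3-cells which are associated with the tuples not containing `k`. -/
@[simps]
def replaceX {P : Type} [DecidableEq P] (R : RawSimplex A P) (k : P) (M : A.C3) :
    RawSimplex A P where
  ob := R.ob
  f := R.f
  α := R.α
  X a b c d := if k = a ∨ k = b ∨ k = c ∨ k = d then R.X a b c d else M

/-- The type of the 3-cell which corresponds to a tuple. -/
structure IsTyped₃ {P : Type} [LinearOrder P] (R : RawSimplex A P) (h : R.IsStrict₂)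
    (i j k l : P) (ij : i < j) (jk : j < k) (kl : k < l) : Prop where
  s2_X :
    A.s2 (R.X i j k l) = A.comp2 (R.α i k l)
      (A.wl2 (R.f k l) (R.α i j k) (by simp [h.s1_α ij jk, h.s0_f kl, h.t0_f jk]))
      (by simp [h.s1_α (ij.trans jk) kl, h.t1_α ij jk])
  t2_X :
    A.t2 (R.X i j k l) = A.comp2 (R.α i j l)
      (A.wr2 (R.α j k l) (R.f i j) (by simp [h.s1_α jk kl, h.s0_f jk, h.t0_f ij]))
      (by simp [h.s1_α ij (jk.trans kl), h.t1_α jk kl])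

lemma isStrict₃_of_isTyped₃ {P : Type} [LinearOrder P] (R : RawSimplex A P) (h : R.IsStrict₂)
    (H : ∀ {i j k l} (ij : i < j) (jk : j < k) (kl : k < l), R.IsTyped₃ h i j k l ij jk kl) :
    R.IsStrict₃ where
  toIsStrict₂ := h
  s2_X ij jk kl := (H ij jk kl).s2_X
  t2_X ij jk kl := (H ij jk kl).t2_X

variable [A.IsGroupoid]

/-- The filling of the horns of dimension 4. -/
lemma exists_replaceX (R : RawSimplex A (Fin 5)) (h : R.IsStrict₂) (m : Fin 5)
    (H : ∀ {i j k l} (ij : i < j) (jk : j < k) (kl : k < l),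
      m = i ∨ m = j ∨ m = k ∨ m = l → R.IsTyped₃ h i j k l ij jk kl) :
    ∃ (M : A.C3) (h' : (R.replaceX m M).IsStrict₃),
      ∀ {a b c d e : Fin 5} (ab : a < b) (bc : b < c) (cd : c < d) (de : d < e),
        ((R.replaceX m M).toData h').pasting₁ ab.le bc.le cd.le de.le =
          ((R.replaceX m M).toData h').pasting₂ ab.le bc.le cd.le de.le := by
  let T : TwoSkeleton A := ⟨R, h⟩
  have M (i j k l : Fin 5) (ij : i < j := by decide) (jk : j < k := by decide)
    (kl : k < l := by decide) (h : m = i ∨ m = j ∨ m = k ∨ m = l) :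
    ∃ M : T.src i j k l ij jk kl ⟶ T.tgt i j k l ij jk kl, Hom.cell M = R.X i j k l :=
    ⟨Hom.mk (R.X i j k l) (H ij jk kl h).s2_X (H ij jk kl h).t2_X, rfl⟩
  -- Only one strictly increasing 4-tuple in `Fin 5` omits `m`, so the replacement family needs just
  -- one new boundary condition.
  have key (M : A.C3) (i j k l : Fin 5) (ij : i < j) (jk : j < k) (kl : k < l)
      (hm : ¬ (m = i ∨ m = j ∨ m = k ∨ m = l)) (hs : A.s2 M = (T.src i j k l ij jk kl).cell)
      (ht : A.t2 M = (T.tgt i j k l ij jk kl).cell) : (R.replaceX m M).IsStrict₃ := by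
    refine isStrict₃_of_isTyped₃ _ ⟨h.1, h.2, h.3, h.4⟩ fun {i' j' k' l'} ij' jk' kl' => ?_
    by_cases hm' : m = i' ∨ m = j' ∨ m = k' ∨ m = l'
    · refine ⟨?_, ?_⟩
      · simpa [hm'] using (H ij' jk' kl' hm').s2_X
      · simpa [hm'] using (H ij' jk' kl' hm').t2_X
    · obtain ⟨rfl, rfl, rfl, rfl⟩ : i' = i ∧ j' = j ∧ k' = k ∧ l' = l := by omega
      refine ⟨?_, ?_⟩
      · simpa [hm'] using hs
      · simpa [hm'] using ht
  have key' (M : A.C3) (h' : (R.replaceX m M).IsStrict₃) (h₁ h₂ h₃ h₄)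
      (hh : GraySimplexData.pasting₁ (toData _ h') (a := 0) (b := 1) (c := 2) (d := 3) (e := 4)
        h₁ h₂ h₃ h₄ = GraySimplexData.pasting₂ (toData _ h') h₁ h₂ h₃ h₄)
      {a b c d e : Fin 5} (ab : a < b) (bc : b < c) (cd : c < d) (de : d < e) :
        ((R.replaceX m M).toData h').pasting₁ ab.le bc.le cd.le de.le =
          ((R.replaceX m M).toData h').pasting₂ ab.le bc.le cd.le de.le := by
    obtain ⟨rfl, rfl, rfl, rfl, rfl⟩ : a = 0 ∧ b = 1 ∧ c = 2 ∧ d = 3 ∧ e = 4 := by omega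
    exact hh
  have l₁ : (0 : Fin 5) ≤ 1 := by decide
  have l₂ : (1 : Fin 5) ≤ 2 := by decide
  have l₃ : (2 : Fin 5) ≤ 3 := by decide
  have l₄ : (3 : Fin 5) ≤ 4 := by decide
  have hm : m = 0 ∨ m = 1 ∨ m = 2 ∨ m = 3 ∨ m = 4 := by omega
  rcases hm with rfl | rfl | rfl | rfl | rfl
  · obtain ⟨M₁₂₃, h₁₂₃⟩ := M 0 1 2 3 (h := by simp)
    obtain ⟨M₁₃, h₁₃⟩ := M 0 1 3 4 (h := by simp)
    obtain ⟨M₂₃, h₂₃⟩ := M 0 2 3 4 (h := by simp)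
    obtain ⟨M₁₂, h₁₂⟩ := M 0 1 2 4 (h := by simp)
    obtain ⟨N, hN, -⟩ := T.existsUnique_compatible₂₃₄ M₁₂₃ M₁₃ M₂₃ M₁₂
    have h' := key (Hom.cell N) _ _ _ _ (by decide) (by decide) (by decide) (by decide)
      (Hom.s2_cell N) (Hom.t2_cell N)
    exact ⟨Hom.cell N, h', key' _ h' l₁ l₂ l₃ l₄
      ((T.compatible_iff h' M₁₂₃ M₁₃ N M₂₃ M₁₂ h₁₂₃ h₁₃ (by simp) h₂₃ h₁₂ l₁ l₂ l₃ l₄).1 hN)⟩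
  · obtain ⟨M₁₂₃, h₁₂₃⟩ := M 0 1 2 3 (h := by simp)
    obtain ⟨M₁₃, h₁₃⟩ := M 0 1 3 4 (h := by simp)
    obtain ⟨M₂₃₄, h₂₃₄⟩ := M 1 2 3 4 (h := by simp)
    obtain ⟨M₁₂, h₁₂⟩ := M 0 1 2 4 (h := by simp)
    obtain ⟨N, hN, -⟩ := T.existsUnique_compatible₂₃ M₁₂₃ M₁₃ M₂₃₄ M₁₂
    have h' := key (Hom.cell N) _ _ _ _ (by decide) (by decide) (by decide) (by decide)
      (Hom.s2_cell N) (Hom.t2_cell N)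
    exact ⟨Hom.cell N, h', key' _ h' l₁ l₂ l₃ l₄
      ((T.compatible_iff h' M₁₂₃ M₁₃ M₂₃₄ N M₁₂ h₁₂₃ h₁₃ h₂₃₄ (by simp) h₁₂ l₁ l₂ l₃ l₄).1 hN)⟩
  · obtain ⟨M₁₂₃, h₁₂₃⟩ := M 0 1 2 3 (h := by simp)
    obtain ⟨M₂₃₄, h₂₃₄⟩ := M 1 2 3 4 (h := by simp)
    obtain ⟨M₂₃, h₂₃⟩ := M 0 2 3 4 (h := by simp)
    obtain ⟨M₁₂, h₁₂⟩ := M 0 1 2 4 (h := by simp)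
    obtain ⟨N, hN, -⟩ := T.existsUnique_compatible₁₃ M₁₂₃ M₂₃₄ M₂₃ M₁₂
    have h' := key (Hom.cell N) _ _ _ _ (by decide) (by decide) (by decide) (by decide)
      (Hom.s2_cell N) (Hom.t2_cell N)
    exact ⟨Hom.cell N, h', key' _ h' l₁ l₂ l₃ l₄
      ((T.compatible_iff h' M₁₂₃ N M₂₃₄ M₂₃ M₁₂ h₁₂₃ (by simp) h₂₃₄ h₂₃ h₁₂ l₁ l₂ l₃ l₄).1 hN)⟩
  · obtain ⟨M₁₂₃, h₁₂₃⟩ := M 0 1 2 3 (h := by simp)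
    obtain ⟨M₁₃, h₁₃⟩ := M 0 1 3 4 (h := by simp)
    obtain ⟨M₂₃₄, h₂₃₄⟩ := M 1 2 3 4 (h := by simp)
    obtain ⟨M₂₃, h₂₃⟩ := M 0 2 3 4 (h := by simp)
    obtain ⟨N, hN, -⟩ := T.existsUnique_compatible₁₂ M₁₂₃ M₁₃ M₂₃₄ M₂₃
    have h' := key (Hom.cell N) _ _ _ _ (by decide) (by decide) (by decide) (by decide)
      (Hom.s2_cell N) (Hom.t2_cell N)
    exact ⟨Hom.cell N, h', key' _ h' l₁ l₂ l₃ l₄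
      ((T.compatible_iff h' M₁₂₃ M₁₃ M₂₃₄ M₂₃ N h₁₂₃ h₁₃ h₂₃₄ h₂₃ (by simp) l₁ l₂ l₃ l₄).1 hN)⟩
  · obtain ⟨M₁₃, h₁₃⟩ := M 0 1 3 4 (h := by simp)
    obtain ⟨M₂₃₄, h₂₃₄⟩ := M 1 2 3 4 (h := by simp)
    obtain ⟨M₂₃, h₂₃⟩ := M 0 2 3 4 (h := by simp)
    obtain ⟨M₁₂, h₁₂⟩ := M 0 1 2 4 (h := by simp)
    obtain ⟨N, hN, -⟩ := T.existsUnique_compatible₁₂₃ M₁₃ M₂₃₄ M₂₃ M₁₂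
    have h' := key (Hom.cell N) _ _ _ _ (by decide) (by decide) (by decide) (by decide)
      (Hom.s2_cell N) (Hom.t2_cell N)
    exact ⟨Hom.cell N, h', key' _ h' l₁ l₂ l₃ l₄
      ((T.compatible_iff h' N M₁₃ M₂₃₄ M₂₃ M₁₂ (by simp) h₁₃ h₂₃₄ h₂₃ h₁₂ l₁ l₂ l₃ l₄).1 hN)⟩

end RawSimplex

namespace GraySimplexData

open TwoCell RawSimplex

variable {A : GrayCat.{u}} [A.IsGroupoid]

/-- The 2-dimensional part of a 4-simplex. -/
@[simps! ob f α]
def twoSkeleton (w : GraySimplexData A (Fin 5)) : TwoSkeleton A where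
  ob := w.ob
  -- The alternatives to ordered tuples, here and for 2-cells, are placeholders. So are all the
  -- 3-cells, since only the 2-skeleton is retained.
  f i j := if h : i ≤ j then w.f h else w.f (le_refl i)
  α i j k := if h : i ≤ j ∧ j ≤ k then w.α h.1 h.2 else w.α (le_refl i) (le_refl i)
  X i _ _ _ := A.id3 (w.α (le_refl i) (le_refl i))
  isStrict₂ := by
    constructor
    case t1_α =>
      intro i j k ij jk
      simp [ij.le, jk.le, (ij.trans jk).le]
    all_goals simp +contextual [le_of_lt]

lemma compatible_twoSkeleton_iff (w : GraySimplexData A (Fin 5)) (M₁₂₃ M₁₃ M₂₃₄ M₂₃ M₁₂)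
    (l₁ : (0 : Fin 5) ≤ 1) (l₂ : (1 : Fin 5) ≤ 2) (l₃ : (2 : Fin 5) ≤ 3) (l₄ : (3 : Fin 5) ≤ 4)
    (h₁₂₃ : Hom.cell M₁₂₃ = w.X l₁ l₂ l₃) (h₁₃ : Hom.cell M₁₃ = w.X l₁ (l₂.trans l₃) l₄)
    (h₂₃₄ : Hom.cell M₂₃₄ = w.X l₂ l₃ l₄) (h₂₃ : Hom.cell M₂₃ = w.X (l₁.trans l₂) l₃ l₄)
    (h₁₂ : Hom.cell M₁₂ = w.X l₁ l₂ (l₃.trans l₄)) :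
    w.twoSkeleton.Compatible M₁₂₃ M₁₃ M₂₃₄ M₂₃ M₁₂ ↔
      w.pasting₁ l₁ l₂ l₃ l₄ = w.pasting₂ l₁ l₂ l₃ l₄ := by
  rw [TwoSkeleton.Compatible, ← Hom.ext_cell_iff]
  simp [TwoSkeleton.e123_213, TwoSkeleton.e213_231, TwoSkeleton.e231_321, TwoSkeleton.e123_132,
    TwoSkeleton.e132_312, TwoSkeleton.e312_321, GraySimplexData.pasting₁,
    GraySimplexData.pasting₂, *]

/-- The 3-cells of a 4-simplex, as morphisms. -/
def tetHom (w : GraySimplexData A (Fin 5)) (i j k l : Fin 5) (ij : i < j := by decide)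
    (jk : j < k := by decide) (kl : k < l := by decide) :
    w.twoSkeleton.src i j k l ij jk kl ⟶ w.twoSkeleton.tgt i j k l ij jk kl :=
  Hom.mk (w.X ij.le jk.le kl.le) (by simp [ij.le, jk.le, kl.le, (ij.trans jk).le])
    (by simp [ij.le, jk.le, kl.le, (jk.trans kl).le])

/-- The 3-cells of a 4-simplex are determined by all but one of them. -/
lemma X_eq_of_horn (w w' : GraySimplexData A (Fin 5)) (hob : w.ob = w'.ob)
    (hf : ∀ {i j} (ij : i ≤ j), w.f ij = w'.f ij)
    (hα : ∀ {i j k} (ij : i ≤ j) (jk : j ≤ k), w.α ij jk = w'.α ij jk) (m : Fin 5)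
    (hX : ∀ {i j k l} (ij : i < j) (jk : j < k) (kl : k < l), m = i ∨ m = j ∨ m = k ∨ m = l →
      w.X ij.le jk.le kl.le = w'.X ij.le jk.le kl.le)
    (hw : ∀ {a b c d e : Fin 5} (ab : a < b) (bc : b < c) (cd : c < d) (de : d < e),
      w.pasting₁ ab.le bc.le cd.le de.le = w.pasting₂ ab.le bc.le cd.le de.le)
    (hw' : ∀ {a b c d e : Fin 5} (ab : a < b) (bc : b < c) (cd : c < d) (de : d < e),
      w'.pasting₁ ab.le bc.le cd.le de.le = w'.pasting₂ ab.le bc.le cd.le de.le)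
    {i j k l} (ij : i < j) (jk : j < k) (kl : k < l) :
    w.X ij.le jk.le kl.le = w'.X ij.le jk.le kl.le := by
  by_cases hm : m = i ∨ m = j ∨ m = k ∨ m = l
  · exact hX ij jk kl hm
  have l₁ : (0 : Fin 5) < 1 := by decide
  have l₂ : (1 : Fin 5) < 2 := by decide
  have l₃ : (2 : Fin 5) < 3 := by decide
  have l₄ : (3 : Fin 5) < 4 := by decide
  have c := (w.compatible_twoSkeleton_iff (w.tetHom 0 1 2 3) (w.tetHom 0 1 3 4) (w.tetHom 1 2 3 4)
    (w.tetHom 0 2 3 4) (w.tetHom 0 1 2 4) l₁.le l₂.le l₃.le l₄.le rfl rfl rfl rfl rfl).2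
      (hw l₁ l₂ l₃ l₄)
  have c' := (w'.compatible_twoSkeleton_iff (w'.tetHom 0 1 2 3) (w'.tetHom 0 1 3 4)
    (w'.tetHom 1 2 3 4) (w'.tetHom 0 2 3 4) (w'.tetHom 0 1 2 4) l₁.le l₂.le l₃.le l₄.le
      rfl rfl rfl rfl rfl).2 (hw' l₁ l₂ l₃ l₄)
  clear hw hw'
  -- The types of the 3-cells depend on the lower cells. Once these are identified by substitution,
  -- the two 2-skeleta coincide definitionally and the uniqueness statement applies to both families
  -- of tetrahedra.
  obtain ⟨ob, f, hf₁, hf₂, hf₃, α, hα₁, hα₂, hα₃, hα₄, X, hX₁, hX₂, hX₃, hX₄, hX₅⟩ := w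
  obtain ⟨ob', f', hf₁', hf₂', hf₃', α', hα₁', hα₂', hα₃', hα₄',
    X', hX₁', hX₂', hX₃', hX₄', hX₅'⟩ := w'
  obtain rfl : ob = ob' := hob
  obtain rfl : @f = @f' := by ext; apply hf
  obtain rfl : @α = @α' := by ext; apply hα
  exact congrArg Hom.cell (TwoSkeleton.eq_of_compatible _ m _ _ c c'
    (fun i j k l ij jk kl h => Hom.ext_cell (hX ij jk kl h)) i j k l ij jk kl)

end GraySimplexData

/-! ### Tuples of vertices and the faces that contain them. -/

/-- The monotone map which is given by a monotone tuple of length 5. -/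
def OrderHom.tuple {P : Type} [Preorder P] {a b c d e : P} (ab : a ≤ b) (bc : b ≤ c) (cd : c ≤ d)
    (de : d ≤ e) : Fin 5 →o P where
  toFun := ![a, b, c, d, e]
  monotone' := by
    rw [Fin.monotone_iff_le_succ]
    intro i
    fin_cases i <;> simpa

/-- A subset `J` avoids a tuple if one of its elements is not in the tuple. -/
def Set.Avoids {P : Type} (J : Set P) (a b c d e : P) : Prop :=
  ∃ j ∈ J, j ≠ a ∧ j ≠ b ∧ j ≠ c ∧ j ≠ d ∧ j ≠ e

/-- An avoided tuple lies in the face opposite to some `j ∈ J`. Shorter tuples are padded by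
repeating the last entry, so that a single notion and a single kind of monotone map serve for cells
of all dimensions and for the pasting equations. The relevant sets are the complement of `k` for a
horn and the whole of `P` for a boundary. -/
lemma Set.Avoids.tuple {P : Type} [Preorder P] {J : Set P} {a b c d e : P}
    (h : J.Avoids a b c d e) (ab : a ≤ b) (bc : b ≤ c) (cd : c ≤ d) (de : d ≤ e) :
    ∃ j ∈ J, ∀ i, OrderHom.tuple ab bc cd de i ≠ j := by
  obtain ⟨j, hj, h₁, h₂, h₃, h₄, h₅⟩ := h
  refine ⟨j, hj, fun i => ?_⟩
  fin_cases i
  exacts [h₁.symm, h₂.symm, h₃.symm, h₄.symm, h₅.symm]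

namespace RawSimplex

variable {A : GrayCat.{u}} {P : Type} [LinearOrder P]

/-- A simplex agrees with a family of cells along a monotone map. -/
structure AgreesAlong (R : RawSimplex A P) {m : ℕ} (σ : Fin (m + 1) →o P)
    (x : GraySimplexData A (Fin (m + 1))) : Prop where
  ob_eq : ∀ i, x.ob i = R.ob (σ i)
  f_eq : ∀ {i j} (ij : i ≤ j), x.f ij = R.f' (σ i) (σ j)
  α_eq : ∀ {i j k} (ij : i ≤ j) (jk : j ≤ k), x.α ij jk = R.α' (σ i) (σ j) (σ k)
  X_eq : ∀ {i j k l} (ij : i ≤ j) (jk : j ≤ k) (kl : k ≤ l),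
    x.X ij jk kl = R.X' (σ i) (σ j) (σ k) (σ l)

/-- Two families of cells agree on the tuples which are avoided by a subset. -/
structure AgreesOn (R R' : RawSimplex A P) (J : Set P) : Prop where
  ob_eq : ∀ {a}, J.Avoids a a a a a → R'.ob a = R.ob a
  f_eq : ∀ {a b}, a < b → J.Avoids a b b b b → R'.f a b = R.f a b
  α_eq : ∀ {a b c}, a < b → b < c → J.Avoids a b c c c → R'.α a b c = R.α a b c
  X_eq : ∀ {a b c d}, a < b → b < c → c < d → J.Avoids a b c d d → R'.X a b c d = R.X a b c d

namespace AgreesOn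

variable {R R' : RawSimplex A P} {J : Set P} (H : R.AgreesOn R' J)

include H

lemma f'_eq {a b : P} (ab : a ≤ b) (h : J.Avoids a b b b b) : R'.f' a b = R.f' a b := by
  obtain rfl | ab := ab.eq_or_lt
  · simp [H.ob_eq h]
  · simp [f'_of_lt, ab, H.f_eq ab h]

lemma α'_eq {a b c : P} (ab : a ≤ b) (bc : b ≤ c) (h : J.Avoids a b c c c) :
    R'.α' a b c = R.α' a b c := by
  have h₁ : J.Avoids a b b b b := by obtain ⟨j, hj, h⟩ := h; exact ⟨j, hj, by grind⟩
  have h₂ : J.Avoids b c c c c := by obtain ⟨j, hj, h⟩ := h; exact ⟨j, hj, by grind⟩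
  obtain rfl | ab := ab.eq_or_lt
  · simp [H.f'_eq bc h₂]
  obtain rfl | bc := bc.eq_or_lt
  · simp [H.f'_eq ab.le h₁]
  · simp [α'_of_lt, ab, bc, H.α_eq ab bc h]

lemma X'_eq {a b c d : P} (ab : a ≤ b) (bc : b ≤ c) (cd : c ≤ d) (h : J.Avoids a b c d d) :
    R'.X' a b c d = R.X' a b c d := by
  have h₁ : J.Avoids a b c c c := by obtain ⟨j, hj, h⟩ := h; exact ⟨j, hj, by grind⟩
  have h₂ : J.Avoids b c d d d := by obtain ⟨j, hj, h⟩ := h; exact ⟨j, hj, by grind⟩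
  have h₃ : J.Avoids a b d d d := by obtain ⟨j, hj, h⟩ := h; exact ⟨j, hj, by grind⟩
  obtain rfl | ab := ab.eq_or_lt
  · simp [H.α'_eq bc cd h₂]
  obtain rfl | bc := bc.eq_or_lt
  · simp [H.α'_eq ab.le cd h₃]
  obtain rfl | cd := cd.eq_or_lt
  · simp [H.α'_eq ab.le bc.le h₁]
  · simp [X'_of_lt, ab, bc, cd, H.X_eq ab bc cd h]

/-- Since `σ` misses an element of `J`, every tuple in its image is avoided by `J`, and there the
two families coincide, degenerate tuples included. -/
lemma agreesAlong {m : ℕ} {σ : Fin (m + 1) →o P} {x : GraySimplexData A (Fin (m + 1))}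
    (hσ : ∃ j ∈ J, ∀ i, σ i ≠ j) (hx : R.AgreesAlong σ x) : R'.AgreesAlong σ x := by
  obtain ⟨j, hj, hσ⟩ := hσ
  refine ⟨fun a => ?_, fun {a b} ab => ?_, fun {a b c} ab bc => ?_, fun {a b c d} ab bc cd => ?_⟩
  · rw [hx.ob_eq, H.ob_eq ⟨j, hj, by simp [(hσ _).symm]⟩]
  · rw [hx.f_eq, H.f'_eq (σ.monotone ab) ⟨j, hj, by simp [(hσ _).symm]⟩]
  · rw [hx.α_eq, H.α'_eq (σ.monotone ab) (σ.monotone bc) ⟨j, hj, by simp [(hσ _).symm]⟩]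
  · rw [hx.X_eq, H.X'_eq (σ.monotone ab) (σ.monotone bc) (σ.monotone cd)
      ⟨j, hj, by simp [(hσ _).symm]⟩]

end AgreesOn

lemma AgreesAlong.eq_reindex {R : RawSimplex A P} (h : R.IsStrict₃) {m : ℕ}
    {σ : Fin (m + 1) →o P} {x : GraySimplexData A (Fin (m + 1))} (hx : R.AgreesAlong σ x) :
    x = (R.toData h).reindex σ := by
  ext
  · simp [hx.ob_eq]
  · simp [hx.f_eq]
  · simp [hx.α_eq]
  · simp [hx.X_eq]

/-- Gray-functors preserve identities, so the values on degenerate tuples follow from those on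
strictly increasing ones. -/
lemma map_toData_eq {B : GrayCat.{u}} {F : GrayFunctor A B} {y : GraySimplexData B P}
    {R : RawSimplex A P} (h : R.IsStrict₃) (h₀ : ∀ i, F.F0 (R.ob i) = y.ob i)
    (h₁ : ∀ {i j} (ij : i < j), F.F1 (R.f i j) = y.f ij.le)
    (h₂ : ∀ {i j k} (ij : i < j) (jk : j < k), F.F2 (R.α i j k) = y.α ij.le jk.le)
    (h₃ : ∀ {i j k l} (ij : i < j) (jk : j < k) (kl : k < l),
      F.F3 (R.X i j k l) = y.X ij.le jk.le kl.le) :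
    (R.toData h).map F = y := by
  have H₁ {i j : P} (ij : i ≤ j) : F.F1 (R.f' i j) = y.f ij := by
    obtain rfl | ij := ij.eq_or_lt
    · simp [y.f_refl, h₀]
    · rw [f'_of_lt _ ij, h₁ ij]
  have H₂ {i j k : P} (ij : i ≤ j) (jk : j ≤ k) : F.F2 (R.α' i j k) = y.α ij jk := by
    obtain rfl | ij := ij.eq_or_lt
    · simp [y.α_refl_left, H₁ jk]
    obtain rfl | jk := jk.eq_or_lt
    · simp [y.α_refl_right, H₁ ij.le]
    · rw [α'_of_lt _ ij jk, h₂ ij jk]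
  have H₃ {i j k l : P} (ij : i ≤ j) (jk : j ≤ k) (kl : k ≤ l) :
      F.F3 (R.X' i j k l) = y.X ij jk kl := by
    obtain rfl | ij := ij.eq_or_lt
    · simp [y.X_refl_left, H₂ jk kl]
    obtain rfl | jk := jk.eq_or_lt
    · simp [y.X_refl_mid, H₂ ij.le kl]
    obtain rfl | kl := kl.eq_or_lt
    · simp [y.X_refl_right, H₂ ij.le jk.le]
    · rw [X'_of_lt _ ij jk kl, h₃ ij jk kl]
  ext
  · exact h₀ _
  · exact H₁ _
  · exact H₂ _ _
  · exact H₃ _ _ _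

end RawSimplex

lemma GraySimplex.ext_data {A : GrayCat.{u}} {P : Type} [Preorder P] {x y : GraySimplex A P}
    (h : x.toGraySimplexData = y.toGraySimplexData) : x = y := by
  obtain ⟨x, hx⟩ := x
  obtain ⟨y, hy⟩ := y
  obtain rfl : x = y := h
  rfl

/-! ### Extension of partial lifts. -/

/-- A lifting problem for a simplex `y` of the target of a Gray-functor, when the liftings of the
faces which are opposite to the elements of `J` are given. -/
structure PartialLift {A B : GrayCat.{u}} (F : GrayFunctor A B) {P : Type} [LinearOrder P]
    (y : GraySimplex B P) (J : Set P) where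
  raw : RawSimplex A P
  simplex {m : ℕ} (σ : Fin (m + 1) →o P) (hσ : ∃ j ∈ J, ∀ i, σ i ≠ j) : GraySimplex A (Fin (m + 1))
  agreesAlong {m : ℕ} (σ : Fin (m + 1) →o P) (hσ : ∃ j ∈ J, ∀ i, σ i ≠ j) :
    raw.AgreesAlong σ (simplex σ hσ).toGraySimplexData
  map_simplex {m : ℕ} (σ : Fin (m + 1) →o P) (hσ : ∃ j ∈ J, ∀ i, σ i ≠ j) :
    (simplex σ hσ).map F = y.reindex σ

namespace PartialLift

open RawSimplex

variable {A B : GrayCat.{u}} {F : GrayFunctor A B} {P : Type} [LinearOrder P]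
  {y : GraySimplex B P} {J : Set P} (L : PartialLift F y J)

/-- The partial lift extends to a simplex. -/
def HasExtension : Prop :=
  ∃ z : GraySimplex A P, z.map F = y ∧
    ∀ {m : ℕ} (σ : Fin (m + 1) →o P) (hσ : ∃ j ∈ J, ∀ i, σ i ≠ j), z.reindex σ = L.simplex σ hσ

section

variable {a b c d e : P} (ab : a < b) (bc : b < c) (cd : c < d) (de : d < e)

section

variable (h : J.Avoids a a a a a)

include h

/-- An avoided tuple defines a monotone map to which a given simplex is attached. Reading off the
cells of this simplex gives all that is known of `L.raw` on the tuple: the boundaries and the image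
by `F`. The three lemmas below do the same in the next dimensions. -/
lemma F0_ob : F.F0 (L.raw.ob a) = y.ob a := by
  have hσ := h.tuple le_rfl le_rfl le_rfl le_rfl
  have e₁ := (L.agreesAlong _ hσ).ob_eq 0
  have e₂ := congr_fun (congrArg (·.ob) (L.map_simplex _ hσ)) 0
  dsimp [OrderHom.tuple, GraySimplex.map, GraySimplex.reindex] at e₁ e₂
  rw [← e₁]
  exact e₂

end

section

variable (h : J.Avoids a b b b b)

include h ab

lemma f_spec : A.s0 (L.raw.f a b) = L.raw.ob a ∧ A.t0 (L.raw.f a b) = L.raw.ob b ∧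
    F.F1 (L.raw.f a b) = y.f ab.le := by
  have hσ := h.tuple ab.le le_rfl le_rfl le_rfl
  have e₁ := (L.agreesAlong _ hσ).f_eq (i := 0) (j := 1) (by decide)
  have e₂ := (L.agreesAlong _ hσ).ob_eq 0
  have e₃ := (L.agreesAlong _ hσ).ob_eq 1
  have e₄ := congrArg (fun x => x.f (i := 0) (j := 1) (by decide)) (L.map_simplex _ hσ)
  dsimp [OrderHom.tuple, GraySimplex.map, GraySimplex.reindex] at e₁ e₂ e₃ e₄
  rw [f'_of_lt _ ab] at e₁
  simp [← e₁, ← e₂, ← e₃]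
  exact e₄

end

section

variable (h : J.Avoids a b c c c)

include h ab bc

lemma α_spec : (∃ h, A.s1 (L.raw.α a b c) = A.comp1 (L.raw.f b c) (L.raw.f a b) h) ∧
    A.t1 (L.raw.α a b c) = L.raw.f a c ∧ F.F2 (L.raw.α a b c) = y.α ab.le bc.le := by
  have hσ := h.tuple ab.le bc.le le_rfl le_rfl
  have e₁ := (L.agreesAlong _ hσ).α_eq (i := 0) (j := 1) (k := 2) (by decide) (by decide)
  have e₂ := (L.agreesAlong _ hσ).f_eq (i := 0) (j := 1) (by decide)
  have e₃ := (L.agreesAlong _ hσ).f_eq (i := 1) (j := 2) (by decide)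
  have e₄ := (L.agreesAlong _ hσ).f_eq (i := 0) (j := 2) (by decide)
  have e₅ := congrArg (fun x => x.α (i := 0) (j := 1) (k := 2) (by decide) (by decide))
    (L.map_simplex _ hσ)
  dsimp [OrderHom.tuple, GraySimplex.map, GraySimplex.reindex] at e₁ e₂ e₃ e₄ e₅
  rw [f'_of_lt _ ab] at e₂
  rw [f'_of_lt _ bc] at e₃
  rw [f'_of_lt _ (ab.trans bc)] at e₄
  rw [α'_of_lt _ ab bc] at e₁
  simp [← e₁, ← e₂, ← e₃, ← e₄]
  exact e₅

end

section

variable (h : J.Avoids a b c d d)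

include h ab bc cd

lemma X_spec : (∃ h h', A.s2 (L.raw.X a b c d) =
      A.comp2 (L.raw.α a c d) (A.wl2 (L.raw.f c d) (L.raw.α a b c) h) h') ∧
    (∃ h h', A.t2 (L.raw.X a b c d) =
      A.comp2 (L.raw.α a b d) (A.wr2 (L.raw.α b c d) (L.raw.f a b) h) h') ∧
    F.F3 (L.raw.X a b c d) = y.X ab.le bc.le cd.le := by
  have hσ := h.tuple ab.le bc.le cd.le le_rfl
  have e₁ := (L.agreesAlong _ hσ).X_eq (i := 0) (j := 1) (k := 2) (l := 3) (by decide) (by decide)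
    (by decide)
  have e₂ := (L.agreesAlong _ hσ).α_eq (i := 0) (j := 1) (k := 2) (by decide) (by decide)
  have e₃ := (L.agreesAlong _ hσ).α_eq (i := 0) (j := 2) (k := 3) (by decide) (by decide)
  have e₄ := (L.agreesAlong _ hσ).α_eq (i := 0) (j := 1) (k := 3) (by decide) (by decide)
  have e₅ := (L.agreesAlong _ hσ).α_eq (i := 1) (j := 2) (k := 3) (by decide) (by decide)
  have e₆ := (L.agreesAlong _ hσ).f_eq (i := 0) (j := 1) (by decide)
  have e₇ := (L.agreesAlong _ hσ).f_eq (i := 2) (j := 3) (by decide)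
  have e₈ := congrArg (fun x => x.X (i := 0) (j := 1) (k := 2) (l := 3) (by decide) (by decide)
    (by decide)) (L.map_simplex _ hσ)
  dsimp [OrderHom.tuple, GraySimplex.map, GraySimplex.reindex] at e₁ e₂ e₃ e₄ e₅ e₆ e₇ e₈
  rw [X'_of_lt _ ab bc cd] at e₁
  rw [α'_of_lt _ ab bc] at e₂
  rw [α'_of_lt _ (ab.trans bc) cd] at e₃
  rw [α'_of_lt _ ab (bc.trans cd)] at e₄
  rw [α'_of_lt _ bc cd] at e₅
  rw [f'_of_lt _ ab] at e₆
  rw [f'_of_lt _ cd] at e₇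
  simp [← e₁, ← e₂, ← e₃, ← e₄, ← e₅, ← e₆, ← e₇]
  exact e₈

end

end

/-- The 5-tuple lies in a face where a full simplex is given. The data built from `R` restrict to
that simplex along the tuple, and a simplex satisfies the pasting equation. -/
lemma pasting_eq (R : RawSimplex A P) (hR : L.raw.AgreesOn R J) (hs : R.IsStrict₃)
    {a b c d e : P} (ab : a ≤ b) (bc : b ≤ c) (cd : c ≤ d) (de : d ≤ e) (h : J.Avoids a b c d e) :
    (R.toData hs).pasting₁ ab bc cd de = (R.toData hs).pasting₂ ab bc cd de := by
  have hσ := h.tuple ab bc cd de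
  have e₁ := (hR.agreesAlong hσ (L.agreesAlong _ hσ)).eq_reindex hs
  have e₂ := (L.simplex _ hσ).pasting_eq (a := 0) (b := 1) (c := 2) (d := 3) (e := 4)
    (by decide) (by decide) (by decide) (by decide)
  rw [e₁] at e₂
  exact e₂

/-- The construction of an extension of a partial lift, from the choice of the missing cells. -/
theorem hasExtension (R : RawSimplex A P) (hR : L.raw.AgreesOn R J)
    (h₀ : ∀ {a}, ¬ J.Avoids a a a a a → F.F0 (R.ob a) = y.ob a)
    (h₁ : ∀ {a b} (ab : a < b), ¬ J.Avoids a b b b b →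
      A.s0 (R.f a b) = R.ob a ∧ A.t0 (R.f a b) = R.ob b ∧ F.F1 (R.f a b) = y.f ab.le)
    (h₂ : ∀ {a b c} (ab : a < b) (bc : b < c), ¬ J.Avoids a b c c c →
      (∃ h, A.s1 (R.α a b c) = A.comp1 (R.f b c) (R.f a b) h) ∧
        A.t1 (R.α a b c) = R.f a c ∧ F.F2 (R.α a b c) = y.α ab.le bc.le)
    (h₃ : ∀ {a b c d} (ab : a < b) (bc : b < c) (cd : c < d), ¬ J.Avoids a b c d d →
      (∃ h h', A.s2 (R.X a b c d) = A.comp2 (R.α a c d) (A.wl2 (R.f c d) (R.α a b c) h) h') ∧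
      (∃ h h', A.t2 (R.X a b c d) = A.comp2 (R.α a b d) (A.wr2 (R.α b c d) (R.f a b) h) h') ∧
      F.F3 (R.X a b c d) = y.X ab.le bc.le cd.le)
    (h₄ : ∀ (hs : R.IsStrict₃) {a b c d e} (ab : a < b) (bc : b < c) (cd : c < d) (de : d < e),
      ¬ J.Avoids a b c d e → (R.toData hs).pasting₁ ab.le bc.le cd.le de.le =
        (R.toData hs).pasting₂ ab.le bc.le cd.le de.le) : L.HasExtension := by
  -- In each dimension the condition is inherited from `L` on the avoided tuples, because the
  -- boundary of an avoided tuple is avoided too, and it is a hypothesis on the other ones.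
  have h₀' {a} : F.F0 (R.ob a) = y.ob a := by
    by_cases h : J.Avoids a a a a a
    · rw [hR.ob_eq h, L.F0_ob h]
    · exact h₀ h
  have h₁' {a b} (ab : a < b) :
      A.s0 (R.f a b) = R.ob a ∧ A.t0 (R.f a b) = R.ob b ∧ F.F1 (R.f a b) = y.f ab.le := by
    by_cases h : J.Avoids a b b b b
    · rw [hR.f_eq ab h, hR.ob_eq (a := a), hR.ob_eq (a := b)]
      · exact L.f_spec ab h
      all_goals obtain ⟨j, hj, h⟩ := h; exact ⟨j, hj, by grind⟩
    · exact h₁ ab h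
  have h₂' {a b c} (ab : a < b) (bc : b < c) :
      (∃ h, A.s1 (R.α a b c) = A.comp1 (R.f b c) (R.f a b) h) ∧
        A.t1 (R.α a b c) = R.f a c ∧ F.F2 (R.α a b c) = y.α ab.le bc.le := by
    by_cases h : J.Avoids a b c c c
    · rw [hR.α_eq ab bc h, hR.f_eq ab, hR.f_eq bc, hR.f_eq (ab.trans bc)]
      · exact L.α_spec ab bc h
      all_goals obtain ⟨j, hj, h⟩ := h; exact ⟨j, hj, by grind⟩
    · exact h₂ ab bc h
  have h₃' {a b c d} (ab : a < b) (bc : b < c) (cd : c < d) :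
      (∃ h h', A.s2 (R.X a b c d) = A.comp2 (R.α a c d) (A.wl2 (R.f c d) (R.α a b c) h) h') ∧
      (∃ h h', A.t2 (R.X a b c d) = A.comp2 (R.α a b d) (A.wr2 (R.α b c d) (R.f a b) h) h') ∧
      F.F3 (R.X a b c d) = y.X ab.le bc.le cd.le := by
    by_cases h : J.Avoids a b c d d
    · rw [hR.X_eq ab bc cd h, hR.f_eq ab, hR.f_eq cd, hR.α_eq ab bc, hR.α_eq bc cd,
        hR.α_eq (ab.trans bc) cd, hR.α_eq ab (bc.trans cd)]
      · exact L.X_spec ab bc cd h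
      all_goals obtain ⟨j, hj, h⟩ := h; exact ⟨j, hj, by grind⟩
    · exact h₃ ab bc cd h
  have hs : R.IsStrict₃ :=
    { s0_f := fun ab => (h₁' ab).1
      t0_f := fun ab => (h₁' ab).2.1
      s1_α := fun ab bc => (h₂' ab bc).1.choose_spec
      t1_α := fun ab bc => (h₂' ab bc).2.1
      s2_X := fun ab bc cd => (h₃' ab bc cd).1.choose_spec.choose_spec
      t2_X := fun ab bc cd => (h₃' ab bc cd).2.1.choose_spec.choose_spec }
  let z : GraySimplex A P := (R.toData hs).toSimplex fun {a b c d e} ab bc cd de => by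
    by_cases h : J.Avoids a b c d e
    · exact L.pasting_eq R hR hs _ _ _ _ h
    · exact h₄ hs ab bc cd de h
  refine ⟨z, ?_, fun σ hσ => ?_⟩
  · exact GraySimplex.ext_data (map_toData_eq hs (fun _ => h₀') (fun ij => (h₁' ij).2.2)
      (fun ij jk => (h₂' ij jk).2.2) (fun ij jk kl => (h₃' ij jk kl).2.2))
  · exact GraySimplex.ext_data ((hR.agreesAlong hσ (L.agreesAlong σ hσ)).eq_reindex hs).symm

end PartialLift

lemma Set.avoids_compl_singleton {P : Type} {k a b c d e : P} :
    ({k}ᶜ : Set P).Avoids a b c d e ↔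
      ∃ j, j ≠ k ∧ j ≠ a ∧ j ≠ b ∧ j ≠ c ∧ j ≠ d ∧ j ≠ e := Iff.rfl

/-! ### Filling of horns. -/

namespace PartialLift

open RawSimplex

variable {A B : GrayCat.{u}} {F : GrayFunctor A B} [A.IsGroupoid] [B.IsGroupoid]

section

variable (hF : F.IsFibration)

include hF

/-- The filling of the horns of dimension 1. -/
lemma hasExtension_horn₁ {y : GraySimplex B (Fin 2)} {k : Fin 2} (L : PartialLift F y {k}ᶜ) :
    L.HasExtension := by
  have hk : k = 0 ∨ k = 1 := by omega
  have hy : (0 : Fin 2) ≤ 1 := by decide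
  obtain ⟨f, hf₀, hf₁, hf⟩ : ∃ f : A.C1, (k = 0 → A.s0 f = L.raw.ob 0) ∧
      (k = 1 → A.t0 f = L.raw.ob 1) ∧ F.F1 f = y.f hy := by
    rcases hk with rfl | rfl
    · obtain ⟨f, h₁, h₂⟩ := hF.exists_lift1_of_s0 (L.raw.ob 0) (y.f hy)
        (by rw [y.s0_f, L.F0_ob ⟨1, by simp, by simp⟩])
      exact ⟨f, by simp [h₁], by simp, h₂⟩
    · obtain ⟨f, h₁, h₂⟩ := hF.exists_lift1_of_t0 (L.raw.ob 1) (y.f hy)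
        (by rw [y.t0_f, L.F0_ob ⟨0, by simp, by simp⟩])
      exact ⟨f, by simp, by simp [h₁], h₂⟩
  refine L.hasExtension
    -- Only vertex `k` is given; the other one is read off the lift `f`. The cells of dimension 2
    -- and 3 are placeholders, as `Fin 2` has no longer strictly increasing tuples.
    { ob i := if i = 0 then A.s0 f else A.t0 f
      f _ _ := f
      α _ _ _ := A.id2 f
      X _ _ _ _ := A.id3 (A.id2 f) } ⟨?_, ?_, ?_, ?_⟩ ?_ ?_ ?_ ?_ ?_
  · rintro a ⟨j, hj : j ≠ k, h⟩
    obtain rfl : a = k := by omega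
    rcases hk with rfl | rfl
    · simp [hf₀]
    · simp [hf₁]
  · rintro a b ab ⟨j, hj : j ≠ k, h⟩
    omega
  · intros; omega
  · intros; omega
  · intro a h
    have : a = 0 ∨ a = 1 := by omega
    rcases this with rfl | rfl
    · simp [← F.s0_F1, hf]
    · simp [← F.t0_F1, hf]
  · intro a b ab h
    obtain ⟨rfl, rfl⟩ : a = 0 ∧ b = 1 := by omega
    simp [hf]
  · intros; omega
  · intros; omega
  · intros; omega

/-- The filling of the horns of dimension 2. -/
lemma hasExtension_horn₂ {y : GraySimplex B (Fin 3)} {k : Fin 3} (L : PartialLift F y {k}ᶜ) :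
    L.HasExtension := by
  have l₀ : (0 : Fin 3) < 1 := by decide
  have l₁ : (1 : Fin 3) < 2 := by decide
  -- What is missing is the edge opposite to `k` and the triangle. The outer horns lack a factor of
  -- the source of the triangle, and the inner horn lacks its target.
  obtain ⟨f, α, hα⟩ : ∃ (f : Fin 3 → Fin 3 → A.C1) (α : A.C2),
      (∀ {i j}, i < j → (k = i ∨ k = j) → f i j = L.raw.f i j) ∧
      (∀ {i j} (ij : i < j), k ≠ i → k ≠ j → A.s0 (f i j) = L.raw.ob i ∧
        A.t0 (f i j) = L.raw.ob j ∧ F.F1 (f i j) = y.f ij.le) ∧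
      (∃ h, A.s1 α = A.comp1 (f 1 2) (f 0 1) h) ∧ A.t1 α = f 0 2 ∧
      F.F2 α = y.α l₀.le l₁.le := by
    have hk : k = 0 ∨ k = 1 ∨ k = 2 := by omega
    rcases hk with rfl | rfl | rfl
    · have h₁ := L.f_spec l₀ ⟨2, by simp, by simp, by simp⟩
      have h₂ := L.f_spec (l₀.trans l₁) ⟨1, by simp, by simp, by simp⟩
      obtain ⟨g, q, α, e₁, e₂, e₃, e₄, e₅⟩ := hF.exists_lift2_left (L.raw.f 0 1) (L.raw.f 0 2)
        (by rw [h₁.1, h₂.1]) (y.f l₁.le) (y.α l₀.le l₁.le) (by simp [h₁]) (by simp [h₁])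
        (by simp [h₂])
      refine ⟨fun i j => if 0 = i ∨ 0 = j then L.raw.f i j else g, α, ?_, ?_, ?_, ?_, ?_⟩
      · intro i j _ h; simp [h]
      · intro i j ij h h'
        obtain ⟨rfl, rfl⟩ : i = 1 ∧ j = 2 := by omega
        simp [*]
      · exact ⟨q, e₂⟩
      · exact e₃
      · exact e₅
    · have h₁ := L.f_spec l₀ ⟨2, by simp, by simp, by simp⟩
      have h₂ := L.f_spec l₁ ⟨0, by simp, by simp, by simp⟩
      -- The composite of the two given edges is a known source, so the missing edge is the target
      -- of the lift.
      obtain ⟨α, e₁, e₂⟩ := hF.exists_lift2_of_s1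
        (A.comp1 (L.raw.f 1 2) (L.raw.f 0 1) (by simp [h₁, h₂])) (y.α l₀.le l₁.le)
        (by simp [h₁, h₂])
      refine ⟨fun i j => if 1 = i ∨ 1 = j then L.raw.f i j else A.t1 α, α, ?_, ?_, ?_, ?_, ?_⟩
      · intro i j _ h; simp [h]
      · intro i j ij h h'
        obtain ⟨rfl, rfl⟩ : i = 0 ∧ j = 2 := by omega
        simp [e₁, h₁, h₂, ← F.t1_F2, e₂]
      · exact ⟨by simp [h₁, h₂], by simp [e₁]⟩
      · simp
      · exact e₂
    · have h₁ := L.f_spec l₁ ⟨0, by simp, by simp, by simp⟩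
      have h₂ := L.f_spec (l₀.trans l₁) ⟨1, by simp, by simp, by simp⟩
      obtain ⟨g, q, α, e₁, e₂, e₃, e₄, e₅⟩ := hF.exists_lift2_right (L.raw.f 1 2) (L.raw.f 0 2)
        (by rw [h₁.2.1, h₂.2.1]) (y.f l₀.le) (y.α l₀.le l₁.le) (by simp [h₁]) (by simp [h₁])
        (by simp [h₂])
      refine ⟨fun i j => if 2 = i ∨ 2 = j then L.raw.f i j else g, α, ?_, ?_, ?_, ?_, ?_⟩
      · intro i j _ h; simp [h]
      · intro i j ij h h'
        obtain ⟨rfl, rfl⟩ : i = 0 ∧ j = 1 := by omega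
        simp [*, ← q]
      · exact ⟨q, e₂⟩
      · exact e₃
      · exact e₅
  obtain ⟨hf, hf', hα₁, hα₂, hα₃⟩ := hα
  refine L.hasExtension
    { ob := L.raw.ob
      f := f
      α _ _ _ := α
      X _ _ _ _ := A.id3 α } ⟨?_, ?_, ?_, ?_⟩ ?_ ?_ ?_ ?_ ?_
  · intros; rfl
  · rintro a b ab ⟨j, hj : j ≠ k, h⟩
    exact hf ab (by omega)
  · rintro a b c ab bc ⟨j, hj : j ≠ k, h⟩
    omega
  · intros; omega
  · intro a h
    simp only [Set.avoids_compl_singleton, not_exists] at h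
    have := h 0
    have := h 1
    have := h 2
    omega
  · intro a b ab h
    simp only [Set.avoids_compl_singleton, not_exists] at h
    have := h 0
    have := h 1
    have := h 2
    exact hf' ab (by omega) (by omega)
  · intro a b c ab bc h
    obtain ⟨rfl, rfl, rfl⟩ : a = 0 ∧ b = 1 ∧ c = 2 := by omega
    exact ⟨hα₁, hα₂, hα₃⟩
  · intros; omega
  · intros; omega

/-- The filling of the horns of dimension 3. -/
lemma hasExtension_horn₃ {y : GraySimplex B (Fin 4)} {k : Fin 4} (L : PartialLift F y {k}ᶜ) :
    L.HasExtension := by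
  have l₀ : (0 : Fin 4) < 1 := by decide
  have l₁ : (1 : Fin 4) < 2 := by decide
  have l₂ : (2 : Fin 4) < 3 := by decide
  obtain ⟨α, X, hX⟩ : ∃ (α : Fin 4 → Fin 4 → Fin 4 → A.C2) (X : A.C3),
      (∀ {a b c}, a < b → b < c → (k = a ∨ k = b ∨ k = c) → α a b c = L.raw.α a b c) ∧
      (∀ {a b c} (ab : a < b) (bc : b < c), k ≠ a → k ≠ b → k ≠ c →
        (∃ h, A.s1 (α a b c) = A.comp1 (L.raw.f b c) (L.raw.f a b) h) ∧
          A.t1 (α a b c) = L.raw.f a c ∧ F.F2 (α a b c) = y.α ab.le bc.le) ∧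
      (∃ h h', A.s2 X = A.comp2 (α 0 2 3) (A.wl2 (L.raw.f 2 3) (α 0 1 2) h) h') ∧
      (∃ h h', A.t2 X = A.comp2 (α 0 1 3) (A.wr2 (α 1 2 3) (L.raw.f 0 1) h) h') ∧
      F.F3 X = y.X l₀.le l₁.le l₂.le := by
    -- All six edges belong to the horn: an edge and `k` together leave out at least one vertex. The
    -- case distinctions exhibit such a vertex.
    have f₀₁ := L.f_spec l₀ (by
      rw [Set.avoids_compl_singleton]
      by_cases h : k = 2
      exacts [⟨3, by omega⟩, ⟨2, by omega⟩])
    have f₁₂ := L.f_spec l₁ (by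
      rw [Set.avoids_compl_singleton]
      by_cases h : k = 0
      exacts [⟨3, by omega⟩, ⟨0, by omega⟩])
    have f₂₃ := L.f_spec l₂ (by
      rw [Set.avoids_compl_singleton]
      by_cases h : k = 0
      exacts [⟨1, by omega⟩, ⟨0, by omega⟩])
    have f₀₂ := L.f_spec (l₀.trans l₁) (by
      rw [Set.avoids_compl_singleton]
      by_cases h : k = 1
      exacts [⟨3, by omega⟩, ⟨1, by omega⟩])
    have f₁₃ := L.f_spec (l₁.trans l₂) (by
      rw [Set.avoids_compl_singleton]
      by_cases h : k = 0
      exacts [⟨2, by omega⟩, ⟨0, by omega⟩])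
    have f₀₃ := L.f_spec ((l₀.trans l₁).trans l₂) (by
      rw [Set.avoids_compl_singleton]
      by_cases h : k = 1
      exacts [⟨2, by omega⟩, ⟨1, by omega⟩])
    have hk : k = 0 ∨ k = 1 ∨ k = 2 ∨ k = 3 := by omega
    -- The lifting lemmas take a known target and a source with one unknown factor. The unknown
    -- triangle lies in the source of the tetrahedron for `k = 1` (023) and `k = 3` (012), and in
    -- its target for `k = 0` (123) and `k = 2` (013); in the latter two cases the inverse of the
    -- tetrahedron is lifted.
    rcases hk with rfl | rfl | rfl | rfl
    · obtain ⟨⟨p₁₂, a₁₂⟩, b₁₂, c₁₂⟩ := L.α_spec l₀ l₁ ⟨3, by simp, by simp⟩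
      obtain ⟨⟨p₁₃, a₁₃⟩, b₁₃, c₁₃⟩ := L.α_spec l₀ (l₁.trans l₂) ⟨2, by simp, by simp⟩
      obtain ⟨⟨p₂₃, a₂₃⟩, b₂₃, c₂₃⟩ := L.α_spec (l₀.trans l₁) l₂ ⟨1, by simp, by simp⟩
      obtain ⟨β, e₁, e₂, M, e₃, e₄, e₅, e₆⟩ := hF.exists_lift3_wr2 (L.raw.α 0 1 3)
        (A.comp2 (L.raw.α 0 2 3) (A.wl2 (L.raw.f 2 3) (L.raw.α 0 1 2) (by simp [*])) (by simp [*]))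
        (L.raw.f 0 1) (A.comp1 (L.raw.f 2 3) (L.raw.f 1 2) (by simp [*])) (L.raw.f 1 3)
        (by simp [*]) (by simp [*]) (by simp [*]) (by simp [*]) (by simp [*])
        (y.α l₁.le l₂.le) (B.inv3 (y.X l₀.le l₁.le l₂.le)) (by simp [*]) (by simp [*])
        (by simp [*]) (by simp [*])
      refine ⟨fun a b c => if 0 = a ∨ 0 = b ∨ 0 = c then L.raw.α a b c else β, A.inv3 M,
        ?_, ?_, ?_, ?_, ?_⟩
      · intro a b c _ _ h; simp [h]
      · intro a b c ab bc _ _ _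
        obtain ⟨rfl, rfl, rfl⟩ : a = 1 ∧ b = 2 ∧ c = 3 := by omega
        exact ⟨⟨_, e₁⟩, e₂, e₅⟩
      · exact ⟨by simp [*], by simp [*], by simp [*]⟩
      · exact ⟨by simp [*], by simp [*], by simp [*]⟩
      · simp [*]
    · obtain ⟨⟨p₁₂, a₁₂⟩, b₁₂, c₁₂⟩ := L.α_spec l₀ l₁ ⟨3, by simp, by simp⟩
      obtain ⟨⟨p₁₃, a₁₃⟩, b₁₃, c₁₃⟩ := L.α_spec l₀ (l₁.trans l₂) ⟨2, by simp, by simp⟩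
      obtain ⟨⟨p₂₃, a₂₃⟩, b₂₃, c₂₃⟩ := L.α_spec l₁ l₂ ⟨0, by simp, by simp⟩
      obtain ⟨β, e₁, M, e₂, e₃, e₄, e₅, e₆⟩ := hF.exists_lift3_comp2
        (A.wl2 (L.raw.f 2 3) (L.raw.α 0 1 2) (by simp [*]))
        (A.comp2 (L.raw.α 0 1 3) (A.wr2 (L.raw.α 1 2 3) (L.raw.f 0 1) (by simp [*])) (by simp [*]))
        (by simp [*])
        (y.α (l₀.trans l₁).le l₂.le) (y.X l₀.le l₁.le l₂.le) (by simp [*]) (by simp [*])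
        (by simp [*])
      refine ⟨fun a b c => if 1 = a ∨ 1 = b ∨ 1 = c then L.raw.α a b c else β, M,
        ?_, ?_, ?_, ?_, ?_⟩
      · intro a b c _ _ h; simp [h]
      · intro a b c ab bc _ _ _
        obtain ⟨rfl, rfl, rfl⟩ : a = 0 ∧ b = 2 ∧ c = 3 := by omega
        exact ⟨⟨by simp [*], by simp [*]⟩, by simp [*], by simp [*]⟩
      · exact ⟨by simp [*], by simp [*], by simp [*]⟩
      · exact ⟨by simp [*], by simp [*], by simp [*]⟩
      · simp [*]
    · obtain ⟨⟨p₁₂, a₁₂⟩, b₁₂, c₁₂⟩ := L.α_spec l₀ l₁ ⟨3, by simp, by simp⟩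
      obtain ⟨⟨p₁₃, a₁₃⟩, b₁₃, c₁₃⟩ := L.α_spec (l₀.trans l₁) l₂ ⟨1, by simp, by simp⟩
      obtain ⟨⟨p₂₃, a₂₃⟩, b₂₃, c₂₃⟩ := L.α_spec l₁ l₂ ⟨0, by simp, by simp⟩
      obtain ⟨β, e₁, M, e₂, e₃, e₄, e₅, e₆⟩ := hF.exists_lift3_comp2
        (A.wr2 (L.raw.α 1 2 3) (L.raw.f 0 1) (by simp [*]))
        (A.comp2 (L.raw.α 0 2 3) (A.wl2 (L.raw.f 2 3) (L.raw.α 0 1 2) (by simp [*])) (by simp [*]))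
        (by simp [*])
        (y.α l₀.le (l₁.trans l₂).le) (B.inv3 (y.X l₀.le l₁.le l₂.le)) (by simp [*]) (by simp [*])
        (by simp [*])
      refine ⟨fun a b c => if 2 = a ∨ 2 = b ∨ 2 = c then L.raw.α a b c else β, A.inv3 M,
        ?_, ?_, ?_, ?_, ?_⟩
      · intro a b c _ _ h; simp [h]
      · intro a b c ab bc _ _ _
        obtain ⟨rfl, rfl, rfl⟩ : a = 0 ∧ b = 1 ∧ c = 3 := by omega
        exact ⟨⟨by simp [*], by simp [*]⟩, by simp [*], by simp [*]⟩
      · exact ⟨by simp [*], by simp [*], by simp [*]⟩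
      · exact ⟨by simp [*], by simp [*], by simp [*]⟩
      · simp [*]
    · obtain ⟨⟨p₁₂, a₁₂⟩, b₁₂, c₁₂⟩ := L.α_spec l₁ l₂ ⟨0, by simp, by simp⟩
      obtain ⟨⟨p₁₃, a₁₃⟩, b₁₃, c₁₃⟩ := L.α_spec l₀ (l₁.trans l₂) ⟨2, by simp, by simp⟩
      obtain ⟨⟨p₂₃, a₂₃⟩, b₂₃, c₂₃⟩ := L.α_spec (l₀.trans l₁) l₂ ⟨1, by simp, by simp⟩
      obtain ⟨β, e₁, e₂, M, e₃, e₄, e₅, e₆⟩ := hF.exists_lift3_wl2 (L.raw.α 0 2 3)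
        (A.comp2 (L.raw.α 0 1 3) (A.wr2 (L.raw.α 1 2 3) (L.raw.f 0 1) (by simp [*])) (by simp [*]))
        (L.raw.f 2 3) (A.comp1 (L.raw.f 1 2) (L.raw.f 0 1) (by simp [*])) (L.raw.f 0 2)
        (by simp [*]) (by simp [*]) (by simp [*]) (by simp [*]) (by simp [*])
        (y.α l₀.le l₁.le) (y.X l₀.le l₁.le l₂.le) (by simp [*]) (by simp [*])
        (by simp [*]) (by simp [*])
      refine ⟨fun a b c => if 3 = a ∨ 3 = b ∨ 3 = c then L.raw.α a b c else β, M,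
        ?_, ?_, ?_, ?_, ?_⟩
      · intro a b c _ _ h; simp [h]
      · intro a b c ab bc _ _ _
        obtain ⟨rfl, rfl, rfl⟩ : a = 0 ∧ b = 1 ∧ c = 2 := by omega
        exact ⟨⟨_, e₁⟩, e₂, e₅⟩
      · exact ⟨by simp [*], by simp [*], by simp [*]⟩
      · exact ⟨by simp [*], by simp [*], by simp [*]⟩
      · simp [*]
  obtain ⟨hα, hα', hX₁, hX₂, hX₃⟩ := hX
  refine L.hasExtension
    { ob := L.raw.ob
      f := L.raw.f
      α := α
      X _ _ _ _ := X } ⟨?_, ?_, ?_, ?_⟩ ?_ ?_ ?_ ?_ ?_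
  · intros; rfl
  · intros; rfl
  · rintro a b c ab bc ⟨j, hj : j ≠ k, h⟩
    exact hα ab bc (by omega)
  · rintro a b c d ab bc cd ⟨j, hj : j ≠ k, h⟩
    omega
  · intro a h
    simp only [Set.avoids_compl_singleton, not_exists] at h
    have := h 0
    have := h 1
    have := h 2
    omega
  · intro a b ab h
    simp only [Set.avoids_compl_singleton, not_exists] at h
    have := h 0
    have := h 1
    have := h 2
    have := h 3
    omega
  · intro a b c ab bc h
    simp only [Set.avoids_compl_singleton, not_exists] at h
    have := h 0
    have := h 1
    have := h 2
    have := h 3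
    exact hα' ab bc (by omega) (by omega) (by omega)
  · intro a b c d ab bc cd h
    obtain ⟨rfl, rfl, rfl, rfl⟩ : a = 0 ∧ b = 1 ∧ c = 2 ∧ d = 3 := by omega
    exact ⟨hX₁, hX₂, hX₃⟩
  · intros; omega

end

end PartialLift

namespace PartialLift

open RawSimplex

variable {A B : GrayCat.{u}} {F : GrayFunctor A B} [A.IsGroupoid] [B.IsGroupoid]

/-- The filling of the horns of dimension 4. -/
lemma hasExtension_horn₄ {y : GraySimplex B (Fin 5)} {k : Fin 5} (L : PartialLift F y {k}ᶜ) :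
    L.HasExtension := by
  -- By counting, all vertices, edges and triangles belong to the horn, as do the tetrahedra that
  -- contain `k`. Only one tetrahedron and the pasting equation are missing.
  have h₀ {a : Fin 5} : ({k}ᶜ : Set (Fin 5)).Avoids a a a a a := by
    rw [Set.avoids_compl_singleton]
    obtain ⟨j, hj⟩ := Finset.exists_mem_notMem_of_card_lt_card (s := {k, a})
      (t := Finset.univ) (Finset.card_le_two.trans_lt (by simp))
    exact ⟨j, by grind⟩
  have h₁ {a b : Fin 5} (h : a < b) : ({k}ᶜ : Set (Fin 5)).Avoids a b b b b := by
    rw [Set.avoids_compl_singleton]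
    obtain ⟨j, hj⟩ := Finset.exists_mem_notMem_of_card_lt_card (s := {k, a, b})
      (t := Finset.univ) (Finset.card_le_three.trans_lt (by simp))
    exact ⟨j, by grind⟩
  have h₂ {a b c : Fin 5} (ab : a < b) (bc : b < c) : ({k}ᶜ : Set (Fin 5)).Avoids a b c c c := by
    rw [Set.avoids_compl_singleton]
    obtain ⟨j, hj⟩ := Finset.exists_mem_notMem_of_card_lt_card (s := {k, a, b, c})
      (t := Finset.univ) (Finset.card_le_four.trans_lt (by simp))
    exact ⟨j, by grind⟩
  have h₃ {a b c d : Fin 5} (hk : k = a ∨ k = b ∨ k = c ∨ k = d) :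
      ({k}ᶜ : Set (Fin 5)).Avoids a b c d d := by
    rw [Set.avoids_compl_singleton]
    obtain ⟨j, hj⟩ := Finset.exists_mem_notMem_of_card_lt_card (s := {a, b, c, d})
      (t := Finset.univ) (Finset.card_le_four.trans_lt (by simp))
    exact ⟨j, by grind⟩
  have hR : L.raw.IsStrict₂ :=
    { s0_f := fun ab => (L.f_spec ab (h₁ ab)).1
      t0_f := fun ab => (L.f_spec ab (h₁ ab)).2.1
      s1_α := fun ab bc => (L.α_spec ab bc (h₂ ab bc)).1.choose_spec
      t1_α := fun ab bc => (L.α_spec ab bc (h₂ ab bc)).2.1 }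
  -- The tetrahedron is found inside `A` alone, from the pasting equation and without lifting
  -- anything.
  obtain ⟨M, hs, hM⟩ := L.raw.exists_replaceX hR k fun ab bc cd h =>
    ⟨(L.X_spec ab bc cd (h₃ h)).1.choose_spec.choose_spec,
      (L.X_spec ab bc cd (h₃ h)).2.1.choose_spec.choose_spec⟩
  refine L.hasExtension (L.raw.replaceX k M) ⟨?_, ?_, ?_, ?_⟩ ?_ ?_ ?_ ?_ ?_
  · intros; rfl
  · intros; rfl
  · intros; rfl
  · rintro a b c d ab bc cd ⟨j, hj : j ≠ k, h⟩
    exact if_pos (by omega)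
  · intro a h
    exact (h h₀).elim
  · intro a b ab h
    exact (h (h₁ ab)).elim
  · intro a b c ab bc h
    exact (h (h₂ ab bc)).elim
  · intro a b c d ab bc cd h
    refine ⟨⟨_, _, hs.s2_X ab bc cd⟩, ⟨_, _, hs.t2_X ab bc cd⟩, ?_⟩
    have H₁ {i j : Fin 5} (ij : i ≤ j) : F.F1 ((L.raw.replaceX k M).f' i j) = y.f ij := by
      obtain rfl | ij := ij.eq_or_lt
      · simp [y.f_refl, L.F0_ob h₀]
      · rw [f'_of_lt _ ij]
        exact (L.f_spec ij (h₁ ij)).2.2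
    have H₂ {i j l : Fin 5} (ij : i ≤ j) (jl : j ≤ l) :
        F.F2 ((L.raw.replaceX k M).α' i j l) = y.α ij jl := by
      obtain rfl | ij := ij.eq_or_lt
      · simp [y.α_refl_left, H₁ jl]
      obtain rfl | jl := jl.eq_or_lt
      · simp [y.α_refl_right, H₁ ij.le]
      · rw [α'_of_lt _ ij jl]
        exact (L.α_spec ij jl (h₂ ij jl)).2.2
    -- The image of the new tetrahedron and the one of `y` solve the same pasting equation in `B`
    -- with the same four other tetrahedra, so they are equal.
    have := GraySimplexData.X_eq_of_horn (((L.raw.replaceX k M).toData hs).map F)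
      y.toGraySimplexData (funext fun i => L.F0_ob h₀) H₁ H₂ k
      (fun ab bc cd h => by
        simpa [X'_of_lt, ab, bc, cd, h] using (L.X_spec ab bc cd (h₃ h)).2.2)
      (fun ab bc cd de => by
        rw [GraySimplexData.map_pasting₁, GraySimplexData.map_pasting₂, hM ab bc cd de])
      (fun _ _ _ _ => y.pasting_eq _ _ _ _) ab bc cd
    simpa [X'_of_lt, ab, bc, cd] using this
  · intro _ a b c d e ab bc cd de h
    exact hM ab bc cd de

/-- The filling of the horns of dimension 5. -/
lemma hasExtension_horn₅ {A B : GrayGpd.{u}} {F : GrayFunctor A.obj B.obj}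
    {y : GraySimplex B.obj (Fin 6)} {k : Fin 6} (L : PartialLift F y {k}ᶜ) :
    L.HasExtension := by
  have h₃ {a b c d : Fin 6} : ({k}ᶜ : Set (Fin 6)).Avoids a b c d d := by
    rw [Set.avoids_compl_singleton]
    obtain ⟨j, hj⟩ := Finset.exists_mem_notMem_of_card_lt_card (s := {k, a, b, c, d})
      (t := Finset.univ) (Finset.card_le_five.trans_lt (by simp))
    exact ⟨j, by grind⟩
  have h₂ {a b c : Fin 6} : ({k}ᶜ : Set (Fin 6)).Avoids a b c c c := h₃
  have h₁ {a b : Fin 6} : ({k}ᶜ : Set (Fin 6)).Avoids a b b b b := h₃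
  have h₀ {a : Fin 6} : ({k}ᶜ : Set (Fin 6)).Avoids a a a a a := h₃
  have hR : L.raw.AgreesOn L.raw {k}ᶜ := ⟨by simp, by simp, by simp, by simp⟩
  refine L.hasExtension L.raw hR (fun h => (h h₀).elim) (fun _ h => (h h₁).elim)
    (fun _ _ h => (h h₂).elim) (fun _ _ _ h => (h h₃).elim) ?_
  intro hs a b c d e ab bc cd de _
  -- All cells are given; the equation missing on the face opposite to `k` follows from those on the
  -- five faces that contain `k`, and these five belong to the horn.
  refine GraySimplexData.pasting_of_horn _ k (fun ab bc cd de h => ?_) ab bc cd de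
  refine L.pasting_eq L.raw hR hs _ _ _ _ ?_
  rename_i a b c d e
  obtain ⟨j, hj⟩ := Finset.exists_mem_notMem_of_card_lt_card (s := {a, b, c, d, e})
    (t := Finset.univ) (Finset.card_le_five.trans_lt (by simp))
  exact ⟨j, by grind⟩

/-- Simplices of which all faces of dimension 4 are given. -/
lemma hasExtension_of_avoids {P : Type} [LinearOrder P] {y : GraySimplex B P} {J : Set P}
    (L : PartialLift F y J) (hJ : ∀ a b c d e, J.Avoids a b c d e) : L.HasExtension :=
  L.hasExtension L.raw ⟨by simp, by simp, by simp, by simp⟩ (fun h => (h (hJ _ _ _ _ _)).elim)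
    (fun _ h => (h (hJ _ _ _ _ _)).elim) (fun _ _ h => (h (hJ _ _ _ _ _)).elim)
    (fun _ _ _ h => (h (hJ _ _ _ _ _)).elim) (fun _ _ _ _ _ _ _ _ _ _ h => (h (hJ _ _ _ _ _)).elim)

lemma hasExtension_horn {A B : GrayGpd.{u}} {F : GrayFunctor A.obj B.obj} (hF : F.IsFibration)
    {n : ℕ} {y : GraySimplex B.obj (Fin (n + 2))} {k : Fin (n + 2)} (L : PartialLift F y {k}ᶜ) :
    L.HasExtension := by
  match n with
  | 0 => exact hasExtension_horn₁ hF L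
  | 1 => exact hasExtension_horn₂ hF L
  | 2 => exact hasExtension_horn₃ hF L
  | 3 => exact hasExtension_horn₄ L
  | 4 => exact hasExtension_horn₅ L
  | n + 5 =>
    refine L.hasExtension_of_avoids fun a b c d e => ?_
    obtain ⟨j, hj⟩ := Finset.exists_mem_notMem_of_card_lt_card (s := {k, a, b, c, d, e})
      (t := Finset.univ) (Finset.card_le_six.trans_lt (by simp))
    exact ⟨j, by grind⟩

end PartialLift

/-! ### Filling of boundaries. -/

namespace GrayFunctor.IsWeakEquivalence

variable {A B : GrayCat.{u}} {F : GrayFunctor A B} (hW : F.IsWeakEquivalence) (hF : F.IsFibration)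

include hW hF

/-- Essential surjectivity gives a 1-cell from `Y` to an object of the image. The source of a lift
of this 1-cell is sent exactly to `Y`. In the two lemmas below, similarly, the lift up to
equivalence or isomorphism is corrected by lifting the comparison cell. -/
lemma exists_lift0 [A.IsGroupoid] [B.IsGroupoid] (Y : B.C0) : ∃ X, F.F0 X = Y := by
  obtain ⟨X, g, -, rfl, h⟩ := hW.essSurj0 Y
  obtain ⟨f, -, rfl⟩ := hF.exists_lift1_of_t0 X g h
  exact ⟨A.s0 f, by simp⟩

lemma exists_lift1 (X X' : A.C0) (g : B.C1) (h : B.s0 g = F.F0 X) (h' : B.t0 g = F.F0 X') :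
    ∃ f, A.s0 f = X ∧ A.t0 f = X' ∧ F.F1 f = g := by
  obtain ⟨f, rfl, rfl, β, hβ, rfl, h₂⟩ := hW.essSurj1 X X' g h h'
  obtain ⟨α, -, rfl, rfl⟩ := hF.lift_equiv f β hβ h₂
  exact ⟨A.s1 α, by simp, by simp, by simp⟩

lemma exists_lift2 (f f' : A.C1) (h : A.s0 f = A.s0 f') (h' : A.t0 f = A.t0 f') (β : B.C2)
    (hs : B.s1 β = F.F1 f) (ht : B.t1 β = F.F1 f') :
    ∃ α, A.s1 α = f ∧ A.t1 α = f' ∧ F.F2 α = β := by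
  obtain ⟨α, rfl, rfl, N, hN, rfl, h₂⟩ := hW.essSurj2 f f' h h' β hs ht
  obtain ⟨M, -, rfl, rfl⟩ := hF.lift_iso α N hN h₂
  exact ⟨A.s2 M, by simp, by simp, by simp⟩

end GrayFunctor.IsWeakEquivalence

namespace PartialLift

open RawSimplex

lemma avoids_univ_of_card_lt {n : ℕ} {a b c d e : Fin n}
    (h : ({a, b, c, d, e} : Finset (Fin n)).card < n) :
    (Set.univ : Set (Fin n)).Avoids a b c d e := by
  obtain ⟨j, hj⟩ := Finset.exists_mem_notMem_of_card_lt_card (s := {a, b, c, d, e})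
    (t := Finset.univ) (by simpa using h)
  exact ⟨j, trivial, by grind⟩

variable {A B : GrayCat.{u}} {F : GrayFunctor A B}
  (hW : F.IsWeakEquivalence) (hF : F.IsFibration)

include hW

lemma hasExtension_boundary₀ (hF : F.IsFibration) [A.IsGroupoid] [B.IsGroupoid]
    {y : GraySimplex B (Fin 1)} (L : PartialLift F y Set.univ) : L.HasExtension := by
  obtain ⟨X, hX⟩ := hW.exists_lift0 hF (y.ob 0)
  refine L.hasExtension
    { ob _ := X
      f _ _ := A.id1 X
      α _ _ _ := A.id2 (A.id1 X)
      X _ _ _ _ := A.id3 (A.id2 (A.id1 X)) } ⟨?_, ?_, ?_, ?_⟩ ?_ ?_ ?_ ?_ ?_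
  · rintro a ⟨j, -, h⟩
    omega
  · intros; omega
  · intros; omega
  · intros; omega
  · intro a h
    obtain rfl : a = 0 := by omega
    exact hX
  · intros; omega
  · intros; omega
  · intros; omega
  · intros; omega

lemma hasExtension_boundary₁ (hF : F.IsFibration)
    {y : GraySimplex B (Fin 2)} (L : PartialLift F y Set.univ) : L.HasExtension := by
  have l₀ : (0 : Fin 2) < 1 := by decide
  have h₀ (a : Fin 2) : (Set.univ : Set (Fin 2)).Avoids a a a a a :=
    avoids_univ_of_card_lt (by simp)
  obtain ⟨f, h₁, h₂, h₃⟩ := hW.exists_lift1 hF (L.raw.ob 0) (L.raw.ob 1) (y.f l₀.le)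
    (by rw [y.s0_f, L.F0_ob (h₀ 0)]) (by rw [y.t0_f, L.F0_ob (h₀ 1)])
  refine L.hasExtension
    { ob := L.raw.ob
      f _ _ := f
      α _ _ _ := A.id2 f
      X _ _ _ _ := A.id3 (A.id2 f) } ⟨?_, ?_, ?_, ?_⟩ ?_ ?_ ?_ ?_ ?_
  · intros; rfl
  · rintro a b ab ⟨j, -, h⟩
    omega
  · intros; omega
  · intros; omega
  · intro a h
    exact (h (h₀ a)).elim
  · intro a b ab h
    obtain ⟨rfl, rfl⟩ : a = 0 ∧ b = 1 := by omega
    exact ⟨h₁, h₂, h₃⟩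
  · intros; omega
  · intros; omega
  · intros; omega

lemma hasExtension_boundary₂ (hF : F.IsFibration)
    {y : GraySimplex B (Fin 3)} (L : PartialLift F y Set.univ) : L.HasExtension := by
  have l₀ : (0 : Fin 3) < 1 := by decide
  have l₁ : (1 : Fin 3) < 2 := by decide
  have h₁ (a b : Fin 3) : (Set.univ : Set (Fin 3)).Avoids a b b b b :=
    avoids_univ_of_card_lt (by simpa using Finset.card_le_two.trans_lt (by simp))
  have f₀₁ := L.f_spec l₀ (h₁ _ _)
  have f₁₂ := L.f_spec l₁ (h₁ _ _)
  have f₀₂ := L.f_spec (l₀.trans l₁) (h₁ _ _)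
  obtain ⟨α, e₁, e₂, e₃⟩ := hW.exists_lift2 hF
    (A.comp1 (L.raw.f 1 2) (L.raw.f 0 1) (by simp [*])) (L.raw.f 0 2) (by simp [*]) (by simp [*])
    (y.α l₀.le l₁.le) (by simp [*]) (by simp [*])
  refine L.hasExtension
    { ob := L.raw.ob
      f := L.raw.f
      α _ _ _ := α
      X _ _ _ _ := A.id3 α } ⟨?_, ?_, ?_, ?_⟩ ?_ ?_ ?_ ?_ ?_
  · intros; rfl
  · intros; rfl
  · rintro a b c ab bc ⟨j, -, h⟩
    omega
  · intros; omega
  · intro a h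
    exact (h (h₁ a a)).elim
  · intro a b ab h
    exact (h (h₁ a b)).elim
  · intro a b c ab bc h
    obtain ⟨rfl, rfl, rfl⟩ : a = 0 ∧ b = 1 ∧ c = 2 := by omega
    exact ⟨⟨_, e₁⟩, e₂, e₃⟩
  · intros; omega
  · intros; omega

/-- Only the tetrahedron is missing, and its source and target are given 2-cells of `A`: fullness on
3-cells provides it, with no use of fibrancy. -/
lemma hasExtension_boundary₃
    {y : GraySimplex B (Fin 4)} (L : PartialLift F y Set.univ) : L.HasExtension := by
  have l₀ : (0 : Fin 4) < 1 := by decide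
  have l₁ : (1 : Fin 4) < 2 := by decide
  have l₂ : (2 : Fin 4) < 3 := by decide
  have h₂ (a b c : Fin 4) : (Set.univ : Set (Fin 4)).Avoids a b c c c :=
    avoids_univ_of_card_lt (by simpa using Finset.card_le_three.trans_lt (by simp))
  have f₀₁ := L.f_spec l₀ (h₂ _ _ _)
  have f₁₂ := L.f_spec l₁ (h₂ _ _ _)
  have f₂₃ := L.f_spec l₂ (h₂ _ _ _)
  have f₀₂ := L.f_spec (l₀.trans l₁) (h₂ _ _ _)
  have f₁₃ := L.f_spec (l₁.trans l₂) (h₂ _ _ _)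
  have f₀₃ := L.f_spec (l₀.trans (l₁.trans l₂)) (h₂ _ _ _)
  obtain ⟨⟨p₁, a₁⟩, b₁, c₁⟩ := L.α_spec l₀ l₁ (h₂ _ _ _)
  obtain ⟨⟨p₂, a₂⟩, b₂, c₂⟩ := L.α_spec l₁ l₂ (h₂ _ _ _)
  obtain ⟨⟨p₃, a₃⟩, b₃, c₃⟩ := L.α_spec l₀ (l₁.trans l₂) (h₂ _ _ _)
  obtain ⟨⟨p₄, a₄⟩, b₄, c₄⟩ := L.α_spec (l₀.trans l₁) l₂ (h₂ _ _ _)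
  obtain ⟨M, ⟨e₁, e₂, e₃⟩, -⟩ := hW.fullyFaithful
    (A.comp2 (L.raw.α 0 2 3) (A.wl2 (L.raw.f 2 3) (L.raw.α 0 1 2) (by simp [*])) (by simp [*]))
    (A.comp2 (L.raw.α 0 1 3) (A.wr2 (L.raw.α 1 2 3) (L.raw.f 0 1) (by simp [*])) (by simp [*]))
    (by simp [*]) (by simp [*]) (y.X l₀.le l₁.le l₂.le) (by simp [*]) (by simp [*])
  refine L.hasExtension
    { ob := L.raw.ob
      f := L.raw.f
      α := L.raw.α
      X _ _ _ _ := M } ⟨?_, ?_, ?_, ?_⟩ ?_ ?_ ?_ ?_ ?_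
  · intros; rfl
  · intros; rfl
  · intros; rfl
  · rintro a b c d ab bc cd ⟨j, -, h⟩
    omega
  · intro a h
    exact (h (h₂ a a a)).elim
  · intro a b ab h
    exact (h (h₂ a b b)).elim
  · intro a b c ab bc h
    exact (h (h₂ a b c)).elim
  · intro a b c d ab bc cd h
    obtain ⟨rfl, rfl, rfl, rfl⟩ : a = 0 ∧ b = 1 ∧ c = 2 ∧ d = 3 := by omega
    exact ⟨⟨_, _, e₁⟩, ⟨_, _, e₂⟩, e₃⟩
  · intros; omega

lemma hasExtension_boundary₄
    {y : GraySimplex B (Fin 5)} (L : PartialLift F y Set.univ) : L.HasExtension := by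
  have h₃ (a b c d : Fin 5) : (Set.univ : Set (Fin 5)).Avoids a b c d d :=
    avoids_univ_of_card_lt (by simpa using Finset.card_le_four.trans_lt (by simp))
  refine L.hasExtension L.raw ⟨by simp, by simp, by simp, by simp⟩ (fun h => (h (h₃ _ _ _ _)).elim)
    (fun _ h => (h (h₃ _ _ _ _)).elim) (fun _ _ h => (h (h₃ _ _ _ _)).elim)
    (fun _ _ _ h => (h (h₃ _ _ _ _)).elim) ?_
  intro hs a b c d e ab bc cd de _
  have hy : (L.raw.toData hs).map F = y.toGraySimplexData :=
    map_toData_eq hs (fun _ => L.F0_ob (h₃ _ _ _ _)) (fun ab => (L.f_spec ab (h₃ _ _ _ _)).2.2)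
      (fun ab bc => (L.α_spec ab bc (h₃ _ _ _ _)).2.2)
      (fun ab bc cd => (L.X_spec ab bc cd (h₃ _ _ _ _)).2.2)
  generalize L.raw.toData hs = x at hy ⊢
  -- All cells are given and only the pasting equation is missing. The two composites are parallel
  -- and have the same image, because `y` satisfies the equation; faithfulness on 3-cells concludes.
  refine (hW.fullyFaithful (A.s2 (x.pasting₂ ab.le bc.le cd.le de.le))
    (A.t2 (x.pasting₂ ab.le bc.le cd.le de.le)) (by rw [A.s1_t2]) (by rw [A.t1_t2])
    (F.F3 (x.pasting₂ ab.le bc.le cd.le de.le)) (by simp) (by simp)).unique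
    ⟨x.s2_pasting _ _ _ _, x.t2_pasting _ _ _ _, ?_⟩ ⟨rfl, rfl, rfl⟩
  rw [← GraySimplexData.map_pasting₁, ← GraySimplexData.map_pasting₂, hy, y.pasting_eq]

lemma hasExtension_boundary (hF : F.IsFibration) [A.IsGroupoid] [B.IsGroupoid] {n : ℕ}
    {y : GraySimplex B (Fin (n + 1))} (L : PartialLift F y Set.univ) : L.HasExtension := by
  match n with
  | 0 => exact hasExtension_boundary₀ hW hF L
  | 1 => exact hasExtension_boundary₁ hW hF L
  | 2 => exact hasExtension_boundary₂ hW hF L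
  | 3 => exact hasExtension_boundary₃ hW L
  | 4 => exact hasExtension_boundary₄ hW L
  | n + 5 =>
    exact L.hasExtension_of_avoids fun a b c d e =>
      avoids_univ_of_card_lt (Finset.card_le_five.trans_lt (by simp))

end PartialLift

/-! ### Maps from a subcomplex of a standard simplex to a nerve. -/

lemma OrderHom.comp_tuple {P Q : Type} [Preorder P] [Preorder Q] (σ : Q →o P) {a b c d e : Q}
    (ab : a ≤ b) (bc : b ≤ c) (cd : c ≤ d) (de : d ≤ e) :
    σ.comp (tuple ab bc cd de) =
      tuple (σ.monotone ab) (σ.monotone bc) (σ.monotone cd) (σ.monotone de) := by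
  ext i
  fin_cases i <;> rfl

/-- A compatible family of simplices, which are indexed by the monotone maps avoiding an element
of `J`. -/
structure CompatibleSimplices (A : GrayCat.{u}) {P : Type} [LinearOrder P] (J : Set P) where
  simplex {m : ℕ} (σ : Fin (m + 1) →o P) (hσ : ∃ j ∈ J, ∀ i, σ i ≠ j) : GraySimplex A (Fin (m + 1))
  reindex_simplex {m m' : ℕ} (σ : Fin (m + 1) →o P) (hσ : ∃ j ∈ J, ∀ i, σ i ≠ j)
    (τ : Fin (m' + 1) →o Fin (m + 1)) (hτ : ∃ j ∈ J, ∀ i, σ.comp τ i ≠ j) :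
    (simplex σ hσ).reindex τ = simplex (σ.comp τ) hτ

namespace CompatibleSimplices

variable {A : GrayCat.{u}} {P : Type} [LinearOrder P] {J : Set P} (S : CompatibleSimplices A J)

lemma reindex_tuple {m : ℕ} {σ : Fin (m + 1) →o P} (hσ : ∃ j ∈ J, ∀ i, σ i ≠ j)
    {a b c d e : Fin (m + 1)} (ab : a ≤ b) (bc : b ≤ c) (cd : c ≤ d) (de : d ≤ e)
    {a' b' c' d' e' : P} (ab' : a' ≤ b') (bc' : b' ≤ c') (cd' : c' ≤ d') (de' : d' ≤ e')
    (h' : ∃ j ∈ J, ∀ i, OrderHom.tuple ab' bc' cd' de' i ≠ j)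
    (ha : σ a = a') (hb : σ b = b') (hc : σ c = c') (hd : σ d = d') (he : σ e = e') :
    (S.simplex σ hσ).reindex (OrderHom.tuple ab bc cd de) =
      S.simplex (OrderHom.tuple ab' bc' cd' de') h' := by
  subst ha hb hc hd he
  obtain ⟨j, hj, h⟩ := id hσ
  rw [S.reindex_simplex _ _ _ ⟨j, hj, fun i => h _⟩]
  congr 1
  exact σ.comp_tuple ab bc cd de

/-- Both sides are the simplex attached to the same composite with `σ`. When `σ` identifies two
consecutive vertices, a tuple can thus be replaced by a degenerate one, on which the cells are known
to be identities. -/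
lemma reindex_tuple_eq {m : ℕ} {σ : Fin (m + 1) →o P} (hσ : ∃ j ∈ J, ∀ i, σ i ≠ j)
    {a b c d e : Fin (m + 1)} (ab : a ≤ b) (bc : b ≤ c) (cd : c ≤ d) (de : d ≤ e)
    {a' b' c' d' e' : Fin (m + 1)} (ab' : a' ≤ b') (bc' : b' ≤ c') (cd' : c' ≤ d') (de' : d' ≤ e')
    (ha : σ a = σ a') (hb : σ b = σ b') (hc : σ c = σ c') (hd : σ d = σ d') (he : σ e = σ e') :
    (S.simplex σ hσ).reindex (OrderHom.tuple ab bc cd de) =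
      (S.simplex σ hσ).reindex (OrderHom.tuple ab' bc' cd' de') := by
  obtain ⟨j, hj, h⟩ := id hσ
  rw [S.reindex_tuple hσ ab bc cd de (σ.monotone ab') (σ.monotone bc') (σ.monotone cd')
    (σ.monotone de') (by rw [← OrderHom.comp_tuple σ ab' bc' cd' de']; exact ⟨j, hj, fun i => h _⟩) ha hb hc hd he,
    S.reindex_tuple hσ ab' bc' cd' de' (σ.monotone ab') (σ.monotone bc') (σ.monotone cd')
    (σ.monotone de') _ rfl rfl rfl rfl rfl]

variable [Nonempty A.C0]

open Classical in
/-- The family of cells which corresponds to a compatible family of simplices. -/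
noncomputable def raw : RawSimplex A P where
  ob a := if h : J.Avoids a a a a a then
    (S.simplex _ (h.tuple le_rfl le_rfl le_rfl le_rfl)).ob 0 else Classical.arbitrary _
  f a b := if h : a ≤ b ∧ J.Avoids a b b b b then
    (S.simplex _ (h.2.tuple h.1 le_rfl le_rfl le_rfl)).f (i := 0) (j := 1) (by decide) else
    A.id1 (Classical.arbitrary _)
  α a b c := if h : a ≤ b ∧ b ≤ c ∧ J.Avoids a b c c c then
    (S.simplex _ (h.2.2.tuple h.1 h.2.1 le_rfl le_rfl)).α (i := 0) (j := 1) (k := 2)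
      (by decide) (by decide) else A.id2 (A.id1 (Classical.arbitrary _))
  X a b c d := if h : a ≤ b ∧ b ≤ c ∧ c ≤ d ∧ J.Avoids a b c d d then
    (S.simplex _ (h.2.2.2.tuple h.1 h.2.1 h.2.2.1 le_rfl)).X (i := 0) (j := 1) (k := 2) (l := 3)
      (by decide) (by decide) (by decide) else A.id3 (A.id2 (A.id1 (Classical.arbitrary _)))

/-- A cell of `simplex σ` on a tuple is the corresponding cell of the simplex attached to the image
tuple. If the image is strictly increasing, this is the definition of `raw`; otherwise
`reindex_tuple_eq` makes the tuple itself degenerate, and both sides are identities on a shorter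
tuple. -/
lemma agreesAlong_raw {m : ℕ} (σ : Fin (m + 1) →o P) (hσ : ∃ j ∈ J, ∀ i, σ i ≠ j) :
    S.raw.AgreesAlong σ (S.simplex σ hσ).toGraySimplexData := by
  have hav (a b c d e) : J.Avoids (σ a) (σ b) (σ c) (σ d) (σ e) := by
    obtain ⟨j, hj, h⟩ := hσ
    exact ⟨j, hj, by simp [(h _).symm]⟩
  have H₀ (i) : (S.simplex σ hσ).ob i = S.raw.ob (σ i) := by
    have := congrArg (fun x => x.ob 0) (S.reindex_tuple hσ (le_refl i) le_rfl le_rfl le_rfl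
      le_rfl le_rfl le_rfl le_rfl ((hav i i i i i).tuple _ _ _ _) rfl rfl rfl rfl rfl)
    refine this.trans ?_
    simp only [raw]
    rw [dif_pos (hav _ _ _ _ _)]
  have H₁ {i j} (ij : i ≤ j) : (S.simplex σ hσ).f ij = S.raw.f' (σ i) (σ j) := by
    by_cases h : σ i = σ j
    · have := congrArg (fun x => x.f (i := 0) (j := 1) (by decide)) (S.reindex_tuple_eq hσ
        ij le_rfl le_rfl le_rfl (le_refl i) le_rfl le_rfl le_rfl rfl h.symm h.symm h.symm h.symm)
      refine this.trans (((S.simplex σ hσ).f_refl i).trans ?_)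
      rw [← h, RawSimplex.f'_refl, H₀]
    · have l := lt_of_le_of_ne (σ.monotone ij) h
      have := congrArg (fun x => x.f (i := 0) (j := 1) (by decide)) (S.reindex_tuple hσ
        ij le_rfl le_rfl le_rfl l.le le_rfl le_rfl le_rfl ((hav i j j j j).tuple _ _ _ _)
        rfl rfl rfl rfl rfl)
      refine this.trans ?_
      rw [RawSimplex.f'_of_lt _ l]
      simp only [raw]
      rw [dif_pos ⟨l.le, hav _ _ _ _ _⟩]
  have H₂ {i j k} (ij : i ≤ j) (jk : j ≤ k) :
      (S.simplex σ hσ).α ij jk = S.raw.α' (σ i) (σ j) (σ k) := by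
    by_cases h : σ i = σ j
    · have := congrArg (fun x => x.α (i := 0) (j := 1) (k := 2) (by decide) (by decide))
        (S.reindex_tuple_eq hσ ij jk le_rfl le_rfl (le_refl i) (ij.trans jk) le_rfl le_rfl
          rfl h.symm rfl rfl rfl)
      refine this.trans (((S.simplex σ hσ).α_refl_left (ij.trans jk)).trans ?_)
      rw [← h, RawSimplex.α'_refl_left, H₁]
    by_cases h' : σ j = σ k
    · have := congrArg (fun x => x.α (i := 0) (j := 1) (k := 2) (by decide) (by decide))
        (S.reindex_tuple_eq hσ ij jk le_rfl le_rfl ij (le_refl j) le_rfl le_rfl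
          rfl rfl h'.symm h'.symm h'.symm)
      refine this.trans (((S.simplex σ hσ).α_refl_right ij).trans ?_)
      rw [← h', RawSimplex.α'_refl_right, H₁]
    · have l := lt_of_le_of_ne (σ.monotone ij) h
      have l' := lt_of_le_of_ne (σ.monotone jk) h'
      have := congrArg (fun x => x.α (i := 0) (j := 1) (k := 2) (by decide) (by decide))
        (S.reindex_tuple hσ ij jk le_rfl le_rfl l.le l'.le le_rfl le_rfl
          ((hav i j k k k).tuple _ _ _ _) rfl rfl rfl rfl rfl)
      refine this.trans ?_
      rw [RawSimplex.α'_of_lt _ l l']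
      simp only [raw]
      rw [dif_pos ⟨l.le, l'.le, hav _ _ _ _ _⟩]
  refine ⟨H₀, H₁, H₂, fun {i j k l} ij jk kl => ?_⟩
  by_cases h : σ i = σ j
  · have := congrArg (fun x => x.X (i := 0) (j := 1) (k := 2) (l := 3) (by decide) (by decide)
      (by decide)) (S.reindex_tuple_eq hσ ij jk kl le_rfl (le_refl i) (ij.trans jk) kl le_rfl
        rfl h.symm rfl rfl rfl)
    refine this.trans (((S.simplex σ hσ).X_refl_left (ij.trans jk) kl).trans ?_)
    rw [← h, RawSimplex.X'_refl_left, H₂]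
  by_cases h' : σ j = σ k
  · have := congrArg (fun x => x.X (i := 0) (j := 1) (k := 2) (l := 3) (by decide) (by decide)
      (by decide)) (S.reindex_tuple_eq hσ ij jk kl le_rfl ij (le_refl j) (jk.trans kl) le_rfl
        rfl rfl h'.symm rfl rfl)
    refine this.trans (((S.simplex σ hσ).X_refl_mid ij (jk.trans kl)).trans ?_)
    rw [← h', RawSimplex.X'_refl_mid, H₂]
  by_cases h'' : σ k = σ l
  · have := congrArg (fun x => x.X (i := 0) (j := 1) (k := 2) (l := 3) (by decide) (by decide)
      (by decide)) (S.reindex_tuple_eq hσ ij jk kl le_rfl ij jk (le_refl k) le_rfl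
        rfl rfl rfl h''.symm h''.symm)
    refine this.trans (((S.simplex σ hσ).X_refl_right ij jk).trans ?_)
    rw [← h'', RawSimplex.X'_refl_right, H₂]
  · have l₁ := lt_of_le_of_ne (σ.monotone ij) h
    have l₂ := lt_of_le_of_ne (σ.monotone jk) h'
    have l₃ := lt_of_le_of_ne (σ.monotone kl) h''
    have := congrArg (fun x => x.X (i := 0) (j := 1) (k := 2) (l := 3) (by decide) (by decide)
      (by decide)) (S.reindex_tuple hσ ij jk kl le_rfl l₁.le l₂.le l₃.le le_rfl
        ((hav i j k l l).tuple _ _ _ _) rfl rfl rfl rfl rfl)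
    refine this.trans ?_
    rw [RawSimplex.X'_of_lt _ l₁ l₂ l₃]
    simp only [raw]
    rw [dif_pos ⟨l₁.le, l₂.le, l₃.le, hav _ _ _ _ _⟩]

/-- A partial lift given by a compatible family of simplices. -/
noncomputable def partialLift {B : GrayCat.{u}} {F : GrayFunctor A B} {y : GraySimplex B P}
    (h : ∀ {m : ℕ} (σ : Fin (m + 1) →o P) (hσ : ∃ j ∈ J, ∀ i, σ i ≠ j),
      (S.simplex σ hσ).map F = y.reindex σ) : PartialLift F y J where
  raw := S.raw
  simplex := S.simplex
  agreesAlong := S.agreesAlong_raw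
  map_simplex := h

end CompatibleSimplices

/-! ### Lifting against horn and boundary inclusions. -/

namespace SSet

variable {A B : GrayCat.{u}} (F : GrayFunctor A B) {n : ℕ} (S : Subcomplex.{u} Δ[n])
  (J : Set (Fin (n + 1)))
  (hS : ∀ {d : ℕ} (s : (Δ[n] : SSet.{u}) _⦋d⦌), s ∈ S.obj (op ⦋d⦌) ↔ ∃ j ∈ J, ∀ i, s i ≠ j)

/-- The simplices given by a map from a subcomplex of the standard simplex to a nerve. -/
def compatibleSimplices (φ : (S : SSet.{u}) ⟶ grayCatNerve.obj A) : CompatibleSimplices A J where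
  simplex {m} σ hσ := φ.app (op ⦋m⦌) ⟨stdSimplex.objMk σ, (hS _).2 hσ⟩
  reindex_simplex σ hσ τ _ :=
    (NatTrans.naturality_apply φ (Quiver.Hom.op (V := SimplexCategory) (SimplexCategory.Hom.mk τ))
      (⟨stdSimplex.objMk σ, (hS _).2 hσ⟩ : (S : SSet.{u}).obj (op (.mk _)))).symm

include hS in
lemma hasLiftingProperty_of_hasExtension (h₀ : Nonempty A.C0)
    (H : ∀ (y : GraySimplex B (Fin (n + 1))) (L : PartialLift F y J), L.HasExtension) :
    HasLiftingProperty S.ι (grayCatNerve.map (X := A) (Y := B) F) where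
  sq_hasLift {φ ψ} sq := by
    have := h₀
    have h {m : ℕ} (σ : Fin (m + 1) →o Fin (n + 1)) (hσ : ∃ j ∈ J, ∀ i, σ i ≠ j) :
        ((compatibleSimplices S J hS φ).simplex σ hσ).map F =
          GraySimplex.reindex (P := Fin (n + 1)) (yonedaEquiv ψ) σ := by
      have h₁ := ConcreteCategory.congr_hom (NatTrans.congr_app sq.w (op ⦋m⦌))
        (⟨stdSimplex.objMk σ, (hS _).2 hσ⟩ : (S : SSet.{u}).obj (op ⦋m⦌))
      have h₂ := ConcreteCategory.congr_hom (NatTrans.congr_app (yonedaEquiv.symm_apply_apply ψ)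
        (op ⦋m⦌)) (stdSimplex.objMk σ)
      exact h₁.trans h₂.symm
    obtain ⟨z, hz, hz'⟩ := H _ ((compatibleSimplices S J hS φ).partialLift h)
    refine ⟨⟨⟨yonedaEquiv.symm z, ?_, ?_⟩⟩⟩
    · ext ⟨⟨m⟩⟩ ⟨s, hs⟩
      exact hz' (stdSimplex.asOrderHom s) ((hS s).1 hs)
    · exact (yonedaEquiv_symm_comp _ _).trans (yonedaEquiv.symm_apply_eq.2 hz)

lemma hasLiftingProperty_horn {A B : GrayGpd.{u}} (F : A ⟶ B) (hF : fibrations GrayGpd.{u} F)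
    (n : ℕ) (i : Fin (n + 2)) : HasLiftingProperty Λ[n + 1, i].ι (grayNerve.map F) where
  sq_hasLift {φ ψ} sq := by
    have hS {d : ℕ} (s : (Δ[n + 1] : SSet.{u}) _⦋d⦌) :
        s ∈ Λ[n + 1, i].obj (op ⦋d⦌) ↔ ∃ j ∈ ({i}ᶜ : Set (Fin (n + 2))), ∀ i, s i ≠ j := by
      simp [mem_horn_iff_notMem_range]
    -- The vertex `i` always belongs to the horn, hence its image is an object of `A`.
    have hA : Nonempty A.obj.C0 :=
      ⟨((compatibleSimplices (A := A.obj) _ _ hS φ).simplex (m := 0) (OrderHom.const _ i)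
        (by
          obtain ⟨j, hj⟩ := exists_ne i
          exact ⟨j, hj, by simp [hj.symm]⟩)).ob 0⟩
    have := hasLiftingProperty_of_hasExtension F.hom Λ[n + 1, i] _ hS hA
      fun y L => L.hasExtension_horn hF
    exact this.sq_hasLift sq

lemma hasLiftingProperty_boundary {A B : GrayGpd.{u}} (F : A ⟶ B)
    (hF : trivialFibrations GrayGpd.{u} F) (n : ℕ) :
    HasLiftingProperty ∂Δ[n].ι (grayNerve.map F) where
  sq_hasLift {φ ψ} sq := by
    have hS {d : ℕ} (s : (Δ[n] : SSet.{u}) _⦋d⦌) :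
        s ∈ ∂Δ[n].obj (op ⦋d⦌) ↔ ∃ j ∈ (Set.univ : Set (Fin (n + 1))), ∀ i, s i ≠ j := by
      simp [mem_boundary_iff_notMem_range]
    -- For `n = 0` the boundary is empty and provides no object; essential surjectivity, applied to
    -- a vertex of the simplex in the target, provides one.
    have hA : Nonempty A.obj.C0 := by
      let y : GraySimplex B.obj (Fin (n + 1)) := yonedaEquiv ψ
      obtain ⟨X, -⟩ := hF.2.essSurj0 (y.ob 0)
      exact ⟨X⟩
    have := hasLiftingProperty_of_hasExtension F.hom ∂Δ[n] _ hS hA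
      fun y L => L.hasExtension_boundary hF.2 hF.1
    exact this.sq_hasLift sq

end SSet

/-! ### Lifting against boundaries implies weak equivalence. -/

namespace SSet

open MonoidalCategory CartesianMonoidalCategory modelCategoryQuillen

variable {X Y : SSet.{u}}

/-- A monotone map to {0 < 1} that is not surjective is constant. This is why testing the first
vertex suffices in `boundaryDesc`, and why that definition is natural. -/
lemma stdSimplex.eq_of_mem_boundary_one {d : ℕ} {t : (Δ[1] : SSet.{u}) _⦋d⦌}
    (ht : t ∈ ∂Δ[1].obj (op ⦋d⦌)) (i j : Fin (d + 1)) : t i = t j := by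
  rw [mem_boundary_iff_notMem_range] at ht
  obtain ⟨k, hk⟩ := ht
  have h₁ : t i ≠ k := fun h => hk ⟨i, h⟩
  have h₂ : t j ≠ k := fun h => hk ⟨j, h⟩
  omega

open Classical in
/-- The map on `X ⊗ ∂Δ[1]` which is given by two maps on `X`. -/
noncomputable def boundaryDesc (f g : X ⟶ Y) :
    (((⊤ : X.Subcomplex).prod ∂Δ[1] : (X ⊗ Δ[1]).Subcomplex) : SSet.{u}) ⟶ Y where
  app n := ↾fun x => if (stdSimplex.objEquiv x.1.2).toOrderHom 0 = 0 then f.app n x.1.1 else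
    g.app n x.1.1
  naturality := by
    rintro ⟨⟨n⟩⟩ ⟨⟨m⟩⟩ τ
    ext ⟨⟨x, t⟩, hx, ht⟩
    have h : (stdSimplex.objEquiv ((Δ[1] : SSet.{u}).map τ t)).toOrderHom 0 =
      (stdSimplex.objEquiv t).toOrderHom 0 := stdSimplex.eq_of_mem_boundary_one ht _ _
    change (if _ then _ else _) = Y.map τ (if _ then _ else _)
    erw [h]
    split_ifs
    · exact NatTrans.naturality_apply f τ x
    · exact NatTrans.naturality_apply g τ x

lemma boundaryDesc_app_of_eq (f g : X ⟶ Y) {n : SimplexCategoryᵒᵖ}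
    (x : (((⊤ : X.Subcomplex).prod ∂Δ[1] : (X ⊗ Δ[1]).Subcomplex) : SSet.{u}).obj n)
    (h : (stdSimplex.objEquiv x.1.2).toOrderHom 0 = 0) :
    (boundaryDesc f g).app n x = f.app n x.1.1 := by
  change (if _ then _ else _) = _
  exact if_pos h

lemma boundaryDesc_app_of_ne (f g : X ⟶ Y) {n : SimplexCategoryᵒᵖ}
    (x : (((⊤ : X.Subcomplex).prod ∂Δ[1] : (X ⊗ Δ[1]).Subcomplex) : SSet.{u}).obj n)
    (h : (stdSimplex.objEquiv x.1.2).toOrderHom 0 ≠ 0) :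
    (boundaryDesc f g).app n x = g.app n x.1.1 := by
  change (if _ then _ else _) = _
  exact if_neg h

/-- The map given by `g` and `h` on the two ends of the cylinder `X ⊗ Δ[1]` lies above the constant
homotopy at `g ≫ f`. Lifting against the inclusion of the ends, which is a monomorphism, extends it
to the cylinder. -/
lemma exists_homotopy (f : X ⟶ Y) (hf : I.rlp f) (g h : X ⟶ X) (e : g ≫ f = h ≫ f) :
    Nonempty (Homotopy g h) := by
  rw [← rlp_monomorphisms] at hf
  have := hf ((⊤ : X.Subcomplex).prod ∂Δ[1] : (X ⊗ Δ[1]).Subcomplex).ι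
    (MorphismProperty.monomorphisms.infer_property _)
  have sq : CommSq (boundaryDesc g h) ((⊤ : X.Subcomplex).prod ∂Δ[1] : (X ⊗ Δ[1]).Subcomplex).ι f
    (fst _ _ ≫ g ≫ f) := ⟨by
      ext n ⟨⟨x, t⟩, hx, ht⟩
      change f.app n (if _ then _ else _) = f.app n (g.app n x)
      split_ifs
      · rfl
      · exact (ConcreteCategory.congr_hom (NatTrans.congr_app e n) x).symm⟩
  refine ⟨{ h := sq.lift, h₀ := ?_, h₁ := ?_, rel := ?_}⟩
  · ext ⟨⟨n⟩⟩ x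
    have hx : ((ι₀ : X ⟶ _).app (op ⦋n⦌) x).2 ∈ ∂Δ[1].obj (op ⦋n⦌) := by
      rw [mem_boundary_iff_notMem_range]
      exact ⟨1, by rintro ⟨i, hi⟩; exact absurd hi (by simp)⟩
    exact (ConcreteCategory.congr_hom (NatTrans.congr_app sq.fac_left (op ⦋n⦌))
      ⟨ι₀.app (op ⦋n⦌) x, trivial, hx⟩).trans
        (boundaryDesc_app_of_eq g h _ rfl)
  · ext ⟨⟨n⟩⟩ x
    have hx : ((ι₁ : X ⟶ _).app (op ⦋n⦌) x).2 ∈ ∂Δ[1].obj (op ⦋n⦌) := by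
      rw [mem_boundary_iff_notMem_range]
      exact ⟨0, by rintro ⟨i, hi⟩; exact absurd hi (by simp)⟩
    exact (ConcreteCategory.congr_hom (NatTrans.congr_app sq.fac_left (op ⦋n⦌))
      ⟨ι₁.app (op ⦋n⦌) x, trivial, hx⟩).trans
        (boundaryDesc_app_of_ne g h _ one_ne_zero)
  · ext n ⟨⟨x, hx⟩, _⟩
    exact hx.elim

/-- Lifting the identity of `Y` against the empty subcomplex gives a section `s` of `f`. Since `f ≫
s` and the identity of `X` agree after `f`, they are homotopic. Composing this homotopy with a map
to `K` gives surjectivity on homotopy classes, and precomposing homotopies with `s` gives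
injectivity. -/
lemma isSimplicialWeakEquivalence_of_rlp {f : X ⟶ Y} (hf : I.rlp f) :
    IsSimplicialWeakEquivalence f := by
  obtain ⟨s, hs⟩ : ∃ s, s ≫ f = 𝟙 Y := by
    have h : (MorphismProperty.monomorphisms SSet.{u}).rlp f := by rwa [rlp_monomorphisms]
    have := h (⊥ : Y.Subcomplex).ι (MorphismProperty.monomorphisms.infer_property _)
    have sq : CommSq ((Subcomplex.isInitialBot (X := Y)).to X) (⊥ : Y.Subcomplex).ι f (𝟙 Y) :=
      ⟨Subcomplex.isInitialBot.hom_ext _ _⟩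
    exact ⟨sq.lift, sq.fac_right⟩
  obtain ⟨H⟩ := exists_homotopy f hf (f ≫ s) (𝟙 X) (by simp [hs])
  refine fun K _ => ⟨fun g => ⟨s ≫ g, ⟨{ h := H.h ≫ g, h₀ := ?_, h₁ := ?_, rel := ?_ }⟩⟩,
    fun h h' ⟨H'⟩ => ⟨{ h := s ▷ _ ≫ H'.h, h₀ := ?_, h₁ := ?_, rel := ?_ }⟩⟩
  · rw [H.h₀_assoc]; rfl
  · rw [H.h₁_assoc]; rfl
  · ext n ⟨⟨x, hx⟩, _⟩
    exact hx.elim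
  · rw [ι₀_comp_assoc, H'.h₀, reassoc_of% hs]; rfl
  · rw [ι₁_comp_assoc, H'.h₁, reassoc_of% hs]; rfl
  · ext n ⟨⟨x, hx⟩, _⟩
    exact hx.elim

end SSet

/-! ### Small sub-Gray-groupoids of large products. -/

/-- A small sub-Gray-groupoid of a (large) product of Gray-groupoids. -/
structure SmallSubGroupoid {ι : Type w} (A : ι → GrayCat.{u}) [∀ k, (A k).IsGroupoid] where
  S0 : Set (∀ k, (A k).C0)
  S1 : Set (∀ k, (A k).C1)
  S2 : Set (∀ k, (A k).C2)
  S3 : Set (∀ k, (A k).C3)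
  small0 : Small.{u} S0
  small1 : Small.{u} S1
  small2 : Small.{u} S2
  small3 : Small.{u} S3
  s0_mem : ∀ f ∈ S1, (fun k => (A k).s0 (f k)) ∈ S0
  t0_mem : ∀ f ∈ S1, (fun k => (A k).t0 (f k)) ∈ S0
  s1_mem : ∀ α ∈ S2, (fun k => (A k).s1 (α k)) ∈ S1
  t1_mem : ∀ α ∈ S2, (fun k => (A k).t1 (α k)) ∈ S1
  s2_mem : ∀ M ∈ S3, (fun k => (A k).s2 (M k)) ∈ S2
  t2_mem : ∀ M ∈ S3, (fun k => (A k).t2 (M k)) ∈ S2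
  id1_mem : ∀ X ∈ S0, (fun k => (A k).id1 (X k)) ∈ S1
  id2_mem : ∀ f ∈ S1, (fun k => (A k).id2 (f k)) ∈ S2
  id3_mem : ∀ α ∈ S2, (fun k => (A k).id3 (α k)) ∈ S3
  inv1_mem : ∀ f ∈ S1, (fun k => (A k).inv1 (f k)) ∈ S1
  inv2_mem : ∀ α ∈ S2, (fun k => (A k).inv2 (α k)) ∈ S2
  inv3_mem : ∀ M ∈ S3, (fun k => (A k).inv3 (M k)) ∈ S3
  comp1_mem : ∀ g ∈ S1, ∀ f ∈ S1, ∀ (h : ∀ k, (A k).s0 (g k) = (A k).t0 (f k)),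
    (fun k => (A k).comp1 (g k) (f k) (h k)) ∈ S1
  comp2_mem : ∀ β ∈ S2, ∀ α ∈ S2, ∀ (h : ∀ k, (A k).s1 (β k) = (A k).t1 (α k)),
    (fun k => (A k).comp2 (β k) (α k) (h k)) ∈ S2
  comp3_mem : ∀ N ∈ S3, ∀ M ∈ S3, ∀ (h : ∀ k, (A k).s2 (N k) = (A k).t2 (M k)),
    (fun k => (A k).comp3 (N k) (M k) (h k)) ∈ S3
  hcomp3_mem : ∀ N ∈ S3, ∀ M ∈ S3, ∀ (h : ∀ k, (A k).s1 ((A k).s2 (N k)) = (A k).t1 ((A k).s2 (M k))),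
    (fun k => (A k).hcomp3 (N k) (M k) (h k)) ∈ S3
  wl2_mem : ∀ g ∈ S1, ∀ α ∈ S2, ∀ (h : ∀ k, (A k).s0 (g k) = (A k).t0 ((A k).s1 (α k))),
    (fun k => (A k).wl2 (g k) (α k) (h k)) ∈ S2
  wr2_mem : ∀ β ∈ S2, ∀ f ∈ S1, ∀ (h : ∀ k, (A k).s0 ((A k).s1 (β k)) = (A k).t0 (f k)),
    (fun k => (A k).wr2 (β k) (f k) (h k)) ∈ S2
  wl3_mem : ∀ g ∈ S1, ∀ M ∈ S3, ∀ (h : ∀ k, (A k).s0 (g k) = (A k).t0 ((A k).s1 ((A k).s2 (M k)))),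
    (fun k => (A k).wl3 (g k) (M k) (h k)) ∈ S3
  wr3_mem : ∀ N ∈ S3, ∀ f ∈ S1, ∀ (h : ∀ k, (A k).s0 ((A k).s1 ((A k).s2 (N k))) = (A k).t0 (f k)),
    (fun k => (A k).wr3 (N k) (f k) (h k)) ∈ S3
  ich_mem : ∀ β ∈ S2, ∀ α ∈ S2, ∀ (h : ∀ k, (A k).s0 ((A k).s1 (β k)) = (A k).t0 ((A k).s1 (α k))),
    (fun k => (A k).ich (β k) (α k) (h k)) ∈ S3

/-- An element of the small type which is equivalent to a small set. -/
noncomputable def Set.toShrink {α : Type*} {S : Set α} [Small.{u} S] (a : α) (h : a ∈ S) :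
    Shrink.{u} S := equivShrink S ⟨a, h⟩

/-- The element of a small set given by an element of the equivalent small type. -/
noncomputable def Set.ofShrink {α : Type*} {S : Set α} [Small.{u} S] (a : Shrink.{u} S) : α :=
  ((equivShrink S).symm a).1

@[simp] lemma Set.ofShrink_toShrink {α : Type*} {S : Set α} [Small.{u} S] (a : α) (h : a ∈ S) :
    ofShrink (toShrink a h) = a := by simp [ofShrink, toShrink]

lemma Set.ofShrink_mem {α : Type*} {S : Set α} [Small.{u} S] (a : Shrink.{u} S) :
    ofShrink a ∈ S := ((equivShrink S).symm a).2

lemma Set.ofShrink_injective {α : Type*} (S : Set α) [Small.{u} S] :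
    Function.Injective (ofShrink (S := S)) :=
  Subtype.val_injective.comp (equivShrink S).symm.injective

namespace SmallSubGroupoid

variable {ι : Type w} {A : ι → GrayCat.{u}} [∀ k, (A k).IsGroupoid] (S : SmallSubGroupoid A)

attribute [instance] small0 small1 small2 small3

open Set

/-- The cells of the Gray-groupoid. -/
noncomputable def cells : GrayCells.{u} where
  C0 := Shrink.{u} S.S0
  C1 := Shrink.{u} S.S1
  C2 := Shrink.{u} S.S2
  C3 := Shrink.{u} S.S3
  s0 f := toShrink _ (S.s0_mem _ (ofShrink_mem f))
  t0 f := toShrink _ (S.t0_mem _ (ofShrink_mem f))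
  s1 f := toShrink _ (S.s1_mem _ (ofShrink_mem f))
  t1 f := toShrink _ (S.t1_mem _ (ofShrink_mem f))
  s2 f := toShrink _ (S.s2_mem _ (ofShrink_mem f))
  t2 f := toShrink _ (S.t2_mem _ (ofShrink_mem f))
  s0_t1 _ := by simp
  t0_t1 _ := by simp
  s1_t2 _ := by simp
  t1_t2 _ := by simp

/-- The components of the cells. -/
noncomputable def val0 (X : S.cells.C0) : ∀ k, (A k).C0 := ofShrink (S := S.S0) X
noncomputable def val1 (f : S.cells.C1) : ∀ k, (A k).C1 := ofShrink (S := S.S1) f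
noncomputable def val2 (α : S.cells.C2) : ∀ k, (A k).C2 := ofShrink (S := S.S2) α
noncomputable def val3 (M : S.cells.C3) : ∀ k, (A k).C3 := ofShrink (S := S.S3) M

/-- The cells which are determined by their components. -/
noncomputable def mk0 (X : ∀ k, (A k).C0) (h : X ∈ S.S0) : S.cells.C0 := toShrink X h
noncomputable def mk1 (f : ∀ k, (A k).C1) (h : f ∈ S.S1) : S.cells.C1 := toShrink f h
noncomputable def mk2 (α : ∀ k, (A k).C2) (h : α ∈ S.S2) : S.cells.C2 := toShrink α h
noncomputable def mk3 (M : ∀ k, (A k).C3) (h : M ∈ S.S3) : S.cells.C3 := toShrink M h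

@[simp] lemma val0_mk0 (X h) : S.val0 (S.mk0 X h) = X := ofShrink_toShrink X h
@[simp] lemma val1_mk1 (f h) : S.val1 (S.mk1 f h) = f := ofShrink_toShrink f h
@[simp] lemma val2_mk2 (α h) : S.val2 (S.mk2 α h) = α := ofShrink_toShrink α h
@[simp] lemma val3_mk3 (M h) : S.val3 (S.mk3 M h) = M := ofShrink_toShrink M h

lemma val0_mem (X) : S.val0 X ∈ S.S0 := ofShrink_mem (S := S.S0) X
lemma val1_mem (f) : S.val1 f ∈ S.S1 := ofShrink_mem (S := S.S1) f
lemma val2_mem (α) : S.val2 α ∈ S.S2 := ofShrink_mem (S := S.S2) α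
lemma val3_mem (M) : S.val3 M ∈ S.S3 := ofShrink_mem (S := S.S3) M

variable {S}

lemma ext0 {X Y : S.cells.C0} (h : ∀ k, S.val0 X k = S.val0 Y k) : X = Y :=
  ofShrink_injective S.S0 (funext h)
lemma ext1 {f g : S.cells.C1} (h : ∀ k, S.val1 f k = S.val1 g k) : f = g :=
  ofShrink_injective S.S1 (funext h)
lemma ext2 {α β : S.cells.C2} (h : ∀ k, S.val2 α k = S.val2 β k) : α = β :=
  ofShrink_injective S.S2 (funext h)
lemma ext3 {M N : S.cells.C3} (h : ∀ k, S.val3 M k = S.val3 N k) : M = N :=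
  ofShrink_injective S.S3 (funext h)

variable (S)

@[simp] lemma val0_s0 (f k) : S.val0 (S.cells.s0 f) k = (A k).s0 (S.val1 f k) :=
  congr_fun (ofShrink_toShrink _ _) k
@[simp] lemma val0_t0 (f k) : S.val0 (S.cells.t0 f) k = (A k).t0 (S.val1 f k) :=
  congr_fun (ofShrink_toShrink _ _) k
@[simp] lemma val1_s1 (α k) : S.val1 (S.cells.s1 α) k = (A k).s1 (S.val2 α k) :=
  congr_fun (ofShrink_toShrink _ _) k
@[simp] lemma val1_t1 (α k) : S.val1 (S.cells.t1 α) k = (A k).t1 (S.val2 α k) :=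
  congr_fun (ofShrink_toShrink _ _) k
@[simp] lemma val2_s2 (M k) : S.val2 (S.cells.s2 M) k = (A k).s2 (S.val3 M k) :=
  congr_fun (ofShrink_toShrink _ _) k
@[simp] lemma val2_t2 (M k) : S.val2 (S.cells.t2 M) k = (A k).t2 (S.val3 M k) :=
  congr_fun (ofShrink_toShrink _ _) k

lemma cells0_eq_iff {X Y : S.cells.C0} : X = Y ↔ ∀ k, S.val0 X k = S.val0 Y k :=
  ⟨by rintro rfl _; rfl, ext0⟩
lemma cells1_eq_iff {f g : S.cells.C1} : f = g ↔ ∀ k, S.val1 f k = S.val1 g k :=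
  ⟨by rintro rfl _; rfl, ext1⟩
lemma cells2_eq_iff {α β : S.cells.C2} : α = β ↔ ∀ k, S.val2 α k = S.val2 β k :=
  ⟨by rintro rfl _; rfl, ext2⟩

/-- The operations of the Gray-groupoid. -/
noncomputable def ops : GrayOps.{u} where
  toGrayCells := S.cells
  id1 X := S.mk1 _ (S.id1_mem _ (S.val0_mem X))
  s0_id1 _ := ext0 fun _ => by simp
  t0_id1 _ := ext0 fun _ => by simp
  comp1 g f h := S.mk1 _ (S.comp1_mem _ (S.val1_mem g) _ (S.val1_mem f)
    (by simpa [cells0_eq_iff] using h))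
  s0_comp1 _ _ _ := ext0 fun _ => by simp
  t0_comp1 _ _ _ := ext0 fun _ => by simp
  id2 f := S.mk2 _ (S.id2_mem _ (S.val1_mem f))
  s1_id2 _ := ext1 fun _ => by simp
  t1_id2 _ := ext1 fun _ => by simp
  comp2 β α h := S.mk2 _ (S.comp2_mem _ (S.val2_mem β) _ (S.val2_mem α)
    (by simpa [cells1_eq_iff] using h))
  s1_comp2 _ _ _ := ext1 fun _ => by simp
  t1_comp2 _ _ _ := ext1 fun _ => by simp
  id3 α := S.mk3 _ (S.id3_mem _ (S.val2_mem α))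
  s2_id3 _ := ext2 fun _ => by simp
  t2_id3 _ := ext2 fun _ => by simp
  comp3 N M h := S.mk3 _ (S.comp3_mem _ (S.val3_mem N) _ (S.val3_mem M)
    (by simpa [cells2_eq_iff] using h))
  s2_comp3 _ _ _ := ext2 fun _ => by simp
  t2_comp3 _ _ _ := ext2 fun _ => by simp
  hcomp3 N M h := S.mk3 _ (S.hcomp3_mem _ (S.val3_mem N) _ (S.val3_mem M)
    (by simpa [cells1_eq_iff] using h))
  s2_hcomp3 _ _ _ := ext2 fun _ => by simp
  t2_hcomp3 _ _ _ := ext2 fun _ => by simp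
  wl2 g α h := S.mk2 _ (S.wl2_mem _ (S.val1_mem g) _ (S.val2_mem α)
    (by simpa [cells0_eq_iff] using h))
  s1_wl2 _ _ _ := ext1 fun _ => by simp
  t1_wl2 _ _ _ := ext1 fun _ => by simp
  wr2 β f h := S.mk2 _ (S.wr2_mem _ (S.val2_mem β) _ (S.val1_mem f)
    (by simpa [cells0_eq_iff] using h))
  s1_wr2 _ _ _ := ext1 fun _ => by simp
  t1_wr2 _ _ _ := ext1 fun _ => by simp
  wl3 g M h := S.mk3 _ (S.wl3_mem _ (S.val1_mem g) _ (S.val3_mem M)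
    (by simpa [cells0_eq_iff] using h))
  s2_wl3 _ _ _ := ext2 fun _ => by simp
  t2_wl3 _ _ _ := ext2 fun _ => by simp
  wr3 N f h := S.mk3 _ (S.wr3_mem _ (S.val3_mem N) _ (S.val1_mem f)
    (by simpa [cells0_eq_iff] using h))
  s2_wr3 _ _ _ := ext2 fun _ => by simp
  t2_wr3 _ _ _ := ext2 fun _ => by simp
  ich β α h := S.mk3 _ (S.ich_mem _ (S.val2_mem β) _ (S.val2_mem α)
    (by simpa [cells0_eq_iff] using h))
  s2_ich _ _ _ := ext2 fun _ => by simp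
  t2_ich _ _ _ := ext2 fun _ => by simp

end SmallSubGroupoid

namespace SmallSubGroupoid

variable {ι : Type w} {A : ι → GrayCat.{u}} [∀ k, (A k).IsGroupoid] (S : SmallSubGroupoid A)

@[simp] lemma val0_s0_ops (f : S.ops.C1) (k) :
    S.val0 (S.ops.s0 f) k = (A k).s0 (S.val1 f k) := S.val0_s0 f k
@[simp] lemma val0_t0_ops (f : S.ops.C1) (k) :
    S.val0 (S.ops.t0 f) k = (A k).t0 (S.val1 f k) := S.val0_t0 f k
@[simp] lemma val1_s1_ops (α : S.ops.C2) (k) :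
    S.val1 (S.ops.s1 α) k = (A k).s1 (S.val2 α k) := S.val1_s1 α k
@[simp] lemma val1_t1_ops (α : S.ops.C2) (k) :
    S.val1 (S.ops.t1 α) k = (A k).t1 (S.val2 α k) := S.val1_t1 α k
@[simp] lemma val2_s2_ops (M : S.ops.C3) (k) :
    S.val2 (S.ops.s2 M) k = (A k).s2 (S.val3 M k) := S.val2_s2 M k
@[simp] lemma val2_t2_ops (M : S.ops.C3) (k) :
    S.val2 (S.ops.t2 M) k = (A k).t2 (S.val3 M k) := S.val2_t2 M k

variable {S}

lemma components0 {X Y : S.ops.C0} (h : X = Y) (k) : S.val0 X k = S.val0 Y k := by rw [h]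
lemma components1 {f g : S.ops.C1} (h : f = g) (k) : S.val1 f k = S.val1 g k := by rw [h]
lemma components2 {α β : S.ops.C2} (h : α = β) (k) : S.val2 α k = S.val2 β k := by rw [h]

variable (S)

@[simp] lemma val1_id1 (X) (k) :
    S.val1 (S.ops.id1 X) k = (A k).id1 (S.val0 X k) :=
  congr_fun (S.val1_mk1 _ _) k

@[simp] lemma val2_id2 (f) (k) :
    S.val2 (S.ops.id2 f) k = (A k).id2 (S.val1 f k) :=
  congr_fun (S.val2_mk2 _ _) k

@[simp] lemma val3_id3 (α) (k) :
    S.val3 (S.ops.id3 α) k = (A k).id3 (S.val2 α k) :=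
  congr_fun (S.val3_mk3 _ _) k

@[simp] lemma val1_comp1 (g f h) (k) :
    S.val1 (S.ops.comp1 g f h) k =
      (A k).comp1 (S.val1 g k) (S.val1 f k) (by simpa using components0 h k) :=
  congr_fun (S.val1_mk1 _ _) k

@[simp] lemma val2_comp2 (β α h) (k) :
    S.val2 (S.ops.comp2 β α h) k =
      (A k).comp2 (S.val2 β k) (S.val2 α k) (by simpa using components1 h k) :=
  congr_fun (S.val2_mk2 _ _) k

@[simp] lemma val3_comp3 (N M h) (k) :
    S.val3 (S.ops.comp3 N M h) k =
      (A k).comp3 (S.val3 N k) (S.val3 M k) (by simpa using components2 h k) :=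
  congr_fun (S.val3_mk3 _ _) k

@[simp] lemma val3_hcomp3 (N M h) (k) :
    S.val3 (S.ops.hcomp3 N M h) k =
      (A k).hcomp3 (S.val3 N k) (S.val3 M k) (by simpa using components1 h k) :=
  congr_fun (S.val3_mk3 _ _) k

@[simp] lemma val2_wl2 (g α h) (k) :
    S.val2 (S.ops.wl2 g α h) k =
      (A k).wl2 (S.val1 g k) (S.val2 α k) (by simpa using components0 h k) :=
  congr_fun (S.val2_mk2 _ _) k

@[simp] lemma val2_wr2 (β f h) (k) :
    S.val2 (S.ops.wr2 β f h) k =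
      (A k).wr2 (S.val2 β k) (S.val1 f k) (by simpa using components0 h k) :=
  congr_fun (S.val2_mk2 _ _) k

@[simp] lemma val3_wl3 (g M h) (k) :
    S.val3 (S.ops.wl3 g M h) k =
      (A k).wl3 (S.val1 g k) (S.val3 M k) (by simpa using components0 h k) :=
  congr_fun (S.val3_mk3 _ _) k

@[simp] lemma val3_wr3 (N f h) (k) :
    S.val3 (S.ops.wr3 N f h) k =
      (A k).wr3 (S.val3 N k) (S.val1 f k) (by simpa using components0 h k) :=
  congr_fun (S.val3_mk3 _ _) k

@[simp] lemma val3_ich (β α h) (k) :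
    S.val3 (S.ops.ich β α h) k =
      (A k).ich (S.val2 β k) (S.val2 α k) (by simpa using components0 h k) :=
  congr_fun (S.val3_mk3 _ _) k

lemma isInv1_ops (f : S.ops.C1) : S.ops.IsInv1 f := by
  obtain ⟨y, hy⟩ : ∃ y : S.ops.C1, ∀ k, S.val1 y k = (A k).inv1 (S.val1 f k) :=
    ⟨S.mk1 _ (S.inv1_mem _ (S.val1_mem f)), congr_fun (S.val1_mk1 _ _)⟩
  have h : S.ops.s0 y = S.ops.t0 f := ext0 fun _ => by simp [hy]
  have h' : S.ops.s0 f = S.ops.t0 y := ext0 fun _ => by simp [hy]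
  exact ⟨y, h, h', ext1 fun _ => by simp [hy], ext1 fun _ => by simp [hy]⟩

lemma isInv2_ops (α : S.ops.C2) : S.ops.IsInv2 α := by
  obtain ⟨y, hy⟩ : ∃ y : S.ops.C2, ∀ k, S.val2 y k = (A k).inv2 (S.val2 α k) :=
    ⟨S.mk2 _ (S.inv2_mem _ (S.val2_mem α)), congr_fun (S.val2_mk2 _ _)⟩
  have h : S.ops.s1 y = S.ops.t1 α := ext1 fun _ => by simp [hy]
  have h' : S.ops.s1 α = S.ops.t1 y := ext1 fun _ => by simp [hy]
  exact ⟨y, h, h', ext2 fun _ => by simp [hy], ext2 fun _ => by simp [hy]⟩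

lemma isInv3_ops (M : S.ops.C3) : S.ops.IsInv3 M := by
  obtain ⟨y, hy⟩ : ∃ y : S.ops.C3, ∀ k, S.val3 y k = (A k).inv3 (S.val3 M k) :=
    ⟨S.mk3 _ (S.inv3_mem _ (S.val3_mem M)), congr_fun (S.val3_mk3 _ _)⟩
  have h : S.ops.s2 y = S.ops.t2 M := ext2 fun _ => by simp [hy]
  have h' : S.ops.s2 M = S.ops.t2 y := ext2 fun _ => by simp [hy]
  exact ⟨y, h, h', ext3 fun _ => by simp [hy], ext3 fun _ => by simp [hy]⟩

/-- Cells are determined by their components, and all operations are computed componentwise, so that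
each axiom follows from the same axiom in the factors. The axioms given explicitly are those that
are not simp rules. -/
lemma isGray : S.ops.IsGray where
  comp1_id1 _ := ext1 fun _ => by simp
  id1_comp1 _ := ext1 fun _ => by simp
  comp1_assoc _ _ _ _ _ := ext1 fun _ => by simp
  comp2_id2 _ := ext2 fun _ => by simp
  id2_comp2 _ := ext2 fun _ => by simp
  comp2_assoc _ _ _ _ _ := ext2 fun _ => by simp
  comp3_id3 _ := ext3 fun _ => by simp
  id3_comp3 _ := ext3 fun _ => by simp
  comp3_assoc _ _ _ _ _ := ext3 fun _ => by simp
  hcomp3_id _ := ext3 fun _ => by simp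
  id_hcomp3 _ := ext3 fun _ => by simp
  hcomp3_assoc _ _ _ _ _ := ext3 fun _ => by simp
  hcomp3_id3 β α p := ext3 fun k => by
    have p := by simpa using components1 p k
    simpa using (A k).isGray.hcomp3_id3 _ _ p
  interchange N' N M' M p q r := ext3 fun k => by
    have p := by simpa using components2 p k
    have q := by simpa using components2 q k
    have r := by simpa using components1 r k
    simpa using (A k).isGray.interchange _ _ _ _ p q r
  wl2_id2 _ _ _ := ext2 fun _ => by simp
  wl2_comp2 _ _ _ _ _ := ext2 fun _ => by simp
  wl3_id3 _ _ _ := ext3 fun _ => by simp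
  wl3_comp3 _ _ _ _ _ := ext3 fun _ => by simp
  wl3_hcomp3 _ _ _ _ _ := ext3 fun _ => by simp
  wr2_id2 _ _ _ := ext2 fun _ => by simp
  wr2_comp2 _ _ _ _ _ := ext2 fun _ => by simp
  wr3_id3 _ _ _ := ext3 fun _ => by simp
  wr3_comp3 _ _ _ _ _ := ext3 fun _ => by simp
  wr3_hcomp3 _ _ _ _ _ := ext3 fun _ => by simp
  id1_wl2 _ := ext2 fun _ => by simp
  id1_wl3 _ := ext3 fun _ => by simp
  wr2_id1 _ := ext2 fun _ => by simp
  wr3_id1 _ := ext3 fun _ => by simp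
  comp1_wl2 _ _ _ _ _ := ext2 fun _ => by simp
  comp1_wl3 _ _ _ _ _ := ext3 fun _ => by simp
  wr2_comp1 _ _ _ _ _ := ext2 fun _ => by simp
  wr3_comp1 _ _ _ _ _ := ext3 fun _ => by simp
  wr2_wl2 _ _ _ _ _ := ext2 fun _ => by simp
  wr3_wl3 _ _ _ _ _ := ext3 fun _ => by simp
  ich_inv β α p := S.isInv3_ops (S.ops.ich β α p)
  ich_id_left _ _ _ := ext3 fun _ => by simp
  ich_id_right _ _ _ := ext3 fun _ => by simp
  ich_comp_right β α' α p q := ext3 fun k => by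
    have p := by simpa using components1 p k
    have q := by simpa using components0 q k
    simpa using (A k).isGray.ich_comp_right _ _ _ p q
  ich_comp_left β' β α p q := ext3 fun k => by
    have p := by simpa using components1 p k
    have q := by simpa using components0 q k
    simpa using (A k).isGray.ich_comp_left _ _ _ p q
  ich_natural_right β M p := ext3 fun k => by
    have p := by simpa using components0 p k
    simpa using (A k).isGray.ich_natural_right _ _ p
  ich_natural_left N α p := ext3 fun k => by
    have p := by simpa using components0 p k
    simpa using (A k).isGray.ich_natural_left _ _ p
  wl3_ich _ _ _ _ _ := ext3 fun _ => by simp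
  ich_wr2 _ _ _ _ _ := ext3 fun _ => by simp
  wr3_ich _ _ _ _ _ := ext3 fun _ => by simp

/-- A small sub-Gray-groupoid of a product of Gray-groupoids, as a Gray-groupoid. -/
noncomputable def toGrayGpd : GrayGpd.{u} where
  obj := { toGrayOps := S.ops, isGray := S.isGray }
  property := ⟨S.isInv1_ops, S.isInv2_ops, S.isInv3_ops⟩

/-- The projections. -/
noncomputable def proj (k : ι) : GrayFunctor S.toGrayGpd.obj (A k) where
  F0 X := S.val0 X k
  F1 f := S.val1 f k
  F2 α := S.val2 α k
  F3 M := S.val3 M k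
  s0_F1 f := (S.val0_s0 f k).symm
  t0_F1 f := (S.val0_t0 f k).symm
  s1_F2 α := (S.val1_s1 α k).symm
  t1_F2 α := (S.val1_t1 α k).symm
  s2_F3 M := (S.val2_s2 M k).symm
  t2_F3 M := (S.val2_t2 M k).symm
  map_id1 X := S.val1_id1 X k
  map_id2 f := S.val2_id2 f k
  map_id3 α := S.val3_id3 α k
  map_comp1 g f h := S.val1_comp1 g f h k
  map_comp2 β α h := S.val2_comp2 β α h k
  map_comp3 N M h := S.val3_comp3 N M h k
  map_hcomp3 N M h := S.val3_hcomp3 N M h k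
  map_wl2 g α h := S.val2_wl2 g α h k
  map_wr2 β f h := S.val2_wr2 β f h k
  map_wl3 g M h := S.val3_wl3 g M h k
  map_wr3 N f h := S.val3_wr3 N f h k
  map_ich β α h := S.val3_ich β α h k

/-- The projections are Gray-functors, and these preserve strict inverses. -/
lemma val1_inv1 (f : S.ops.C1) (k) :
    S.val1 (S.toGrayGpd.obj.inv1 f) k = (A k).inv1 (S.val1 f k) :=
  (S.proj k).map_inv1 f
lemma val2_inv2 (α : S.ops.C2) (k) :
    S.val2 (S.toGrayGpd.obj.inv2 α) k = (A k).inv2 (S.val2 α k) :=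
  (S.proj k).map_inv2 α
lemma val3_inv3 (M : S.ops.C3) (k) :
    S.val3 (S.toGrayGpd.obj.inv3 M) k = (A k).inv3 (S.val3 M k) :=
  (S.proj k).map_inv3 M

end SmallSubGroupoid

/-! ### The sub-Gray-groupoid generated by a small family of cells. -/

/-- The type of `n`-cells. -/
abbrev GrayCells.Cell (A : GrayCells.{u}) (n : ℕ) : Type u :=
  match n with
  | 0 => A.C0
  | 1 => A.C1
  | 2 => A.C2
  | _ => A.C3

/-- The formal `n`-cells which are obtained from generating cells by means of the operations of
Gray-groupoids. -/
inductive GrayTerm (G : ℕ → Type u) : ℕ → Type u where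
  /-- a generating cell -/
  | gen {n : ℕ} : G n → GrayTerm G n
  /-- the source of a 1-cell -/
  | s0 : GrayTerm G 1 → GrayTerm G 0
  /-- the target of a 1-cell -/
  | t0 : GrayTerm G 1 → GrayTerm G 0
  /-- the source of a 2-cell -/
  | s1 : GrayTerm G 2 → GrayTerm G 1
  /-- the target of a 2-cell -/
  | t1 : GrayTerm G 2 → GrayTerm G 1
  /-- the source of a 3-cell -/
  | s2 : GrayTerm G 3 → GrayTerm G 2
  /-- the target of a 3-cell -/
  | t2 : GrayTerm G 3 → GrayTerm G 2
  /-- an identity 1-cell -/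
  | id1 : GrayTerm G 0 → GrayTerm G 1
  /-- an identity 2-cell -/
  | id2 : GrayTerm G 1 → GrayTerm G 2
  /-- an identity 3-cell -/
  | id3 : GrayTerm G 2 → GrayTerm G 3
  /-- the inverse of a 1-cell -/
  | inv1 : GrayTerm G 1 → GrayTerm G 1
  /-- the inverse of a 2-cell -/
  | inv2 : GrayTerm G 2 → GrayTerm G 2
  /-- the inverse of a 3-cell -/
  | inv3 : GrayTerm G 3 → GrayTerm G 3
  /-- a composite of 1-cells -/
  | comp1 : GrayTerm G 1 → GrayTerm G 1 → GrayTerm G 1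
  /-- a vertical composite of 2-cells -/
  | comp2 : GrayTerm G 2 → GrayTerm G 2 → GrayTerm G 2
  /-- a composite of 3-cells along a 2-cell -/
  | comp3 : GrayTerm G 3 → GrayTerm G 3 → GrayTerm G 3
  /-- a composite of 3-cells along a 1-cell -/
  | hcomp3 : GrayTerm G 3 → GrayTerm G 3 → GrayTerm G 3
  /-- a left whiskering of a 2-cell -/
  | wl2 : GrayTerm G 1 → GrayTerm G 2 → GrayTerm G 2
  /-- a right whiskering of a 2-cell -/
  | wr2 : GrayTerm G 2 → GrayTerm G 1 → GrayTerm G 2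
  /-- a left whiskering of a 3-cell -/
  | wl3 : GrayTerm G 1 → GrayTerm G 3 → GrayTerm G 3
  /-- a right whiskering of a 3-cell -/
  | wr3 : GrayTerm G 3 → GrayTerm G 1 → GrayTerm G 3
  /-- a pseudonaturality 3-cell -/
  | ich : GrayTerm G 2 → GrayTerm G 2 → GrayTerm G 3

section

variable {ι : Type w} {A : ι → GrayCat.{u}} [∀ k, (A k).IsGroupoid] {G : ℕ → Type u}
  (γ : ∀ n, G n → ∀ k, (A k).Cell n)

open scoped Classical in
/-- The evaluation of formal cells in a family of Gray-groupoids, when the values of the generating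
cells are given. If some cells are not composable, their composite is given an irrelevant value. -/
noncomputable def GrayTerm.eval {n : ℕ} (t : GrayTerm G n) : ∀ k, (A k).Cell n :=
  match n, t with
  | n, .gen x => γ n x
  | _, .s0 x => fun k => (A k).s0 (x.eval k)
  | _, .t0 x => fun k => (A k).t0 (x.eval k)
  | _, .s1 x => fun k => (A k).s1 (x.eval k)
  | _, .t1 x => fun k => (A k).t1 (x.eval k)
  | _, .s2 x => fun k => (A k).s2 (x.eval k)
  | _, .t2 x => fun k => (A k).t2 (x.eval k)
  | _, .id1 x => fun k => (A k).id1 (x.eval k)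
  | _, .id2 x => fun k => (A k).id2 (x.eval k)
  | _, .id3 x => fun k => (A k).id3 (x.eval k)
  | _, .inv1 x => fun k => (A k).inv1 (x.eval k)
  | _, .inv2 x => fun k => (A k).inv2 (x.eval k)
  | _, .inv3 x => fun k => (A k).inv3 (x.eval k)
  | _, .comp1 g f =>
    if h : ∀ k, (A k).s0 (g.eval k) = (A k).t0 (f.eval k) then
      fun k => (A k).comp1 (g.eval k) (f.eval k) (h k) else g.eval
  | _, .comp2 β α =>
    if h : ∀ k, (A k).s1 (β.eval k) = (A k).t1 (α.eval k) then
      fun k => (A k).comp2 (β.eval k) (α.eval k) (h k) else β.eval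
  | _, .comp3 N M =>
    if h : ∀ k, (A k).s2 (N.eval k) = (A k).t2 (M.eval k) then
      fun k => (A k).comp3 (N.eval k) (M.eval k) (h k) else N.eval
  | _, .hcomp3 N M =>
    if h : ∀ k, (A k).s1 ((A k).s2 (N.eval k)) = (A k).t1 ((A k).s2 (M.eval k)) then
      fun k => (A k).hcomp3 (N.eval k) (M.eval k) (h k) else N.eval
  | _, .wl2 g α =>
    if h : ∀ k, (A k).s0 (g.eval k) = (A k).t0 ((A k).s1 (α.eval k)) then
      fun k => (A k).wl2 (g.eval k) (α.eval k) (h k) else α.eval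
  | _, .wr2 β f =>
    if h : ∀ k, (A k).s0 ((A k).s1 (β.eval k)) = (A k).t0 (f.eval k) then
      fun k => (A k).wr2 (β.eval k) (f.eval k) (h k) else β.eval
  | _, .wl3 g M =>
    if h : ∀ k, (A k).s0 (g.eval k) = (A k).t0 ((A k).s1 ((A k).s2 (M.eval k))) then
      fun k => (A k).wl3 (g.eval k) (M.eval k) (h k) else M.eval
  | _, .wr3 N f =>
    if h : ∀ k, (A k).s0 ((A k).s1 ((A k).s2 (N.eval k))) = (A k).t0 (f.eval k) then
      fun k => (A k).wr3 (N.eval k) (f.eval k) (h k) else N.eval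
  -- Every irrelevant value is built from the values of subterms, so that inductions on terms go
  -- through. Here no subterm is a 3-cell, and an identity is used instead.
  | _, .ich β α =>
    if h : ∀ k, (A k).s0 ((A k).s1 (β.eval k)) = (A k).t0 ((A k).s1 (α.eval k)) then
      fun k => (A k).ich (β.eval k) (α.eval k) (h k) else fun k => (A k).id3 (β.eval k)

/-- The small sub-Gray-groupoid which is generated by a small family of cells. -/
noncomputable def SmallSubGroupoid.generated : SmallSubGroupoid A where
  S0 := Set.range fun t : GrayTerm G 0 => t.eval γ
  S1 := Set.range fun t : GrayTerm G 1 => t.eval γ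
  S2 := Set.range fun t : GrayTerm G 2 => t.eval γ
  S3 := Set.range fun t : GrayTerm G 3 => t.eval γ
  -- The formal cells form a type in the universe of the generators, so the set of their values is
  -- small even though the index type `ι` may be large.
  small0 := inferInstance
  small1 := inferInstance
  small2 := inferInstance
  small3 := inferInstance
  s0_mem := by rintro _ ⟨x, rfl⟩; exact ⟨x.s0, rfl⟩
  t0_mem := by rintro _ ⟨x, rfl⟩; exact ⟨x.t0, rfl⟩
  s1_mem := by rintro _ ⟨x, rfl⟩; exact ⟨x.s1, rfl⟩
  t1_mem := by rintro _ ⟨x, rfl⟩; exact ⟨x.t1, rfl⟩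
  s2_mem := by rintro _ ⟨x, rfl⟩; exact ⟨x.s2, rfl⟩
  t2_mem := by rintro _ ⟨x, rfl⟩; exact ⟨x.t2, rfl⟩
  id1_mem := by rintro _ ⟨x, rfl⟩; exact ⟨x.id1, rfl⟩
  id2_mem := by rintro _ ⟨x, rfl⟩; exact ⟨x.id2, rfl⟩
  id3_mem := by rintro _ ⟨x, rfl⟩; exact ⟨x.id3, rfl⟩
  inv1_mem := by rintro _ ⟨x, rfl⟩; exact ⟨x.inv1, rfl⟩
  inv2_mem := by rintro _ ⟨x, rfl⟩; exact ⟨x.inv2, rfl⟩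
  inv3_mem := by rintro _ ⟨x, rfl⟩; exact ⟨x.inv3, rfl⟩
  comp1_mem := by rintro _ ⟨x, rfl⟩ _ ⟨y, rfl⟩ h; exact ⟨x.comp1 y, dif_pos h⟩
  comp2_mem := by rintro _ ⟨x, rfl⟩ _ ⟨y, rfl⟩ h; exact ⟨x.comp2 y, dif_pos h⟩
  comp3_mem := by rintro _ ⟨x, rfl⟩ _ ⟨y, rfl⟩ h; exact ⟨x.comp3 y, dif_pos h⟩
  hcomp3_mem := by rintro _ ⟨x, rfl⟩ _ ⟨y, rfl⟩ h; exact ⟨x.hcomp3 y, dif_pos h⟩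
  wl2_mem := by rintro _ ⟨x, rfl⟩ _ ⟨y, rfl⟩ h; exact ⟨x.wl2 y, dif_pos h⟩
  wr2_mem := by rintro _ ⟨x, rfl⟩ _ ⟨y, rfl⟩ h; exact ⟨x.wr2 y, dif_pos h⟩
  wl3_mem := by rintro _ ⟨x, rfl⟩ _ ⟨y, rfl⟩ h; exact ⟨x.wl3 y, dif_pos h⟩
  wr3_mem := by rintro _ ⟨x, rfl⟩ _ ⟨y, rfl⟩ h; exact ⟨x.wr3 y, dif_pos h⟩
  ich_mem := by rintro _ ⟨x, rfl⟩ _ ⟨y, rfl⟩ h; exact ⟨x.ich y, dif_pos h⟩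

namespace SmallSubGroupoid

variable {γ}

lemma exists_val0_generated (t : GrayTerm G 0) :
    ∃ x : (generated γ).ops.C0, ∀ k, (generated γ).val0 x k = t.eval γ k :=
  ⟨(generated γ).mk0 _ ⟨t, rfl⟩, congr_fun ((generated γ).val0_mk0 _ _)⟩
lemma exists_val1_generated (t : GrayTerm G 1) :
    ∃ x : (generated γ).ops.C1, ∀ k, (generated γ).val1 x k = t.eval γ k :=
  ⟨(generated γ).mk1 _ ⟨t, rfl⟩, congr_fun ((generated γ).val1_mk1 _ _)⟩
lemma exists_val2_generated (t : GrayTerm G 2) :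
    ∃ x : (generated γ).ops.C2, ∀ k, (generated γ).val2 x k = t.eval γ k :=
  ⟨(generated γ).mk2 _ ⟨t, rfl⟩, congr_fun ((generated γ).val2_mk2 _ _)⟩
lemma exists_val3_generated (t : GrayTerm G 3) :
    ∃ x : (generated γ).ops.C3, ∀ k, (generated γ).val3 x k = t.eval γ k :=
  ⟨(generated γ).mk3 _ ⟨t, rfl⟩, congr_fun ((generated γ).val3_mk3 _ _)⟩

/-- Two Gray-functors agree on the `n`-cells with the given components. -/
abbrev AgreeAt {B : GrayCat.{u}} (F F' : GrayFunctor (generated γ).toGrayGpd.obj B) {n : ℕ}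
    (v : ∀ k, (A k).Cell n) : Prop :=
  match n with
  | 0 => ∀ x, (∀ k, (generated γ).val0 x k = v k) → F.F0 x = F'.F0 x
  | 1 => ∀ x, (∀ k, (generated γ).val1 x k = v k) → F.F1 x = F'.F1 x
  | 2 => ∀ x, (∀ k, (generated γ).val2 x k = v k) → F.F2 x = F'.F2 x
  | _ + 3 => ∀ x, (∀ k, (generated γ).val3 x k = v k) → F.F3 x = F'.F3 x

/-- Induction on the formal cell: Gray-functors between Gray-groupoids preserve all the operations,
inverses included. A composite that is not defined has the value of a subterm, or the identity of
one, and the induction hypothesis still applies. -/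
lemma agreeAt_eval {B : GrayCat.{u}} [B.IsGroupoid]
    {F F' : GrayFunctor (generated γ).toGrayGpd.obj B}
    (hγ : ∀ n (x : G n), AgreeAt F F' (γ n x)) {n : ℕ} (t : GrayTerm G n) :
    AgreeAt F F' (t.eval γ) := by
  induction t with
  | gen x => exact hγ _ x
  | s0 t ih =>
    intro x hx
    obtain ⟨y, hy⟩ := exists_val1_generated (γ := γ) t
    obtain rfl : x = (generated γ).ops.s0 y := ext0 fun k => (hx k).trans (by simp [hy]; rfl)
    exact (F.s0_F1 y).symm.trans ((congr_arg B.s0 (ih y hy)).trans (F'.s0_F1 y))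
  | t0 t ih =>
    intro x hx
    obtain ⟨y, hy⟩ := exists_val1_generated (γ := γ) t
    obtain rfl : x = (generated γ).ops.t0 y := ext0 fun k => (hx k).trans (by simp [hy]; rfl)
    exact (F.t0_F1 y).symm.trans ((congr_arg B.t0 (ih y hy)).trans (F'.t0_F1 y))
  | s1 t ih =>
    intro x hx
    obtain ⟨y, hy⟩ := exists_val2_generated (γ := γ) t
    obtain rfl : x = (generated γ).ops.s1 y := ext1 fun k => (hx k).trans (by simp [hy]; rfl)
    exact (F.s1_F2 y).symm.trans ((congr_arg B.s1 (ih y hy)).trans (F'.s1_F2 y))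
  | t1 t ih =>
    intro x hx
    obtain ⟨y, hy⟩ := exists_val2_generated (γ := γ) t
    obtain rfl : x = (generated γ).ops.t1 y := ext1 fun k => (hx k).trans (by simp [hy]; rfl)
    exact (F.t1_F2 y).symm.trans ((congr_arg B.t1 (ih y hy)).trans (F'.t1_F2 y))
  | s2 t ih =>
    intro x hx
    obtain ⟨y, hy⟩ := exists_val3_generated (γ := γ) t
    obtain rfl : x = (generated γ).ops.s2 y := ext2 fun k => (hx k).trans (by simp [hy]; rfl)
    exact (F.s2_F3 y).symm.trans ((congr_arg B.s2 (ih y hy)).trans (F'.s2_F3 y))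
  | t2 t ih =>
    intro x hx
    obtain ⟨y, hy⟩ := exists_val3_generated (γ := γ) t
    obtain rfl : x = (generated γ).ops.t2 y := ext2 fun k => (hx k).trans (by simp [hy]; rfl)
    exact (F.t2_F3 y).symm.trans ((congr_arg B.t2 (ih y hy)).trans (F'.t2_F3 y))
  | id1 t ih =>
    intro x hx
    obtain ⟨y, hy⟩ := exists_val0_generated (γ := γ) t
    obtain rfl : x = (generated γ).ops.id1 y := ext1 fun k => (hx k).trans (by simp [hy]; rfl)
    exact (F.map_id1 y).trans ((congr_arg B.id1 (ih y hy)).trans (F'.map_id1 y).symm)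
  | id2 t ih =>
    intro x hx
    obtain ⟨y, hy⟩ := exists_val1_generated (γ := γ) t
    obtain rfl : x = (generated γ).ops.id2 y := ext2 fun k => (hx k).trans (by simp [hy]; rfl)
    exact (F.map_id2 y).trans ((congr_arg B.id2 (ih y hy)).trans (F'.map_id2 y).symm)
  | id3 t ih =>
    intro x hx
    obtain ⟨y, hy⟩ := exists_val2_generated (γ := γ) t
    obtain rfl : x = (generated γ).ops.id3 y := ext3 fun k => (hx k).trans (by simp [hy]; rfl)
    exact (F.map_id3 y).trans ((congr_arg B.id3 (ih y hy)).trans (F'.map_id3 y).symm)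
  | inv1 t ih =>
    intro x hx
    obtain ⟨y, hy⟩ := exists_val1_generated (γ := γ) t
    obtain rfl : x = (generated γ).toGrayGpd.obj.inv1 y := ext1 fun k => (hx k).trans
      (by rw [(generated γ).val1_inv1, hy]; rfl)
    exact (F.map_inv1 y).trans ((congr_arg B.inv1 (ih y hy)).trans (F'.map_inv1 y).symm)
  | inv2 t ih =>
    intro x hx
    obtain ⟨y, hy⟩ := exists_val2_generated (γ := γ) t
    obtain rfl : x = (generated γ).toGrayGpd.obj.inv2 y := ext2 fun k => (hx k).trans
      (by rw [(generated γ).val2_inv2, hy]; rfl)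
    exact (F.map_inv2 y).trans ((congr_arg B.inv2 (ih y hy)).trans (F'.map_inv2 y).symm)
  | inv3 t ih =>
    intro x hx
    obtain ⟨y, hy⟩ := exists_val3_generated (γ := γ) t
    obtain rfl : x = (generated γ).toGrayGpd.obj.inv3 y := ext3 fun k => (hx k).trans
      (by rw [(generated γ).val3_inv3, hy]; rfl)
    exact (F.map_inv3 y).trans ((congr_arg B.inv3 (ih y hy)).trans (F'.map_inv3 y).symm)
  | comp1 t t' ih ih' =>
    intro x hx
    obtain ⟨y, hy⟩ := exists_val1_generated (γ := γ) t
    obtain ⟨z, hz⟩ := exists_val1_generated (γ := γ) t'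
    by_cases h : ∀ k, (A k).s0 (t.eval γ k) = (A k).t0 (t'.eval γ k)
    · have h' : (generated γ).ops.s0 y = (generated γ).ops.t0 z := ext0 fun k => by
        simpa [hy, hz] using h k
      obtain rfl : x = (generated γ).ops.comp1 y z h' := ext1 fun k =>
        ((hx k).trans (congr_fun (dif_pos h) k)).trans (by simp [hy, hz])
      refine (F.map_comp1 y z h').trans (Eq.trans ?_ (F'.map_comp1 y z h').symm)
      simp only [ih y hy, ih' z hz]
    · exact ih x fun k => (hx k).trans (congr_fun (dif_neg h) k)
  | comp2 t t' ih ih' =>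
    intro x hx
    obtain ⟨y, hy⟩ := exists_val2_generated (γ := γ) t
    obtain ⟨z, hz⟩ := exists_val2_generated (γ := γ) t'
    by_cases h : ∀ k, (A k).s1 (t.eval γ k) = (A k).t1 (t'.eval γ k)
    · have h' : (generated γ).ops.s1 y = (generated γ).ops.t1 z := ext1 fun k => by
        simpa [hy, hz] using h k
      obtain rfl : x = (generated γ).ops.comp2 y z h' := ext2 fun k =>
        ((hx k).trans (congr_fun (dif_pos h) k)).trans (by simp [hy, hz])
      refine (F.map_comp2 y z h').trans (Eq.trans ?_ (F'.map_comp2 y z h').symm)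
      simp only [ih y hy, ih' z hz]
    · exact ih x fun k => (hx k).trans (congr_fun (dif_neg h) k)
  | comp3 t t' ih ih' =>
    intro x hx
    obtain ⟨y, hy⟩ := exists_val3_generated (γ := γ) t
    obtain ⟨z, hz⟩ := exists_val3_generated (γ := γ) t'
    by_cases h : ∀ k, (A k).s2 (t.eval γ k) = (A k).t2 (t'.eval γ k)
    · have h' : (generated γ).ops.s2 y = (generated γ).ops.t2 z := ext2 fun k => by
        simpa [hy, hz] using h k
      obtain rfl : x = (generated γ).ops.comp3 y z h' := ext3 fun k =>
        ((hx k).trans (congr_fun (dif_pos h) k)).trans (by simp [hy, hz])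
      refine (F.map_comp3 y z h').trans (Eq.trans ?_ (F'.map_comp3 y z h').symm)
      simp only [ih y hy, ih' z hz]
    · exact ih x fun k => (hx k).trans (congr_fun (dif_neg h) k)
  | hcomp3 t t' ih ih' =>
    intro x hx
    obtain ⟨y, hy⟩ := exists_val3_generated (γ := γ) t
    obtain ⟨z, hz⟩ := exists_val3_generated (γ := γ) t'
    by_cases h : ∀ k, (A k).s1 ((A k).s2 (t.eval γ k)) = (A k).t1 ((A k).s2 (t'.eval γ k))
    · have h' : (generated γ).ops.s1 ((generated γ).ops.s2 y) = (generated γ).ops.t1 ((generated γ).ops.s2 z) := ext1 fun k => by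
        simpa [hy, hz] using h k
      obtain rfl : x = (generated γ).ops.hcomp3 y z h' := ext3 fun k =>
        ((hx k).trans (congr_fun (dif_pos h) k)).trans (by simp [hy, hz])
      refine (F.map_hcomp3 y z h').trans (Eq.trans ?_ (F'.map_hcomp3 y z h').symm)
      simp only [ih y hy, ih' z hz]
    · exact ih x fun k => (hx k).trans (congr_fun (dif_neg h) k)
  | wl2 t t' ih ih' =>
    intro x hx
    obtain ⟨y, hy⟩ := exists_val1_generated (γ := γ) t
    obtain ⟨z, hz⟩ := exists_val2_generated (γ := γ) t'
    by_cases h : ∀ k, (A k).s0 (t.eval γ k) = (A k).t0 ((A k).s1 (t'.eval γ k))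
    · have h' : (generated γ).ops.s0 y = (generated γ).ops.t0 ((generated γ).ops.s1 z) := ext0 fun k => by
        simpa [hy, hz] using h k
      obtain rfl : x = (generated γ).ops.wl2 y z h' := ext2 fun k =>
        ((hx k).trans (congr_fun (dif_pos h) k)).trans (by simp [hy, hz])
      refine (F.map_wl2 y z h').trans (Eq.trans ?_ (F'.map_wl2 y z h').symm)
      simp only [ih y hy, ih' z hz]
    · exact ih' x fun k => (hx k).trans (congr_fun (dif_neg h) k)
  | wr2 t t' ih ih' =>
    intro x hx
    obtain ⟨y, hy⟩ := exists_val2_generated (γ := γ) t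
    obtain ⟨z, hz⟩ := exists_val1_generated (γ := γ) t'
    by_cases h : ∀ k, (A k).s0 ((A k).s1 (t.eval γ k)) = (A k).t0 (t'.eval γ k)
    · have h' : (generated γ).ops.s0 ((generated γ).ops.s1 y) = (generated γ).ops.t0 z := ext0 fun k => by
        simpa [hy, hz] using h k
      obtain rfl : x = (generated γ).ops.wr2 y z h' := ext2 fun k =>
        ((hx k).trans (congr_fun (dif_pos h) k)).trans (by simp [hy, hz])
      refine (F.map_wr2 y z h').trans (Eq.trans ?_ (F'.map_wr2 y z h').symm)
      simp only [ih y hy, ih' z hz]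
    · exact ih x fun k => (hx k).trans (congr_fun (dif_neg h) k)
  | wl3 t t' ih ih' =>
    intro x hx
    obtain ⟨y, hy⟩ := exists_val1_generated (γ := γ) t
    obtain ⟨z, hz⟩ := exists_val3_generated (γ := γ) t'
    by_cases h : ∀ k, (A k).s0 (t.eval γ k) = (A k).t0 ((A k).s1 ((A k).s2 (t'.eval γ k)))
    · have h' : (generated γ).ops.s0 y = (generated γ).ops.t0 ((generated γ).ops.s1 ((generated γ).ops.s2 z)) := ext0 fun k => by
        simpa [hy, hz] using h k
      obtain rfl : x = (generated γ).ops.wl3 y z h' := ext3 fun k =>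
        ((hx k).trans (congr_fun (dif_pos h) k)).trans (by simp [hy, hz])
      refine (F.map_wl3 y z h').trans (Eq.trans ?_ (F'.map_wl3 y z h').symm)
      simp only [ih y hy, ih' z hz]
    · exact ih' x fun k => (hx k).trans (congr_fun (dif_neg h) k)
  | wr3 t t' ih ih' =>
    intro x hx
    obtain ⟨y, hy⟩ := exists_val3_generated (γ := γ) t
    obtain ⟨z, hz⟩ := exists_val1_generated (γ := γ) t'
    by_cases h : ∀ k, (A k).s0 ((A k).s1 ((A k).s2 (t.eval γ k))) = (A k).t0 (t'.eval γ k)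
    · have h' : (generated γ).ops.s0 ((generated γ).ops.s1 ((generated γ).ops.s2 y)) = (generated γ).ops.t0 z := ext0 fun k => by
        simpa [hy, hz] using h k
      obtain rfl : x = (generated γ).ops.wr3 y z h' := ext3 fun k =>
        ((hx k).trans (congr_fun (dif_pos h) k)).trans (by simp [hy, hz])
      refine (F.map_wr3 y z h').trans (Eq.trans ?_ (F'.map_wr3 y z h').symm)
      simp only [ih y hy, ih' z hz]
    · exact ih x fun k => (hx k).trans (congr_fun (dif_neg h) k)
  | ich t t' ih ih' =>
    intro x hx
    obtain ⟨y, hy⟩ := exists_val2_generated (γ := γ) t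
    obtain ⟨z, hz⟩ := exists_val2_generated (γ := γ) t'
    by_cases h : ∀ k, (A k).s0 ((A k).s1 (t.eval γ k)) = (A k).t0 ((A k).s1 (t'.eval γ k))
    · have h' : (generated γ).ops.s0 ((generated γ).ops.s1 y) = (generated γ).ops.t0 ((generated γ).ops.s1 z) := ext0 fun k => by
        simpa [hy, hz] using h k
      obtain rfl : x = (generated γ).ops.ich y z h' := ext3 fun k =>
        ((hx k).trans (congr_fun (dif_pos h) k)).trans (by simp [hy, hz])
      refine (F.map_ich y z h').trans (Eq.trans ?_ (F'.map_ich y z h').symm)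
      simp only [ih y hy, ih' z hz]
    · obtain rfl : x = (generated γ).ops.id3 y := ext3 fun k =>
        ((hx k).trans (congr_fun (dif_neg h) k)).trans (by simp [hy])
      exact (F.map_id3 y).trans ((congr_arg B.id3 (ih y hy)).trans (F'.map_id3 y).symm)

/-- Two Gray-functors which are defined on a generated Gray-groupoid agree as soon as they agree on
the generating cells. -/
lemma generated_hom_ext {B : GrayCat.{u}} [B.IsGroupoid]
    {F F' : GrayFunctor (generated γ).toGrayGpd.obj B}
    (hγ : ∀ n (x : G n), AgreeAt F F' (γ n x)) : F = F' := by
  ext x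
  · obtain ⟨t, ht⟩ := (generated γ).val0_mem x
    exact agreeAt_eval hγ t x fun k => (congr_fun ht k).symm
  · obtain ⟨t, ht⟩ := (generated γ).val1_mem x
    exact agreeAt_eval hγ t x fun k => (congr_fun ht k).symm
  · obtain ⟨t, ht⟩ := (generated γ).val2_mem x
    exact agreeAt_eval hγ t x fun k => (congr_fun ht k).symm
  · obtain ⟨t, ht⟩ := (generated γ).val3_mem x
    exact agreeAt_eval hγ t x fun k => (congr_fun ht k).symm

end SmallSubGroupoid

end

/-! ### The free Gray-groupoid on a simplicial set. -/

namespace SSet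

/-- The objects of the free Gray-groupoid on `X`: the vertices of the simplices of `X`. -/
structure VertexGenerator (X : SSet.{u}) where
  {dim : SimplexCategoryᵒᵖ}
  simplex : X.obj dim
  i : Fin (dim.unop.len + 1)

/-- The generating 1-cells of the free Gray-groupoid on `X`. -/
structure EdgeGenerator (X : SSet.{u}) where
  {dim : SimplexCategoryᵒᵖ}
  simplex : X.obj dim
  {i j : Fin (dim.unop.len + 1)}
  ij : i ≤ j

/-- The generating 2-cells of the free Gray-groupoid on `X`. -/
structure TriangleGenerator (X : SSet.{u}) where
  {dim : SimplexCategoryᵒᵖ}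
  simplex : X.obj dim
  {i j k : Fin (dim.unop.len + 1)}
  ij : i ≤ j
  jk : j ≤ k

/-- The generating 3-cells of the free Gray-groupoid on `X`. -/
structure TetrahedronGenerator (X : SSet.{u}) where
  {dim : SimplexCategoryᵒᵖ}
  simplex : X.obj dim
  {i j k l : Fin (dim.unop.len + 1)}
  ij : i ≤ j
  jk : j ≤ k
  kl : k ≤ l

/-- The generating `n`-cells of the free Gray-groupoid on `X`. -/
abbrev GrayGenerators (X : SSet.{u}) (n : ℕ) : Type u :=
  match n with
  | 0 => X.VertexGenerator
  | 1 => X.EdgeGenerator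
  | 2 => X.TriangleGenerator
  | _ => X.TetrahedronGenerator

variable (X : SSet.{u})

/-- The Gray-groupoid underlying a map from `X` to the nerve of a Gray-groupoid. -/
abbrev targetGray (k : StructuredArrow X grayNerve.{u}) : GrayCat.{u} := k.right.obj

variable {X}

/-- The image of a simplex of `X` by a map to the nerve of a Gray-groupoid. -/
def imageSimplex (k : StructuredArrow X grayNerve.{u}) {m : SimplexCategoryᵒᵖ} (x : X.obj m) :
    GraySimplex (X.targetGray k) (Fin (m.unop.len + 1)) :=
  k.hom.app m x

lemma imageSimplex_map (k : StructuredArrow X grayNerve.{u}) {m m' : SimplexCategoryᵒᵖ}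
    (φ : m ⟶ m') (x : X.obj m) :
    imageSimplex k (X.map φ x) = (imageSimplex k x).reindex φ.unop.toOrderHom :=
  NatTrans.naturality_apply k.hom φ x

variable (X) in
/-- The values of the generating cells in all Gray-groupoids under `X`. -/
def generatorValue (n : ℕ) (x : X.GrayGenerators n) (k : StructuredArrow X grayNerve.{u}) :
    (X.targetGray k).Cell n :=
  match n, x with
  | 0, x => (imageSimplex k x.simplex).ob x.i
  | 1, x => (imageSimplex k x.simplex).f x.ij
  | 2, x => (imageSimplex k x.simplex).α x.ij x.jk
  | _ + 3, x => (imageSimplex k x.simplex).X x.ij x.jk x.kl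

variable (X) in
/-- The free Gray-groupoid on `X`, in the product of all Gray-groupoids under `X`. -/
noncomputable def freeSubGroupoid : SmallSubGroupoid X.targetGray :=
  SmallSubGroupoid.generated X.generatorValue

variable (X) in
/-- The free Gray-groupoid on a simplicial set. -/
noncomputable def freeGrayGpd : GrayGpd.{u} := X.freeSubGroupoid.toGrayGpd

/-- The projections from the free Gray-groupoid. -/
noncomputable def freeProj (k : StructuredArrow X grayNerve.{u}) : X.freeGrayGpd ⟶ k.right :=
  ⟨X.freeSubGroupoid.proj k⟩

open SmallSubGroupoid

section

variable {m : SimplexCategoryᵒᵖ} (x : X.obj m)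

/-- The cells of the free Gray-groupoid which are given by the vertices of a simplex. -/
noncomputable def freeOb (i : Fin (m.unop.len + 1)) : X.freeSubGroupoid.ops.C0 :=
  X.freeSubGroupoid.mk0 _ ⟨.gen (⟨x, i⟩ : X.VertexGenerator), rfl⟩

/-- The cells of the free Gray-groupoid which are given by the edges of a simplex. -/
noncomputable def freeF {i j : Fin (m.unop.len + 1)} (ij : i ≤ j) : X.freeSubGroupoid.ops.C1 :=
  X.freeSubGroupoid.mk1 _ ⟨.gen (⟨x, ij⟩ : X.EdgeGenerator), rfl⟩

/-- The cells of the free Gray-groupoid which are given by the triangles of a simplex. -/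
noncomputable def freeα {i j k : Fin (m.unop.len + 1)} (ij : i ≤ j) (jk : j ≤ k) :
    X.freeSubGroupoid.ops.C2 :=
  X.freeSubGroupoid.mk2 _ ⟨.gen (⟨x, ij, jk⟩ : X.TriangleGenerator), rfl⟩

/-- The cells of the free Gray-groupoid which are given by the tetrahedra of a simplex. -/
noncomputable def freeX {i j k l : Fin (m.unop.len + 1)} (ij : i ≤ j) (jk : j ≤ k) (kl : k ≤ l) :
    X.freeSubGroupoid.ops.C3 :=
  X.freeSubGroupoid.mk3 _ ⟨.gen (⟨x, ij, jk, kl⟩ : X.TetrahedronGenerator), rfl⟩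

@[simp] lemma val0_freeOb (i) (k) :
    X.freeSubGroupoid.val0 (freeOb x i) k = (imageSimplex k x).ob i :=
  congr_fun (X.freeSubGroupoid.val0_mk0 _ _) k

@[simp] lemma val1_freeF {i j} (ij : i ≤ j) (k) :
    X.freeSubGroupoid.val1 (freeF x ij) k = (imageSimplex k x).f ij :=
  congr_fun (X.freeSubGroupoid.val1_mk1 _ _) k

@[simp] lemma val2_freeα {i j l} (ij : i ≤ j) (jl : j ≤ l) (k) :
    X.freeSubGroupoid.val2 (freeα x ij jl) k = (imageSimplex k x).α ij jl :=
  congr_fun (X.freeSubGroupoid.val2_mk2 _ _) k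

@[simp] lemma val3_freeX {i j l n} (ij : i ≤ j) (jl : j ≤ l) (ln : l ≤ n) (k) :
    X.freeSubGroupoid.val3 (freeX x ij jl ln) k = (imageSimplex k x).X ij jl ln :=
  congr_fun (X.freeSubGroupoid.val3_mk3 _ _) k

/-- The data of a simplex of the nerve of the free Gray-groupoid. -/
noncomputable def freeSimplexData :
    GraySimplexData X.freeGrayGpd.obj (Fin (m.unop.len + 1)) where
  ob i := freeOb x i
  f ij := freeF x ij
  s0_f _ := ext0 fun _ => (val0_s0_ops ..).trans (by simp)
  t0_f _ := ext0 fun _ => (val0_t0_ops ..).trans (by simp)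
  f_refl _ := ext1 fun _ => Eq.trans (by simp [GraySimplexData.f_refl]) (val1_id1 ..).symm
  α ij jk := freeα x ij jk
  s1_α _ _ := ext1 fun _ => (val1_s1_ops ..).trans (Eq.trans (by simp) (val1_comp1 ..).symm)
  t1_α _ _ := ext1 fun _ => (val1_t1_ops ..).trans (by simp)
  α_refl_left _ := ext2 fun _ =>
    Eq.trans (by simp [GraySimplexData.α_refl_left]) (val2_id2 ..).symm
  α_refl_right _ := ext2 fun _ =>
    Eq.trans (by simp [GraySimplexData.α_refl_right]) (val2_id2 ..).symm
  X ij jk kl := freeX x ij jk kl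
  s2_X _ _ _ := ext2 fun _ => (val2_s2_ops ..).trans (Eq.trans (by
    simp only [val3_freeX, val2_freeα, GraySimplexData.s2_X]
    congr 1
    exact Eq.trans (by simp) (val2_wl2 ..).symm) (val2_comp2 ..).symm)
  t2_X _ _ _ := ext2 fun _ => (val2_t2_ops ..).trans (Eq.trans (by
    simp only [val3_freeX, val2_freeα, GraySimplexData.t2_X]
    congr 1
    exact Eq.trans (by simp) (val2_wr2 ..).symm) (val2_comp2 ..).symm)
  X_refl_left _ _ := ext3 fun _ =>
    Eq.trans (by simp [GraySimplexData.X_refl_left]) (val3_id3 ..).symm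
  X_refl_mid _ _ := ext3 fun _ =>
    Eq.trans (by simp [GraySimplexData.X_refl_mid]) (val3_id3 ..).symm
  X_refl_right _ _ := ext3 fun _ =>
    Eq.trans (by simp [GraySimplexData.X_refl_right]) (val3_id3 ..).symm

/-- The generators are indexed by all vertices, edges, triangles and tetrahedra of all simplices,
without any identification. The expected relations hold nevertheless, because the components of a
generator are cells of actual simplices of nerves. -/
lemma map_freeSimplexData (k : StructuredArrow X grayNerve.{u}) :
    (freeSimplexData x).map (freeProj k).hom = (imageSimplex k x).toGraySimplexData := by
  apply GraySimplexData.ext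
  · ext i; exact val0_freeOb x i k
  · ext i j ij; exact val1_freeF x ij k
  · ext a b c ab bc; exact val2_freeα x ab bc k
  · ext a b c d ab bc cd; exact val3_freeX x ab bc cd k

/-- A simplex of the nerve of the free Gray-groupoid. -/
noncomputable def freeSimplex : GraySimplex X.freeGrayGpd.obj (Fin (m.unop.len + 1)) where
  toGraySimplexData := freeSimplexData x
  -- An equation of 3-cells is tested on components, where it is the pasting equation of the simplex
  -- `imageSimplex k x`.
  pasting_eq ab bc cd de := ext3 fun k => by
    have h := (imageSimplex k x).pasting_eq ab bc cd de
    rw [← map_freeSimplexData, GraySimplexData.map_pasting₁, GraySimplexData.map_pasting₂] at h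
    exact h

lemma map_freeSimplex (k : StructuredArrow X grayNerve.{u}) :
    (freeSimplex x).map (freeProj k).hom = imageSimplex k x :=
  GraySimplex.ext_data (map_freeSimplexData x k)

end

/-- The projections are jointly injective on cells, hence on simplices of the nerve. Naturality of
the unit is deduced from this. -/
lemma freeGrayGpd_simplex_ext {P : Type} [Preorder P] {y y' : GraySimplex X.freeGrayGpd.obj P}
    (h : ∀ k, y.map (freeProj k).hom = y'.map (freeProj k).hom) : y = y' := by
  apply GraySimplex.ext_data
  apply GraySimplexData.ext
  · ext i
    exact ext0 fun k => congr_arg (fun z => z.ob i) (h k)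
  · ext i j ij
    exact ext1 fun k => congr_arg (fun z => z.f ij) (h k)
  · ext i j l ij jl
    exact ext2 fun k => congr_arg (fun z => z.α ij jl) (h k)
  · ext i j l n ij jl ln
    exact ext3 fun k => congr_arg (fun z => z.X ij jl ln) (h k)

variable (X) in
/-- The unit of the adjunction between the free Gray-groupoid and the nerve. -/
noncomputable def freeUnit : X ⟶ grayNerve.obj X.freeGrayGpd where
  app _ := ↾fun x => freeSimplex x
  naturality m m' φ := by
    ext x
    refine freeGrayGpd_simplex_ext fun k => ?_
    exact ((map_freeSimplex _ k).trans (imageSimplex_map k φ x)).trans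
      (congr_arg (fun z => GraySimplex.reindex z φ.unop.toOrderHom) (map_freeSimplex x k)).symm

lemma freeUnit_comp_freeProj (k : StructuredArrow X grayNerve.{u}) :
    X.freeUnit ≫ grayNerve.map (freeProj k) = k.hom := by
  ext m x
  exact map_freeSimplex x k

/-- Equality after the unit says that the two Gray-functors agree on the cells of all the simplices
of `X`, and these are the generating cells. -/
lemma freeGrayGpd_hom_ext {B : GrayGpd.{u}} {F F' : X.freeGrayGpd ⟶ B}
    (h : X.freeUnit ≫ grayNerve.map F = X.freeUnit ≫ grayNerve.map F') : F = F' := by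
  have h' {m : SimplexCategoryᵒᵖ} (x : X.obj m) :
      (freeSimplex x).map F.hom = (freeSimplex x).map F'.hom :=
    ConcreteCategory.congr_hom (NatTrans.congr_app h m) x
  apply ObjectProperty.hom_ext
  refine generated_hom_ext fun n x => ?_
  match n, x with
  | 0, ⟨x, i⟩ =>
    intro y hy
    obtain rfl : y = freeOb x i := ext0 fun k => (hy k).trans (val0_freeOb x i k).symm
    exact congr_arg (fun z => z.ob i) (h' x)
  | 1, ⟨x, ij⟩ =>
    intro y hy
    obtain rfl : y = freeF x ij := ext1 fun k => (hy k).trans (val1_freeF x ij k).symm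
    exact congr_arg (fun z => z.f ij) (h' x)
  | 2, ⟨x, ij, jl⟩ =>
    intro y hy
    obtain rfl : y = freeα x ij jl := ext2 fun k => (hy k).trans (val2_freeα x ij jl k).symm
    exact congr_arg (fun z => z.α ij jl) (h' x)
  | _ + 3, ⟨x, ij, jl, ln⟩ =>
    intro y hy
    obtain rfl : y = freeX x ij jl ln := ext3 fun k => (hy k).trans (val3_freeX x ij jl ln k).symm
    exact congr_arg (fun z => z.X ij jl ln) (h' x)

variable (X) in
/-- The unit of the adjunction is an initial arrow from `X` to the nerve. -/
noncomputable def freeUnitIsInitial : Limits.IsInitial (StructuredArrow.mk X.freeUnit) :=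
  Limits.IsInitial.ofUniqueHom
    (fun k => StructuredArrow.homMk (freeProj k) (freeUnit_comp_freeProj k))
    (fun k F => StructuredArrow.hom_ext _ _
      (freeGrayGpd_hom_ext ((StructuredArrow.w F).trans (freeUnit_comp_freeProj k).symm)))

end SSet

/-! ### The nerve is a right Quillen functor. -/

/-- A left adjoint amounts to an initial object in each category of arrows from `X` to the nerve;
the unit `X.freeUnit` is one. -/
lemma isRightAdjoint_grayNerve : grayNerve.{u}.IsRightAdjoint :=
  have (X : SSet.{u}) : Limits.HasInitial (StructuredArrow X grayNerve.{u}) :=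
    X.freeUnitIsInitial.hasInitial
  isRightAdjointOfStructuredArrowInitials _

lemma fibration_grayNerve_map {A B : GrayGpd.{u}} (F : A ⟶ B) (hF : fibrations GrayGpd.{u} F) :
    fibrations SSet.{u} (grayNerve.map F) := by
  rw [SSet.modelCategoryQuillen.fibrations_eq]
  rintro _ _ _ hf
  simp only [SSet.modelCategoryQuillen.J, MorphismProperty.iSup_iff] at hf
  obtain ⟨n, ⟨i⟩⟩ := hf
  exact SSet.hasLiftingProperty_horn F hF n i

lemma rlp_grayNerve_map {A B : GrayGpd.{u}} (F : A ⟶ B)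
    (hF : trivialFibrations GrayGpd.{u} F) :
    SSet.modelCategoryQuillen.I.rlp (grayNerve.map F) := by
  rintro _ _ _ ⟨n⟩
  exact SSet.hasLiftingProperty_boundary F hF n

theorem mainTheorem5 :
    IsRightQuillen grayNerve.{u} ∧
      ∀ ⦃A B : GrayGpd.{u}⦄ (F : A ⟶ B), trivialFibrations GrayGpd.{u} F →
        SSet.modelCategoryQuillen.I.rlp (grayNerve.map F) := by
  refine ⟨⟨isRightAdjoint_grayNerve, fun _ _ F hF => fibration_grayNerve_map F hF,
    fun _ _ F hF => ⟨fibration_grayNerve_map F hF.1, ?_⟩⟩, fun _ _ F hF => rlp_grayNerve_map F hF⟩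
  exact SSet.isSimplicialWeakEquivalence_of_rlp (rlp_grayNerve_map F hF)
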